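/- Let $G$ be a group, $V$ a unitary representation of $G$ on a complex Hilbert space $\mathcal K$, and $\Gamma$ a conjugation (antiunitary involution) on $\mathcal K$. Let $F$ be the tensor flip of $\mathcal K\otimes\mathcal K$. Let $R$ be an invariant Yang--Baxter function, i.e. a strongly measurable, essentially bounded function $R:\mathbb R\to\mathcal B(\mathcal K\otimes\mathcal K)$ such that for almost all $\theta,\theta'\in\mathbb R$: $R(\theta)$ is unitary; $R(\theta)$ commutes with $V(g)\otimes V(g)$ for all $g\in G$; $(\Gamma\otimes\Gamma)F R(-\theta)F(\Gamma\otimes\Gamma)=R(\theta)$; $(R(\theta)\otimes1)(1\otimes R(\theta+\theta'))(R(\theta')\otimes1)=(1\otimes R(\theta'))(R(\theta+\theta')\otimes1)(1\otimes R(\theta))$; and $R(-\theta)=R(\theta)^{-1}$. Assume that $R$ is crossing-symmetric: $R$ is the boundary value (weakly, almost everywhere) of a bounded analytic function on the strip $0<\operatorname{Im}\theta<\pi$, also denoted $R$, whose boundary values on the upper edge satisfy, for all $\xi,\psi,\varphi,\xi'\in\mathcal K$ and almost all $\theta\in\mathbb R$, $$\langle\xi\otimes\psi,R(i\pi-\theta)(\varphi\otimes\xi')\rangle=\langle\psi\otimes\Gamma\xi',R(\theta)(\Gamma\xi\otimes\varphi)\rangle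 .$$ Let $\mathcal H_1=L^2(\mathbb R\to\mathcal K,d\theta)$ and let $\boldsymbol R$ be the operator on $\mathcal H_1\otimes\mathcal H_1\cong L^2(\mathbb R^2\to\mathcal K\otimes\mathcal K)$ given by $(\boldsymbol R\Psi)(\theta_1,\theta_2)=R(\theta_1-\theta_2)\Psi(\theta_2,\theta_1)$. The $\boldsymbol R$-symmetric Fock space is $\mathcal H^R=\bigoplus_{n\ge0}\mathcal H^R_n$, where $\mathcal H^R_n\subset\mathcal H_1^{\otimes n}$ is the subspace of vectors invariant under all operators $1^{\otimes j}\otimes\boldsymbol R\otimes1^{\otimes(n-j-2)}$, with orthogonal projection $P^R_n$. On vectors of finite particle number let $z_R^\dagger(\boldsymbol\xi)\boldsymbol\Psi_n=\sqrt{n+1}\,P^R_{n+1}(\boldsymbol\xi\otimes\boldsymbol\Psi_n)$ and $z_R(\boldsymbol\xi)=z_R^\dagger(\boldsymbol\xi)^*$, and let $\Theta$ be the antiunitary involution of $\mathcal H^R$ that acts on $\mathcal H_n^R$ as the restriction of $\boldsymbol\xi_1\otimes\cdots\otimes\boldsymbol\xi_n\mapsto\Theta_1\boldsymbol\xi_n\otimes\cdots\otimes\Theta_1\boldsymbol\xi_1$,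 where $(\Theta_1\boldsymbol\xi)(\theta)=\Gamma\,\boldsymbol\xi(\theta)$. For $f\in\mathscr S(\mathbb R)$ put $f^\pm(\theta)=\pm ie^\theta\int_{\mathbb R}e^{\pm iue^\theta}f(u)\,du$ and, for $k\in\mathcal K$, $$\phi_{R,k}(f)=z_R^\dagger(f^+\otimes k)+z_R(\overline{f^-}\otimes\Gamma k),\qquad \phi'_{R,k}(f)=\Theta\,\phi_{R,\Gamma k}(\overline{f_-})\,\Theta,\qquad \overline{f_-}(u)=\overline{f(-u)} .$$ Then for all $k,k'\in\mathcal K$, $[\phi_{R,k}(u),\phi'_{R,k'}(u')]=0$ for $u<u'$ in the sense of distributions on the space of vectors of finite particle number. That is, for all $f,g\in\mathscr S(\mathbb R)$ such that $u<u'$ whenever $f(u)\neq0$ and $g(u')\neq0$, and all vectors $\Psi\in\mathcal H^R$ of finite particle number, $$\phi_{R,k}(f)\,\phi'_{R,k'}(g)\,\Psi=\phi'_{R,k'}(g)\,\phi_{R,k}(f)\,\Psi .$$ -/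

import Mathlib

open MeasureTheory Filter Topology
open scoped TensorProduct SchwartzMap InnerProductSpace ComplexConjugate ENNReal

universe u v

noncomputable section

namespace YangBaxterQFT

section HilbertTensor

variable {E F G E' F' : Type*}
  [NormedAddCommGroup E] [InnerProductSpace ℂ E] [NormedAddCommGroup F] [InnerProductSpace ℂ F]
  [NormedAddCommGroup G] [InnerProductSpace ℂ G]
  [NormedAddCommGroup E'] [InnerProductSpace ℂ E'] [NormedAddCommGroup F'] [InnerProductSpace ℂ F']

/-- The Hilbert space tensor product: the completion of the algebraic tensor product with respect
to `⟪a ⊗ b, c ⊗ d⟫ = ⟪a, c⟫ * ⟪b, d⟫`. -/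
def HTensor (E F : Type*) [NormedAddCommGroup E] [InnerProductSpace ℂ E]
    [NormedAddCommGroup F] [InnerProductSpace ℂ F] : Type _ :=
  UniformSpace.Completion (E ⊗[ℂ] F)

instance : NormedAddCommGroup (HTensor E F) :=
  inferInstanceAs (NormedAddCommGroup (UniformSpace.Completion (E ⊗[ℂ] F)))

instance : InnerProductSpace ℂ (HTensor E F) :=
  inferInstanceAs (InnerProductSpace ℂ (UniformSpace.Completion (E ⊗[ℂ] F)))

instance : CompleteSpace (HTensor E F) :=
  inferInstanceAs (CompleteSpace (UniformSpace.Completion (E ⊗[ℂ] F)))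

/-- The inclusion of the algebraic tensor product. -/
def ofAlg (E F : Type*) [NormedAddCommGroup E] [InnerProductSpace ℂ E]
    [NormedAddCommGroup F] [InnerProductSpace ℂ F] : E ⊗[ℂ] F →ₗᵢ[ℂ] HTensor E F :=
  (UniformSpace.Completion.toComplₗᵢ : E ⊗[ℂ] F →ₗᵢ[ℂ] UniformSpace.Completion (E ⊗[ℂ] F))

theorem denseRange_ofAlg (E F : Type*) [NormedAddCommGroup E] [InnerProductSpace ℂ E]
    [NormedAddCommGroup F] [InnerProductSpace ℂ F] : DenseRange (ofAlg E F) :=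
  UniformSpace.Completion.denseRange_coe

/-- The extension by continuity of a bounded (anti)linear map on the algebraic tensor product. -/
def extendT {σ : ℂ →+* ℂ} [CompleteSpace G]
    (A : E ⊗[ℂ] F →SL[σ] G) : HTensor E F →SL[σ] G :=
  A.extend (ofAlg E F).toContinuousLinearMap

theorem extendT_ofAlg {σ : ℂ →+* ℂ} [CompleteSpace G] (A : E ⊗[ℂ] F →SL[σ] G) (x : E ⊗[ℂ] F) : extendT A (ofAlg E F x) = A x :=
  ContinuousLinearMap.extend_eq A (e := (ofAlg E F).toContinuousLinearMap)
    (denseRange_ofAlg E F) (ofAlg E F).isometry.isUniformInducing x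

/-- The pure tensor `x ⊗ y`, as a continuous bilinear map. -/
def tmulL (E F : Type*) [NormedAddCommGroup E] [InnerProductSpace ℂ E]
    [NormedAddCommGroup F] [InnerProductSpace ℂ F] : E →L[ℂ] F →L[ℂ] HTensor E F :=
  (ContinuousLinearMap.compL ℂ F (E ⊗[ℂ] F) (HTensor E F) (ofAlg E F).toContinuousLinearMap) ∘L
    TensorProduct.mkL ℂ E F

/-- The pure tensor `x ⊗ y` in the Hilbert space tensor product. -/
def tmul (x : E) (y : F) : HTensor E F := ofAlg E F (x ⊗ₜ[ℂ] y)

/-- The tensor product `A ⊗ B` of bounded operators. -/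
def mapT (A : E →L[ℂ] E') (B : F →L[ℂ] F') : HTensor E F →L[ℂ] HTensor E' F' :=
  extendT ((ofAlg E' F').toContinuousLinearMap ∘L TensorProduct.mapL A B)

/-- The tensor flip `x ⊗ y ↦ y ⊗ x`. -/
def flipT (E F : Type*) [NormedAddCommGroup E] [InnerProductSpace ℂ E]
    [NormedAddCommGroup F] [InnerProductSpace ℂ F] : HTensor E F →L[ℂ] HTensor F E :=
  extendT ((ofAlg F E).comp
    (TensorProduct.commIsometry ℂ E F).toLinearIsometry).toContinuousLinearMap

theorem mapT_tmul (A : E →L[ℂ] E') (B : F →L[ℂ] F') (x : E) (y : F) :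
    mapT A B (tmul x y) = tmul (A x) (B y) := by
  rw [mapT, tmul, extendT_ofAlg]; rfl

theorem flipT_tmul (x : E) (y : F) : flipT E F (tmul x y) = tmul y x := by
  rw [flipT, tmul, extendT_ofAlg]; rfl

theorem inner_conj_conj (A : E →ₗᵢ⋆[ℂ] E') (a b : E) : inner ℂ (A a) (A b) = inner ℂ b a := by
  have hI : ∀ z : E, A (Complex.I • z) = -(Complex.I • A z) := by
    intro z; rw [map_smulₛₗ]; simp
  rw [inner_eq_sum_norm_sq_div_four, inner_eq_sum_norm_sq_div_four]
  have e1 : ‖A a + A b‖ = ‖b + a‖ := by rw [← map_add, A.norm_map, add_comm]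
  have e2 : ‖A a - A b‖ = ‖b - a‖ := by rw [← map_sub, A.norm_map, norm_sub_rev]
  have e3 : ‖A a - Complex.I • A b‖ = ‖b - Complex.I • a‖ := by
    have : A a - Complex.I • A b = A (a + Complex.I • b) := by rw [map_add, hI]; abel
    rw [this, A.norm_map]
    have : b - Complex.I • a = (-Complex.I) • (a + Complex.I • b) := by
      rw [smul_add, smul_smul]; simp [sub_eq_add_neg, add_comm]
    rw [this, norm_smul]; simp
  have e4 : ‖A a + Complex.I • A b‖ = ‖b + Complex.I • a‖ := by
    have : A a + Complex.I • A b = A (a - Complex.I • b) := by rw [map_sub, hI]; abel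
    rw [this, A.norm_map]
    have : b + Complex.I • a = Complex.I • (a - Complex.I • b) := by
      rw [smul_sub, smul_smul]; simp [sub_eq_add_neg, add_comm]
    rw [this, norm_smul]; simp
  simp only [RCLike.I_to_complex] at *
  rw [e1, e2, e3, e4]

theorem inner_map_conj (A : E →ₗᵢ⋆[ℂ] E') (B : F →ₗᵢ⋆[ℂ] F') (x y : E ⊗[ℂ] F) :
    inner ℂ (TensorProduct.map A.toLinearMap B.toLinearMap x)
      (TensorProduct.map A.toLinearMap B.toLinearMap y) = inner ℂ y x := by
  induction x using TensorProduct.induction_on with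
  | zero => simp
  | add a b ha hb => simp only [map_add, inner_add_left, inner_add_right, ha, hb]
  | tmul a b =>
    induction y using TensorProduct.induction_on with
    | zero => simp
    | add c d hc hd => simp only [map_add, inner_add_left, inner_add_right, hc, hd]
    | tmul c d =>
      simp only [TensorProduct.map_tmul, TensorProduct.inner_tmul]
      exact congrArg₂ _ (inner_conj_conj A a c) (inner_conj_conj B b d)

/-- The tensor product `A ⊗ B` of antilinear isometries, on the algebraic tensor product. -/
def algMapConj (A : E →ₗᵢ⋆[ℂ] E') (B : F →ₗᵢ⋆[ℂ] F') : E ⊗[ℂ] F →ₗᵢ⋆[ℂ] E' ⊗[ℂ] F' where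
  toLinearMap := TensorProduct.map A.toLinearMap B.toLinearMap
  norm_map' x := by
    rw [@norm_eq_sqrt_re_inner ℂ, @norm_eq_sqrt_re_inner ℂ, inner_map_conj]

/-- The tensor product `A ⊗ B` of antilinear isometries: the antilinear isometry with
`x ⊗ y ↦ A x ⊗ B y`. -/
def mapConjT (A : E →ₗᵢ⋆[ℂ] E') (B : F →ₗᵢ⋆[ℂ] F') : HTensor E F →ₗᵢ⋆[ℂ] HTensor E' F' where
  toLinearMap := (extendT ((ofAlg E' F').toContinuousLinearMap.comp
    (algMapConj A B).toContinuousLinearMap)).toLinearMap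
  norm_map' x := by
    refine (denseRange_ofAlg E F).induction_on x (isClosed_eq
      (ContinuousLinearMap.continuous _).norm continuous_norm) fun a => ?_
    rw [ContinuousLinearMap.coe_coe, extendT_ofAlg]
    simp

theorem mapConjT_tmul (A : E →ₗᵢ⋆[ℂ] E') (B : F →ₗᵢ⋆[ℂ] F') (x : E) (y : F) :
    mapConjT A B (tmul x y) = tmul (A x) (B y) :=
  extendT_ofAlg ((ofAlg E' F').toContinuousLinearMap.comp
    (algMapConj A B).toContinuousLinearMap) (x ⊗ₜ[ℂ] y)

theorem denseRange_tensor {A : E →ₗ[ℂ] E'} {B : F →ₗ[ℂ] F'} (hA : DenseRange A)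
    (hB : DenseRange B) :
    DenseRange (TensorProduct.map A B) := by
  have h : (LinearMap.range (TensorProduct.map A B)).topologicalClosure = ⊤ := by
    rw [eq_top_iff]
    rintro x -
    induction x using TensorProduct.induction_on with
    | zero => exact zero_mem _
    | add a b ha hb => exact add_mem ha hb
    | tmul a b =>
      have hc : IsClosed {p : E' × F' | p.1 ⊗ₜ[ℂ] p.2 ∈
          (LinearMap.range (TensorProduct.map A B)).topologicalClosure} :=
        (Submodule.isClosed_topologicalClosure _).preimage TensorProduct.continuous_tmul
      have := (hA.prodMap hB).induction_on (p := fun p : E' × F' => p.1 ⊗ₜ[ℂ] p.2 ∈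
          (LinearMap.range (TensorProduct.map A B)).topologicalClosure) (a, b) hc (by
        rintro ⟨x, y⟩
        exact Submodule.le_topologicalClosure _ ⟨x ⊗ₜ y, rfl⟩)
      exact this
  intro x
  have : x ∈ (LinearMap.range (TensorProduct.map A B)).topologicalClosure := h ▸ trivial
  rw [← SetLike.mem_coe, Submodule.topologicalClosure_coe, LinearMap.coe_range] at this
  exact this

/-- The associator `(x ⊗ y) ⊗ z ↦ x ⊗ (y ⊗ z)`. -/
def assocT (E F G : Type*) [NormedAddCommGroup E] [InnerProductSpace ℂ E]
    [NormedAddCommGroup F] [InnerProductSpace ℂ F] [NormedAddCommGroup G] [InnerProductSpace ℂ G] :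
    HTensor (HTensor E F) G ≃ₗᵢ[ℂ] HTensor E (HTensor F G) :=
  (TensorProduct.assoc ℂ E F G).extendOfIsometry
    ((ofAlg (HTensor E F) G).toLinearMap ∘ₗ
      TensorProduct.map (ofAlg E F).toLinearMap (LinearIsometry.id (R := ℂ) (E := G)).toLinearMap)
    ((ofAlg E (HTensor F G)).toLinearMap ∘ₗ
      TensorProduct.map (LinearIsometry.id (R := ℂ) (E := E)).toLinearMap (ofAlg F G).toLinearMap)
    ((denseRange_ofAlg _ _).comp
      (denseRange_tensor (denseRange_ofAlg E F) Function.surjective_id.denseRange)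
      (ofAlg _ _).continuous)
    ((denseRange_ofAlg _ _).comp
      (denseRange_tensor Function.surjective_id.denseRange (denseRange_ofAlg F G))
      (ofAlg _ _).continuous)
    (by
      intro x
      simp only [LinearMap.comp_apply, LinearIsometry.coe_toLinearMap, LinearIsometry.norm_map,
        TensorProduct.norm_map]
      exact (TensorProduct.assocIsometry ℂ E F G).norm_map x)

theorem assocT_tmul (x : E) (y : F) (z : G) :
    assocT E F G (tmul (tmul x y) z) = tmul x (tmul y z) :=
  LinearEquiv.extendOfIsometry_eq _ _ _ _ _ _ ((x ⊗ₜ[ℂ] y) ⊗ₜ[ℂ] z)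

/-- `T ⊗ 1` acting on the first two factors of `E ⊗ (E ⊗ G)`. -/
def leftAmp (G : Type*) [NormedAddCommGroup G] [InnerProductSpace ℂ G]
    (T : HTensor E E →L[ℂ] HTensor E E) :
    HTensor E (HTensor E G) →L[ℂ] HTensor E (HTensor E G) :=
  (assocT E E G).toContinuousLinearEquiv.toContinuousLinearMap ∘L
    mapT T (ContinuousLinearMap.id ℂ G) ∘L
    (assocT E E G).symm.toContinuousLinearEquiv.toContinuousLinearMap

end HilbertTensor

section Power

/-- A bundled Hilbert space, used to define tensor powers by recursion. -/
structure HilbertSp where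
  carrier : Type u
  [grp : NormedAddCommGroup carrier]
  [ips : InnerProductSpace ℂ carrier]
  [cpl : CompleteSpace carrier]

variable (H : Type u) [NormedAddCommGroup H] [InnerProductSpace ℂ H]

attribute [local instance] HilbertSp.grp HilbertSp.ips HilbertSp.cpl

/-- `H^{⊗0} = ℂ` (as the one-dimensional Euclidean space in the universe of `H`) and
`H^{⊗(n+1)} = H ⊗ H^{⊗n}`. -/
def powBundle : ℕ → HilbertSp.{u}
  | 0 => ⟨EuclideanSpace ℂ PUnit.{u + 1}⟩
  | n + 1 => ⟨HTensor H (powBundle n).carrier⟩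

/-- The `n`-th Hilbert space tensor power `H^{⊗n}`. -/
def Pow (n : ℕ) : Type u := (powBundle H n).carrier

instance (n : ℕ) : NormedAddCommGroup (Pow H n) := (powBundle H n).grp
instance (n : ℕ) : InnerProductSpace ℂ (Pow H n) := (powBundle H n).ips
instance (n : ℕ) : CompleteSpace (Pow H n) := (powBundle H n).cpl

/-- The identity `H ⊗ H^{⊗n} = H^{⊗(n+1)}`. -/
def powCons (n : ℕ) : HTensor H (Pow H n) ≃ₗᵢ[ℂ] Pow H (n + 1) :=
  LinearIsometryEquiv.refl ℂ (HTensor H (Pow H n))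

/-- The identity `H^{⊗0} = ℂ`. -/
def powZero : EuclideanSpace ℂ PUnit.{u + 1} ≃ₗᵢ[ℂ] Pow H 0 :=
  LinearIsometryEquiv.refl ℂ (EuclideanSpace ℂ PUnit.{u + 1})

variable {H}

/-- For `T` on `H ⊗ H`, the operator `1^{⊗j} ⊗ T ⊗ 1^{⊗(n-j-2)}` on `H^{⊗n}`, which represents the
transposition of the factors `j` and `j + 1` (factors are counted from `0`). It is the identity if
`n ≤ j + 1`. -/
def leg (T : HTensor H H →L[ℂ] HTensor H H) : (n : ℕ) → ℕ → (Pow H n →L[ℂ] Pow H n)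
  | 0, _ => ContinuousLinearMap.id ℂ _
  | 1, _ => ContinuousLinearMap.id ℂ _
  | n + 2, 0 =>
    let e : HTensor H (HTensor H (Pow H n)) ≃L[ℂ] Pow H (n + 2) :=
      (powCons H (n + 1)).toContinuousLinearEquiv
    e.toContinuousLinearMap ∘L leftAmp (Pow H n) T ∘L e.symm.toContinuousLinearMap
  | n + 2, j + 1 =>
    let e := (powCons H (n + 1)).toContinuousLinearEquiv
    e.toContinuousLinearMap ∘L mapT (ContinuousLinearMap.id ℂ H) (leg T (n + 1) j) ∘L
      e.symm.toContinuousLinearMap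

/-- Appending a factor on the right: `(x₁ ⊗ ⋯ ⊗ xₙ) ⊗ y ↦ x₁ ⊗ ⋯ ⊗ xₙ ⊗ y`. -/
def powSnoc (H : Type u) [NormedAddCommGroup H] [InnerProductSpace ℂ H] :
    (n : ℕ) → (HTensor (Pow H n) H →L[ℂ] Pow H (n + 1))
  | 0 => (powCons H 0).toContinuousLinearEquiv.toContinuousLinearMap ∘L flipT (Pow H 0) H
  | n + 1 => (powCons H (n + 1)).toContinuousLinearEquiv.toContinuousLinearMap ∘L
      mapT (ContinuousLinearMap.id ℂ H) (powSnoc H n) ∘L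
      (assocT H (Pow H n) H).toContinuousLinearEquiv.toContinuousLinearMap ∘L
      mapT (powCons H n).symm.toContinuousLinearEquiv.toContinuousLinearMap
        (ContinuousLinearMap.id ℂ H)

/-- The total reversal `x₁ ⊗ ⋯ ⊗ xₙ ↦ xₙ ⊗ ⋯ ⊗ x₁`. -/
def powRev (H : Type u) [NormedAddCommGroup H] [InnerProductSpace ℂ H] :
    (n : ℕ) → (Pow H n →L[ℂ] Pow H n)
  | 0 => ContinuousLinearMap.id ℂ _
  | n + 1 => powSnoc H n ∘L mapT (powRev H n) (ContinuousLinearMap.id ℂ H) ∘L flipT H (Pow H n) ∘L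
      (powCons H n).symm.toContinuousLinearEquiv.toContinuousLinearMap

/-- Complex conjugation on the one-dimensional space `H^{⊗0} = ℂ`. -/
def euclConj : EuclideanSpace ℂ PUnit.{u + 1} →ₗᵢ⋆[ℂ] EuclideanSpace ℂ PUnit.{u + 1} where
  toFun x := WithLp.toLp 2 fun i => conj (x i)
  map_add' x y := by ext i; simp
  map_smul' c x := by ext i; simp
  norm_map' x := by simp [EuclideanSpace.norm_eq]

/-- The antilinear map `A^{⊗n}`, for an antilinear isometry `A`. -/
def powConj (A : H →ₗᵢ⋆[ℂ] H) : (n : ℕ) → (Pow H n →ₗᵢ⋆[ℂ] Pow H n)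
  | 0 => (powZero H).toLinearIsometry.comp (euclConj.comp (powZero H).symm.toLinearIsometry)
  | n + 1 => (powCons H n).toLinearIsometry.comp
      ((mapConjT A (powConj A n)).comp (powCons H n).symm.toLinearIsometry)

end Power

section Fock

variable {H : Type u} [NormedAddCommGroup H] [InnerProductSpace ℂ H]
  (T : HTensor H H →L[ℂ] HTensor H H)

/-- The `T`-symmetric `n`-particle space `H_n^T ⊆ H^{⊗n}`: the vectors that are invariant under the
representatives of all elementary transpositions, hence, when these generate a representation of
the symmetric group, the vectors on which that representation acts trivially. -/
def symSpace (n : ℕ) : Submodule ℂ (Pow H n) where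
  carrier := {Ψ | ∀ j, leg T n j Ψ = Ψ}
  add_mem' ha hb j := by rw [map_add, ha j, hb j]
  zero_mem' j := map_zero _
  smul_mem' c x hx j := by rw [map_smul, hx j]

instance (n : ℕ) : CompleteSpace (symSpace T n) := by
  refine IsComplete.completeSpace_coe (s := (symSpace T n : Set (Pow H n)))
    (IsClosed.isComplete ?_)
  have : (symSpace T n : Set (Pow H n)) = ⋂ j, {Ψ | leg T n j Ψ = Ψ} := by
    ext; simp [symSpace]
  rw [this]
  exact isClosed_iInter fun j => isClosed_eq (leg T n j).continuous continuous_id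

/-- The orthogonal projection `P_n^T` of `H^{⊗n}` onto `H_n^T`. For a unitary representation of the
symmetric group this is the mean over the group. -/
def symProj (n : ℕ) : Pow H n →L[ℂ] symSpace T n := (symSpace T n).orthogonalProjectionOnto

/-- The `T`-symmetric Fock space, the Hilbert space direct sum of the spaces `H_n^T`. -/
abbrev Fock : Type u := lp (fun n : ℕ => symSpace T n) 2

/-- The vectors of finite particle number. -/
def finPart : Submodule ℂ (Fock T) where
  carrier := {Ψ | {n : ℕ | Ψ n ≠ 0}.Finite}
  add_mem' {a b} ha hb := (ha.union hb).subset fun n hn => by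
    by_contra h
    simp only [Set.mem_union, Set.mem_ofPred_eq, not_or, not_not] at h
    exact hn (by rw [lp.coeFn_add, Pi.add_apply, h.1, h.2, add_zero])
  zero_mem' := by simp
  smul_mem' c x hx := hx.subset fun n hn h => hn (by rw [lp.coeFn_smul, Pi.smul_apply, h, smul_zero])

variable {T}

/-- The vector of finite particle number with given `n`-particle components. -/
def mkFin (Ψ : ∀ n, symSpace T n) (h : {n : ℕ | Ψ n ≠ 0}.Finite) : finPart T :=
  ⟨⟨Ψ, (memℓp_zero h).of_exponent_ge (zero_le)⟩, h⟩

variable (T)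

/-- The operator on vectors of finite particle number with
`(a Ψ)_{n+1} = A_n Ψ_n` and `(a Ψ)_0 = 0`. -/
def raiseOp (A : ∀ n, symSpace T n →L[ℂ] symSpace T (n + 1)) : finPart T →ₗ[ℂ] finPart T where
  toFun Ψ := mkFin (fun m => match m with
      | 0 => 0
      | n + 1 => A n ((Ψ : Fock T) n))
    ((Ψ.2.image Nat.succ).subset fun m hm => by
      cases m with
      | zero => exact absurd rfl hm
      | succ n => exact ⟨n, fun h => hm (by simp only [h, map_zero]), rfl⟩)
  map_add' Ψ Φ := by
    ext m
    cases m with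
    | zero => exact congrArg Subtype.val (add_zero (0 : symSpace T 0)).symm
    | succ n => exact congrArg Subtype.val (map_add (A n) _ _)
  map_smul' c Ψ := by
    ext m
    cases m <;> simp [mkFin]

/-- The operator on vectors of finite particle number with `(b Ψ)_n = B_n Ψ_{n+1}`. -/
def lowerOp (B : ∀ n, symSpace T (n + 1) →L[ℂ] symSpace T n) : finPart T →ₗ[ℂ] finPart T where
  toFun Ψ := mkFin (fun n => B n ((Ψ : Fock T) (n + 1)))
    ((Ψ.2.image Nat.pred).subset fun n hn =>
      ⟨n + 1, fun h => hn (by simp only [h, map_zero]), rfl⟩)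
  map_add' Ψ Φ := by
    ext m
    exact congrArg Subtype.val (map_add (B m) _ _)
  map_smul' c Ψ := by
    ext m
    simp [mkFin]

/-- The antilinear operator on vectors of finite particle number with `(J Ψ)_n = J_n Ψ_n`. -/
def diagConjOp (J : ∀ n, symSpace T n →L⋆[ℂ] symSpace T n) : finPart T →ₗ⋆[ℂ] finPart T where
  toFun Ψ := mkFin (fun n => J n ((Ψ : Fock T) n))
    (Ψ.2.subset fun n hn h => hn (by simp only [h, map_zero]))
  map_add' Ψ Φ := by
    ext m
    exact congrArg Subtype.val (map_add (J m) _ _)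
  map_smul' c Ψ := by
    ext m
    simp [mkFin]

/-- `Ψ_n ↦ √(n+1) P_{n+1} (ξ ⊗ Ψ_n)`. -/
def createN (ξ : H) (n : ℕ) : symSpace T n →L[ℂ] symSpace T (n + 1) :=
  ((Real.sqrt (n + 1) : ℝ) : ℂ) •
    (symProj T (n + 1) ∘L (powCons H n).toContinuousLinearEquiv.toContinuousLinearMap ∘L
      tmulL H (Pow H n) ξ ∘L (symSpace T n).subtypeL)

/-- The creation operator `z†(ξ)` on vectors of finite particle number. -/
def create (ξ : H) : finPart T →ₗ[ℂ] finPart T := raiseOp T (createN T ξ)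

/-- The annihilation operator `z(ξ) = z†(ξ)^*` on vectors of finite particle number. -/
def annihilate (ξ : H) : finPart T →ₗ[ℂ] finPart T :=
  lowerOp T fun n => ContinuousLinearMap.adjoint (createN T ξ n)

theorem inner_annihilate (ξ : H) (Ψ Φ : finPart T) :
    inner ℂ (annihilate T ξ Ψ) Φ = inner ℂ Ψ (create T ξ Φ) := by
  change inner ℂ (annihilate T ξ Ψ : Fock T) (Φ : Fock T) =
    inner ℂ (Ψ : Fock T) (create T ξ Φ : Fock T)
  rw [lp.inner_eq_tsum, lp.inner_eq_tsum]
  rw [(lp.summable_inner (𝕜 := ℂ) (Ψ : Fock T) (create T ξ Φ : Fock T)).tsum_eq_zero_add]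
  have h0 : (create T ξ Φ : Fock T) 0 = 0 := rfl
  rw [h0, inner_zero_right, zero_add]
  exact tsum_congr fun n => ContinuousLinearMap.adjoint_inner_left _ _ _

/-- The second quantization `Θ` of an antilinear isometry `J` of `H` (on vectors of finite particle
number), given on `H_n^T` by `P_n^T J^{⊗n} F_n` with `F_n` the total reversal. When `T` commutes
with `(J ⊗ J) F_2`, the operator `J^{⊗n} F_n` commutes with the projection `P_n^T`, and this is the
restriction of `J^{⊗n} F_n` to `H_n^T`. -/
def secondQuantConj (J : H →ₗᵢ⋆[ℂ] H) : finPart T →ₗ⋆[ℂ] finPart T :=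
  diagConjOp T fun n => (symProj T n).comp ((powConj J n).toContinuousLinearMap.comp
    (powRev H n ∘L (symSpace T n).subtypeL))

end Fock


section OneParticle

variable (K : Type u) [NormedAddCommGroup K] [InnerProductSpace ℂ K]

/-- The one-particle space `L²(ℝ → K, dθ)`. -/
abbrev OneP : Type u := Lp K 2 (volume : Measure ℝ)

/-- The space `L²(ℝ² → K ⊗ K, dθ₁ dθ₂)`. -/
abbrev TwoP : Type u := Lp (HTensor K K) 2 (volume : Measure (ℝ × ℝ))

variable {K}

theorem norm_tmul (x y : K) : ‖tmul x y‖ = ‖x‖ * ‖y‖ := by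
  rw [tmul, LinearIsometry.norm_map, TensorProduct.norm_tmul]

theorem inner_tmul (x y x' y' : K) :
    inner ℂ (tmul x y) (tmul x' y') = inner ℂ x x' * inner ℂ y y' := by
  rw [tmul, tmul, LinearIsometry.inner_map_map, TensorProduct.inner_tmul]

theorem memLp_prodTensor (ξ η : OneP K) :
    MemLp (fun p : ℝ × ℝ => tmul (ξ p.1) (η p.2)) 2 volume := by
  have h1 : AEStronglyMeasurable (fun p : ℝ × ℝ => ξ p.1) volume :=
    (Lp.aestronglyMeasurable ξ).comp_quasiMeasurePreserving Measure.quasiMeasurePreserving_fst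
  have h2 : AEStronglyMeasurable (fun p : ℝ × ℝ => η p.2) volume :=
    (Lp.aestronglyMeasurable η).comp_quasiMeasurePreserving Measure.quasiMeasurePreserving_snd
  have hm : AEStronglyMeasurable (fun p : ℝ × ℝ => tmul (ξ p.1) (η p.2)) volume :=
    (tmulL K K).aestronglyMeasurable_comp₂ h1 h2
  rw [memLp_two_iff_integrable_sq_norm hm]
  simp only [norm_tmul, mul_pow]
  exact Integrable.mul_prod ((memLp_two_iff_integrable_sq_norm (Lp.aestronglyMeasurable ξ)).1
    (Lp.memLp ξ)) ((memLp_two_iff_integrable_sq_norm (Lp.aestronglyMeasurable η)).1 (Lp.memLp η))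

theorem ae_fst {p : ℝ → Prop} (h : ∀ᵐ x, p x) : ∀ᵐ z : ℝ × ℝ, p z.1 :=
  Measure.quasiMeasurePreserving_fst.ae h

theorem ae_snd {p : ℝ → Prop} (h : ∀ᵐ x, p x) : ∀ᵐ z : ℝ × ℝ, p z.2 :=
  Measure.quasiMeasurePreserving_snd.ae h

/-- The bilinear map that sends `ξ, η` to the function `(θ₁, θ₂) ↦ ξ(θ₁) ⊗ η(θ₂)`. -/
def prodTensor : OneP K →ₗ[ℂ] OneP K →ₗ[ℂ] TwoP K :=
  LinearMap.mk₂ ℂ (fun ξ η => (memLp_prodTensor ξ η).toLp _)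
    (fun ξ ξ' η => by
      ext1
      filter_upwards [(memLp_prodTensor (ξ + ξ') η).coeFn_toLp, (memLp_prodTensor ξ η).coeFn_toLp,
        (memLp_prodTensor ξ' η).coeFn_toLp, ae_fst (Lp.coeFn_add ξ ξ'),
        Lp.coeFn_add ((memLp_prodTensor ξ η).toLp _) ((memLp_prodTensor ξ' η).toLp _)]
        with p h1 h2 h3 h4 h5
      rw [h1, h5, Pi.add_apply, h2, h3, h4]
      exact (tmulL K K).map_add₂ _ _ _)
    (fun c ξ η => by
      ext1
      filter_upwards [(memLp_prodTensor (c • ξ) η).coeFn_toLp, (memLp_prodTensor ξ η).coeFn_toLp,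
        ae_fst (Lp.coeFn_smul c ξ), Lp.coeFn_smul c ((memLp_prodTensor ξ η).toLp _)]
        with p h1 h2 h3 h4
      rw [h1, h4, Pi.smul_apply, h2, h3]
      exact (tmulL K K).map_smul₂ _ _ _)
    (fun ξ η η' => by
      ext1
      filter_upwards [(memLp_prodTensor ξ (η + η')).coeFn_toLp, (memLp_prodTensor ξ η).coeFn_toLp,
        (memLp_prodTensor ξ η').coeFn_toLp, ae_snd (Lp.coeFn_add η η'),
        Lp.coeFn_add ((memLp_prodTensor ξ η).toLp _) ((memLp_prodTensor ξ η').toLp _)]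
        with p h1 h2 h3 h4 h5
      rw [h1, h5, Pi.add_apply, h2, h3, h4]
      exact map_add (tmulL K K _) _ _)
    (fun c ξ η => by
      ext1
      filter_upwards [(memLp_prodTensor ξ (c • η)).coeFn_toLp, (memLp_prodTensor ξ η).coeFn_toLp,
        ae_snd (Lp.coeFn_smul c η), Lp.coeFn_smul c ((memLp_prodTensor ξ η).toLp _)]
        with p h1 h2 h3 h4
      rw [h1, h4, Pi.smul_apply, h2, h3]
      exact map_smul (tmulL K K _) _ _)

theorem prodTensor_coeFn (ξ η : OneP K) :
    prodTensor ξ η =ᵐ[volume] fun p : ℝ × ℝ => tmul (ξ p.1) (η p.2) :=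
  (memLp_prodTensor ξ η).coeFn_toLp

theorem inner_prodTensor (ξ η ξ' η' : OneP K) :
    inner ℂ (prodTensor ξ η) (prodTensor ξ' η') = inner ℂ ξ ξ' * inner ℂ η η' := by
  rw [L2.inner_def, L2.inner_def, L2.inner_def]
  have : ∫ p : ℝ × ℝ, inner ℂ (prodTensor ξ η p) (prodTensor ξ' η' p) =
      ∫ p : ℝ × ℝ, inner ℂ (ξ p.1) (ξ' p.1) * inner ℂ (η p.2) (η' p.2) := by
    refine integral_congr_ae ?_
    filter_upwards [prodTensor_coeFn ξ η, prodTensor_coeFn ξ' η'] with p h1 h2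
    rw [h1, h2, inner_tmul]
  rw [this]
  exact integral_prod_mul (fun x => inner ℂ (ξ x) (ξ' x)) (fun x => inner ℂ (η x) (η' x))

/-- The canonical map on the algebraic tensor product. -/
def algTwoP : OneP K ⊗[ℂ] OneP K →ₗᵢ[ℂ] TwoP K :=
  (TensorProduct.lift (prodTensor (K := K))).isometryOfInner fun x y => by
    induction x using TensorProduct.induction_on with
    | zero => simp
    | add a b ha hb => simp only [map_add, inner_add_left, ha, hb]
    | tmul a b =>
      induction y using TensorProduct.induction_on with
      | zero => simp
      | add c d hc hd => simp only [map_add, inner_add_right, hc, hd]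
      | tmul c d =>
        simp only [TensorProduct.lift.tmul, TensorProduct.inner_tmul]
        exact inner_prodTensor a b c d

/-- The canonical unitary identification `L²(ℝ → K) ⊗ L²(ℝ → K) ≅ L²(ℝ² → K ⊗ K)` which sends
`ξ ⊗ η` to the function `(θ₁, θ₂) ↦ ξ(θ₁) ⊗ η(θ₂)`. -/
def twoPMap (K : Type u) [NormedAddCommGroup K] [InnerProductSpace ℂ K] :
    HTensor (OneP K) (OneP K) →L[ℂ] TwoP K :=
  extendT algTwoP.toContinuousLinearMap

/-- A measurable field of bounded operators acts on measurable functions. -/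
theorem aestronglyMeasurable_field {X E : Type*} [MeasurableSpace X] {μ : Measure X}
    [NormedAddCommGroup E] [NormedSpace ℂ E] {S : X → E →L[ℂ] E}
    (hS : ∀ x, AEStronglyMeasurable (fun t => S t x) μ) {f : X → E}
    (hf : AEStronglyMeasurable f μ) : AEStronglyMeasurable (fun t => S t (f t)) μ := by
  have key : ∀ s : SimpleFunc X E, AEStronglyMeasurable (fun t => S t (s t)) μ := by
    intro s
    induction s using SimpleFunc.induction with
    | const c hs =>
      refine ((hS c).indicator hs).congr (Eventually.of_forall fun t => ?_)
      simp only [SimpleFunc.coe_piecewise, SimpleFunc.coe_const, Set.piecewise, Set.indicator,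
        Function.const_apply]
      split_ifs <;> simp
    | add h hf hg =>
      refine (hf.add hg).congr (Eventually.of_forall fun t => ?_)
      simp
  refine AEStronglyMeasurable.congr ?_
    (f := fun t => S t (hf.mk f t)) (hf.ae_eq_mk.mono fun t ht => by simp only [ht])
  refine aestronglyMeasurable_of_tendsto_ae atTop
    (fun n => key (hf.stronglyMeasurable_mk.approx n)) (Eventually.of_forall fun t => ?_)
  exact ((S t).continuous.tendsto _).comp (hf.stronglyMeasurable_mk.tendsto_approx t)

theorem memLp_field {R : ℝ → HTensor K K →L[ℂ] HTensor K K}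
    (hm : ∀ x, AEStronglyMeasurable (fun θ => R θ x) volume)
    (hu : ∀ᵐ θ : ℝ, R θ ∈ unitary (HTensor K K →L[ℂ] HTensor K K)) (Ψ : TwoP K) :
    MemLp (fun p : ℝ × ℝ => R (p.1 - p.2) (Ψ p)) 2 volume := by
  have hq : Measure.QuasiMeasurePreserving (fun p : ℝ × ℝ => p.1 - p.2)
      (volume : Measure (ℝ × ℝ)) volume := quasiMeasurePreserving_sub volume volume
  refine (Lp.memLp Ψ).of_le (aestronglyMeasurable_field
    (fun x => (hm x).comp_quasiMeasurePreserving hq) (Lp.aestronglyMeasurable Ψ)) ?_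
  filter_upwards [hq.ae hu] with p hp
  exact (ContinuousLinearMap.norm_map_of_mem_unitary hp (Ψ p)).le

/-- The operator `(M Ψ)(θ₁, θ₂) = R(θ₁ - θ₂) Ψ(θ₂, θ₁)` on `L²(ℝ² → K ⊗ K)`, for a measurable
field `R` of unitary operators. -/
def twistedFlip {R : ℝ → HTensor K K →L[ℂ] HTensor K K}
    (hm : ∀ x, AEStronglyMeasurable (fun θ => R θ x) volume)
    (hu : ∀ᵐ θ : ℝ, R θ ∈ unitary (HTensor K K →L[ℂ] HTensor K K)) : TwoP K →L[ℂ] TwoP K :=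
  LinearMap.mkContinuous
    { toFun := fun Ψ => (memLp_field hm hu Ψ).toLp _
      map_add' := fun Ψ Φ => by
        ext1
        filter_upwards [(memLp_field hm hu (Ψ + Φ)).coeFn_toLp, (memLp_field hm hu Ψ).coeFn_toLp,
          (memLp_field hm hu Φ).coeFn_toLp, Lp.coeFn_add Ψ Φ,
          Lp.coeFn_add ((memLp_field hm hu Ψ).toLp _) ((memLp_field hm hu Φ).toLp _)]
          with p h1 h2 h3 h4 h5
        rw [h1, h5, Pi.add_apply, h2, h3, h4, Pi.add_apply, map_add]
      map_smul' := fun c Ψ => by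
        ext1
        filter_upwards [(memLp_field hm hu (c • Ψ)).coeFn_toLp, (memLp_field hm hu Ψ).coeFn_toLp,
          Lp.coeFn_smul c Ψ, Lp.coeFn_smul c ((memLp_field hm hu Ψ).toLp _)]
          with p h1 h2 h3 h4
        rw [h1, RingHom.id_apply, h4, Pi.smul_apply, h2, h3, Pi.smul_apply, map_smul] }
    1 (fun Ψ => by
      rw [one_mul]
      refine Lp.norm_le_norm_of_ae_le ?_
      have hq : Measure.QuasiMeasurePreserving (fun p : ℝ × ℝ => p.1 - p.2)
        (volume : Measure (ℝ × ℝ)) volume := quasiMeasurePreserving_sub volume volume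
      filter_upwards [(memLp_field hm hu Ψ).coeFn_toLp, hq.ae hu] with p h1 hp
      refine (congrArg norm h1).le.trans ?_
      exact (ContinuousLinearMap.norm_map_of_mem_unitary hp (Ψ p)).le) ∘L
  (Lp.compMeasurePreservingₗᵢ ℂ Prod.swap
    (Measure.measurePreserving_swap (μ := (volume : Measure ℝ)) (ν := (volume : Measure ℝ)))
    ).toContinuousLinearMap

end OneParticle

section YangBaxter

variable {K : Type u} [NormedAddCommGroup K] [InnerProductSpace ℂ K]

/-- A conjugation: an antiunitary involution. -/
structure Conjugation (K : Type u) [NormedAddCommGroup K] [InnerProductSpace ℂ K] where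
  map : K →ₗᵢ⋆[ℂ] K
  involutive : ∀ x, map (map x) = x

variable [CompleteSpace K]

/-- An invariant Yang-Baxter function for the unitary representation `V` and the conjugation `Γ`.
It is an element of `L^∞(ℝ → B(K ⊗ K))` in the sense of strong measurability of
`θ ↦ R(θ) x` for all `x`; essential boundedness follows from unitarity. -/
structure YBFunction {G : Type v} [Group G] (V : G →* (K ≃ₗᵢ[ℂ] K)) (Γ : Conjugation K) where
  toFun : ℝ → (HTensor K K →L[ℂ] HTensor K K)
  measurable : ∀ x, AEStronglyMeasurable (fun θ => toFun θ x) volume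
  isUnitary : ∀ᵐ θ : ℝ, toFun θ ∈ unitary (HTensor K K →L[ℂ] HTensor K K)
  invariant : ∀ᵐ θ : ℝ, ∀ g : G,
    toFun θ ∘L mapT (V g).toContinuousLinearEquiv.toContinuousLinearMap
        (V g).toContinuousLinearEquiv.toContinuousLinearMap =
      mapT (V g).toContinuousLinearEquiv.toContinuousLinearMap
        (V g).toContinuousLinearEquiv.toContinuousLinearMap ∘L toFun θ
  tcp : ∀ᵐ θ : ℝ, ∀ x, mapConjT Γ.map Γ.map (flipT K K (toFun (-θ)
    (flipT K K (mapConjT Γ.map Γ.map x)))) = toFun θ x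
  yang_baxter : ∀ᵐ p : ℝ × ℝ,
    leftAmp K (toFun p.1) ∘L mapT (ContinuousLinearMap.id ℂ K) (toFun (p.1 + p.2)) ∘L
        leftAmp K (toFun p.2) =
      mapT (ContinuousLinearMap.id ℂ K) (toFun p.2) ∘L leftAmp K (toFun (p.1 + p.2)) ∘L
        mapT (ContinuousLinearMap.id ℂ K) (toFun p.1)
  inverse : ∀ᵐ θ : ℝ, toFun (-θ) * toFun θ = 1 ∧ toFun θ * toFun (-θ) = 1

variable {G : Type v} [Group G] {V : G →* (K ≃ₗᵢ[ℂ] K)} {Γ : Conjugation K}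

/-- The strip `0 < Im ζ < π`. -/
def strip : Set ℂ := {ζ | 0 < ζ.im ∧ ζ.im < Real.pi}

/-- Crossing symmetry: `R` is the boundary value, in the weak operator topology almost everywhere,
of a bounded analytic function `S` on the strip `0 < Im ζ < π`, whose boundary value `R(iπ - θ)` on
the upper edge satisfies
`⟪ξ ⊗ ψ, R(iπ - θ) (φ ⊗ ξ')⟫ = ⟪ψ ⊗ Γ ξ', R(θ) (Γ ξ ⊗ φ)⟫`. -/
def YBFunction.CrossingSymmetric (R : YBFunction V Γ) : Prop :=
  ∃ S : ℂ → (HTensor K K →L[ℂ] HTensor K K),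
    DifferentiableOn ℂ S strip ∧
    (∃ C : ℝ, ∀ ζ ∈ strip, ‖S ζ‖ ≤ C) ∧
    (∀ x y : HTensor K K, ∀ᵐ θ : ℝ,
      Tendsto (fun ε : ℝ => inner ℂ x (S (θ + ε * Complex.I) y)) (𝓝[>] 0)
        (𝓝 (inner ℂ x (R.toFun θ y)))) ∧
    (∀ ξ ψ φ ξ' : K, ∀ᵐ θ : ℝ,
      Tendsto (fun ε : ℝ =>
          inner ℂ (tmul ξ ψ) (S (Real.pi * Complex.I - θ - ε * Complex.I) (tmul φ ξ')))
        (𝓝[>] 0)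
        (𝓝 (inner ℂ (tmul ψ (Γ.map ξ')) (R.toFun θ (tmul (Γ.map ξ) φ)))))

/-- The operator on `L²(ℝ → K) ⊗ L²(ℝ → K) ≅ L²(ℝ² → K ⊗ K)` given by
`Ψ ↦ ((θ₁, θ₂) ↦ R(θ₁ - θ₂) Ψ(θ₂, θ₁))`. The adjoint of the unitary identification is its
inverse. -/
def YBFunction.op (R : YBFunction V Γ) :
    HTensor (OneP K) (OneP K) →L[ℂ] HTensor (OneP K) (OneP K) :=
  ContinuousLinearMap.adjoint (twoPMap K) ∘L twistedFlip R.measurable R.isUnitary ∘L twoPMap K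

/-- The conjugation `C ⊗ Γ` on `L²(ℝ → K)`: `(Θ ξ)(θ) = Γ (ξ(θ))`. -/
def oneTCP (Γ : Conjugation K) : OneP K →ₗᵢ⋆[ℂ] OneP K where
  toLinearMap := (Γ.map.toContinuousLinearMap.compLpL 2 volume).toLinearMap
  norm_map' ξ := by
    rw [Lp.norm_def, Lp.norm_def]
    congr 1
    refine eLpNorm_congr_norm_ae ?_
    filter_upwards [Γ.map.toContinuousLinearMap.coeFn_compLpL (p := 2) (μ := volume) ξ] with θ h
    rw [ContinuousLinearMap.coe_coe, h]
    simp

end YangBaxter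

section Field

/-- The functions `f^±(θ) = ± i e^θ ∫ e^{± i u e^θ} f(u) du`, for the sign `s = ± 1`. -/
def fpm (s : ℝ) (f : 𝓢(ℝ, ℂ)) (θ : ℝ) : ℂ :=
  s * Complex.I * Real.exp θ * ∫ u : ℝ, Complex.exp (s * Complex.I * u * Real.exp θ) * f u

theorem fpm_eq (s : ℝ) (f : 𝓢(ℝ, ℂ)) (θ : ℝ) : fpm s f θ =
    s * Complex.I * Real.exp θ * FourierTransform.fourier f (-(s * Real.exp θ) / (2 * Real.pi)) := by
  rw [fpm, SchwartzMap.fourier_coe, Real.fourier_real_eq_integral_exp_smul]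
  congr 2
  ext u
  rw [smul_eq_mul]
  congr 2
  push_cast
  have : (Real.pi : ℂ) ≠ 0 := by exact_mod_cast Real.pi_ne_zero
  field_simp

theorem memLp_fpm {s : ℝ} (hs : s = 1 ∨ s = -1) (f : 𝓢(ℝ, ℂ)) : MemLp (fpm s f) 2 volume := by
  obtain ⟨C, hC⟩ := (FourierTransform.fourier f : 𝓢(ℝ, ℂ)).decay' 0 0
  obtain ⟨D, hD⟩ := (FourierTransform.fourier f : 𝓢(ℝ, ℂ)).decay' 2 0
  have hs1 : |s| = 1 := by rcases hs with rfl | rfl <;> simp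
  have hcont : Continuous (fpm s f) := by
    have : fpm s f = fun θ => s * Complex.I * Real.exp θ *
        FourierTransform.fourier f (-(s * Real.exp θ) / (2 * Real.pi)) := funext (fpm_eq s f)
    rw [this]
    have := (FourierTransform.fourier f : 𝓢(ℝ, ℂ)).continuous
    fun_prop
  have hbound : ∀ θ, ‖fpm s f θ‖ ≤ (C + D * (2 * Real.pi) ^ 2) * Real.exp (-|θ|) := by
    intro θ
    rw [fpm_eq]
    set F := ‖(FourierTransform.fourier f : 𝓢(ℝ, ℂ)) (-(s * Real.exp θ) / (2 * Real.pi))‖ with hF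
    have h0 : F ≤ C := by
      have := hC (-(s * Real.exp θ) / (2 * Real.pi))
      rw [pow_zero, one_mul, norm_iteratedFDeriv_zero] at this
      exact this
    have h2 : (Real.exp θ / (2 * Real.pi)) ^ 2 * F ≤ D := by
      have := hD (-(s * Real.exp θ) / (2 * Real.pi))
      rw [norm_iteratedFDeriv_zero, Real.norm_eq_abs, abs_div, abs_neg, abs_mul, hs1,
        one_mul, Real.abs_exp, abs_of_pos Real.two_pi_pos] at this
      exact this
    have hF0 : 0 ≤ F := norm_nonneg _
    have hD0 : 0 ≤ D := le_trans (by positivity) h2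
    have hC0 : 0 ≤ C := hF0.trans h0
    have h2' : Real.exp θ ^ 2 * F ≤ D * (2 * Real.pi) ^ 2 := by
      have := mul_le_mul_of_nonneg_right h2 (sq_nonneg (2 * Real.pi))
      calc Real.exp θ ^ 2 * F = (Real.exp θ / (2 * Real.pi)) ^ 2 * F * (2 * Real.pi) ^ 2 := by
            field_simp
        _ ≤ _ := this
    have hn : ‖(s : ℂ) * Complex.I * Real.exp θ *
        (FourierTransform.fourier f : 𝓢(ℝ, ℂ)) (-(s * Real.exp θ) / (2 * Real.pi))‖ =
        Real.exp θ * F := by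
      rw [norm_mul, norm_mul, norm_mul, Complex.norm_I, Complex.norm_real, Complex.norm_real,
        Real.norm_eq_abs, hs1, Real.norm_eq_abs, Real.abs_exp, one_mul, one_mul]
    rw [hn]
    rcases le_total θ 0 with h | h
    · rw [abs_of_nonpos h, neg_neg, mul_comm]
      gcongr
      nlinarith [sq_nonneg (2 * Real.pi)]
    · rw [abs_of_nonneg h, Real.exp_neg, ← div_eq_mul_inv, le_div_iff₀ (Real.exp_pos θ)]
      nlinarith
  have hdec : MemLp (fun θ : ℝ => (C + D * (2 * Real.pi) ^ 2) * Real.exp (-|θ|)) 2 volume := by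
    refine MemLp.const_mul ?_ _
    have hc : Continuous fun θ : ℝ => Real.exp (-|θ|) := by fun_prop
    rw [memLp_two_iff_integrable_sq hc.aestronglyMeasurable]
    refine integrable_inv_one_add_sq.mono' (hc.pow 2).aestronglyMeasurable
      (Eventually.of_forall fun θ => ?_)
    rw [Real.norm_eq_abs, abs_of_nonneg (by positivity), ← Real.exp_nat_mul, mul_neg, Real.exp_neg]
    gcongr
    have := Real.quadratic_le_exp_of_nonneg (x := ((2 : ℕ) : ℝ) * |θ|) (by positivity)
    push_cast at this ⊢
    nlinarith [abs_nonneg θ, sq_abs θ]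
  exact hdec.of_le hcont.aestronglyMeasurable (Eventually.of_forall fun θ =>
    (hbound θ).trans (le_abs_self _))

/-- `f^+` as an element of `L²(ℝ)`. -/
def fPlus (f : 𝓢(ℝ, ℂ)) : Lp ℂ 2 (volume : Measure ℝ) := (memLp_fpm (Or.inl rfl) f).toLp

/-- `f^-` as an element of `L²(ℝ)`. -/
def fMinus (f : 𝓢(ℝ, ℂ)) : Lp ℂ 2 (volume : Measure ℝ) := (memLp_fpm (Or.inr rfl) f).toLp

/-- The reflected conjugate test function `u ↦ conj (f (-u))`. -/
def tcpTest (f : 𝓢(ℝ, ℂ)) : 𝓢(ℝ, ℂ) :=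
  SchwartzMap.postcompCLM (𝕜 := ℝ) (Complex.conjCLE : ℂ →L[ℝ] ℂ)
    (SchwartzMap.compCLMOfContinuousLinearEquiv ℝ (ContinuousLinearEquiv.neg ℝ) f)

theorem tcpTest_apply (f : 𝓢(ℝ, ℂ)) (u : ℝ) : tcpTest f u = conj (f (-u)) := rfl

variable {K : Type u} [NormedAddCommGroup K] [InnerProductSpace ℂ K] [CompleteSpace K]

/-- The one-particle vector `h ⊗ k`, that is `θ ↦ h(θ) k`. -/
def tensorVec (h : Lp ℂ 2 (volume : Measure ℝ)) (k : K) : OneP K :=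
  (ContinuousLinearMap.toSpanSingleton ℂ k).compLp h

variable {G : Type v} [Group G] {V : G →* (K ≃ₗᵢ[ℂ] K)} {Γ : Conjugation K}

/-- The field operator `φ_{R,k}(f) = z†(f^+ ⊗ k) + z(conj f^- ⊗ Γ k)` on vectors of finite particle
number in the Fock space of the operator `R.op`. -/
def field (R : YBFunction V Γ) (k : K) (f : 𝓢(ℝ, ℂ)) : finPart R.op →ₗ[ℂ] finPart R.op :=
  create R.op (tensorVec (fPlus f) k) + annihilate R.op (tensorVec (star (fMinus f)) (Γ.map k))

/-- The TCP operator `Θ` of the Fock space, on vectors of finite particle number. -/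
def tcpOp (R : YBFunction V Γ) : finPart R.op →ₗ⋆[ℂ] finPart R.op :=
  secondQuantConj R.op (oneTCP Γ)

/-- The TCP conjugate field `φ'_{R,k}(f) = Θ φ_{R,Γk}(u ↦ conj (f (-u))) Θ`, on vectors of finite
particle number. -/
def tcpField (R : YBFunction V Γ) (k : K) (f : 𝓢(ℝ, ℂ)) : finPart R.op →ₗ[ℂ] finPart R.op :=
  (tcpOp R).comp ((field R (Γ.map k) (tcpTest f)).comp (tcpOp R))

end Field

end YangBaxterQFT

end

noncomputable section

namespace YangBaxterQFT

/-! ### Pure tensors, adjoints and associators in the Hilbert space tensor product. -/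

section HilbertTensorLemmas

variable {E F G E' F' E'' F'' : Type*}
  [NormedAddCommGroup E] [InnerProductSpace ℂ E] [NormedAddCommGroup F] [InnerProductSpace ℂ F]
  [NormedAddCommGroup G] [InnerProductSpace ℂ G]
  [NormedAddCommGroup E'] [InnerProductSpace ℂ E'] [NormedAddCommGroup F'] [InnerProductSpace ℂ F']
  [NormedAddCommGroup E''] [InnerProductSpace ℂ E'']
  [NormedAddCommGroup F''] [InnerProductSpace ℂ F'']

/-! Conjugation by `Θ` turns creation at the left end of a tensor into creation at the right end.
Thus `φ'` is a field of the same form as `φ`, acting from the right, with one-particle vectors `-k'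
⊗ g⁺` and `-Γk' ⊗ conj g⁻` (`tcpField_eq`). Left and right creators commute, and so do left and
right annihilators. Only the mixed terms matter.

For a self-adjoint involutive braided `T`, the projection of `x ⊗ ξ` with `x` symmetric is the mean
of `T_k ⋯ T_{n-1} (x ⊗ ξ)` over `0 ≤ k ≤ n` (`symProj_snocOp`). Annihilation on the left turns the
terms with `k ≥ 1` into the opposite product of the two operators. The commutator of a left
annihilator and a right creator is therefore the single term `k = 0`, the operator `exchangeOp`. The
fields commute once the exchange operators of the two mixed pairs are adjoint to each other
(`field_comm_of_exchange`).

Matrix elements of exchange operators are matrix elements of products of one-particle operators, the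
partial matrix elements of `T` (`exchangeOp_eq_adjoint`). For `T = R.op` and vectors `h ⊗ x`, `h' ⊗
y` these act fibrewise in the rapidity, by convolutions of `conj h · h'` with matrix elements of
`R`. Such a convolution is the boundary value of a bounded analytic function on the strip, and
crossing symmetry identifies its upper edge with the matching coefficient for the other pair
(`exists_stripPair_partialElem`). Finite-rank projections of `K`, inserted between the factors, make
every product a finite sum of products of scalar functions, which stay in this class; the
projections are removed by strong convergence.

It remains to compare `∫ f⁻ g⁺ m` with `∫ f⁺ g⁻ m'`, where `m`, `m'` are the two edges of a bounded
analytic function. Because `f` is supported to the left of `g`, the product `f⁻ g⁺` continues to a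
decaying analytic function on the strip with upper edge `f⁺ g⁻`, and Cauchy's theorem moves the
contour (`integral_fpm_mul`).

The hypotheses on `T` come from those on `R`: unitarity and `R(-θ) = R(θ)⁻¹` make `R.op` a
self-adjoint involution, Yang-Baxter gives the braid relation, and the `tcp` condition gives
compatibility with `Θ`. -/

theorem tmulL_apply (x : E) (y : F) : tmulL E F x y = tmul x y := rfl

theorem add_tmul (x x' : E) (y : F) : tmul (x + x') y = tmul x y + tmul x' y :=
  (tmulL E F).map_add₂ x x' y

theorem tmul_add (x : E) (y y' : F) : tmul x (y + y') = tmul x y + tmul x y' :=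
  map_add (tmulL E F x) y y'

theorem smul_tmul (c : ℂ) (x : E) (y : F) : tmul (c • x) y = c • tmul x y :=
  (tmulL E F).map_smul₂ c x y

theorem tmul_smul (c : ℂ) (x : E) (y : F) : tmul x (c • y) = c • tmul x y :=
  map_smul (tmulL E F x) c y

theorem zero_tmul (y : F) : tmul (0 : E) y = 0 := (tmulL E F).map_zero₂ y

theorem tmul_zero (x : E) : tmul x (0 : F) = 0 := map_zero (tmulL E F x)

theorem inner_tmul_tmul (x x' : E) (y y' : F) :
    inner ℂ (tmul x y) (tmul x' y') = inner ℂ x x' * inner ℂ y y' := by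
  rw [tmul, tmul, LinearIsometry.inner_map_map, TensorProduct.inner_tmul]

theorem norm_tmul_eq (x : E) (y : F) : ‖tmul x y‖ = ‖x‖ * ‖y‖ := by
  rw [tmul, LinearIsometry.norm_map, TensorProduct.norm_tmul]

/-- Closed, additive properties of vectors of the Hilbert space tensor product may be checked on
pure tensors. -/
theorem htensor_induction {p : HTensor E F → Prop} (hc : IsClosed {x | p x})
    (hadd : ∀ x y, p x → p y → p (x + y)) (htmul : ∀ x y, p (tmul x y)) (z : HTensor E F) : p z := by
  refine (denseRange_ofAlg E F).induction_on z hc fun a => ?_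
  induction a using TensorProduct.induction_on with
  | zero =>
    rw [map_zero, ← zero_tmul (E := E) (0 : F)]
    exact htmul 0 0
  | add a b ha hb => rw [map_add]; exact hadd _ _ ha hb
  | tmul a b => exact htmul a b

theorem htensor_ext {W : Type*} [NormedAddCommGroup W] [NormedSpace ℂ W] {σ : ℂ →+* ℂ}
    {A B : HTensor E F →SL[σ] W} (h : ∀ x y, A (tmul x y) = B (tmul x y)) : A = B := by
  ext z
  refine htensor_induction (p := fun z => A z = B z) (isClosed_eq A.continuous B.continuous)
    (fun x y hx hy => by rw [map_add, map_add, hx, hy]) h z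

theorem mapT_comp_mapT (A : E →L[ℂ] E') (B : F →L[ℂ] F') (A' : E' →L[ℂ] E'') (B' : F' →L[ℂ] F'') :
    mapT A' B' ∘L mapT A B = mapT (A' ∘L A) (B' ∘L B) :=
  htensor_ext fun x y => by simp [mapT_tmul]

theorem mapT_mapT (A : E →L[ℂ] E') (B : F →L[ℂ] F') (A' : E' →L[ℂ] E'') (B' : F' →L[ℂ] F'')
    (z : HTensor E F) : mapT A' B' (mapT A B z) = mapT (A' ∘L A) (B' ∘L B) z :=
  congrArg (fun C => C z) (mapT_comp_mapT A B A' B')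

theorem mapT_id_id : mapT (ContinuousLinearMap.id ℂ E) (ContinuousLinearMap.id ℂ F) =
    ContinuousLinearMap.id ℂ (HTensor E F) :=
  htensor_ext fun x y => by simp [mapT_tmul]

theorem adjoint_mapT [CompleteSpace E] [CompleteSpace F] [CompleteSpace E'] [CompleteSpace F']
    (A : E →L[ℂ] E') (B : F →L[ℂ] F') :
    ContinuousLinearMap.adjoint (mapT A B) =
      mapT (ContinuousLinearMap.adjoint A) (ContinuousLinearMap.adjoint B) := by
  refine htensor_ext fun x y => ext_inner_right ℂ fun v => ?_
  rw [ContinuousLinearMap.adjoint_inner_left]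
  refine htensor_induction (p := fun v => inner ℂ (tmul x y) (mapT A B v) = inner ℂ (mapT
    (ContinuousLinearMap.adjoint A) (ContinuousLinearMap.adjoint B) (tmul x y)) v)
    (isClosed_eq (by fun_prop) (by fun_prop))
    (fun a b ha hb => by simp only [map_add, inner_add_right, ha, hb]) (fun a b => ?_) v
  simp only [mapT_tmul, inner_tmul_tmul, ContinuousLinearMap.adjoint_inner_left]

theorem assocT_symm_tmul (x : E) (y : F) (z : G) :
    (assocT E F G).symm (tmul x (tmul y z)) = tmul (tmul x y) z := by
  rw [← assocT_tmul, LinearIsometryEquiv.symm_apply_apply]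

theorem leftAmp_assocT (T : HTensor E E →L[ℂ] HTensor E E) (w : HTensor E E) (z : G) :
    leftAmp G T (assocT E E G (tmul w z)) = assocT E E G (tmul (T w) z) := by
  simp [leftAmp, mapT_tmul]

theorem adjoint_linearIsometryEquiv {A B : Type*} [NormedAddCommGroup A] [InnerProductSpace ℂ A]
    [CompleteSpace A] [NormedAddCommGroup B] [InnerProductSpace ℂ B] [CompleteSpace B]
    (e : A ≃ₗᵢ[ℂ] B) : ContinuousLinearMap.adjoint e.toContinuousLinearEquiv.toContinuousLinearMap =
      e.symm.toContinuousLinearEquiv.toContinuousLinearMap := by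
  refine ContinuousLinearMap.ext fun x => ext_inner_right ℂ fun y => ?_
  rw [ContinuousLinearMap.adjoint_inner_left]
  change inner ℂ x (e y) = inner ℂ (e.symm x) y
  rw [← e.inner_map_map, e.apply_symm_apply]

theorem adjoint_leftAmp [CompleteSpace G] (T : HTensor E E →L[ℂ] HTensor E E) :
    ContinuousLinearMap.adjoint (leftAmp G T) = leftAmp G (ContinuousLinearMap.adjoint T) := by
  rw [leftAmp, ContinuousLinearMap.adjoint_comp, ContinuousLinearMap.adjoint_comp, adjoint_mapT,
    adjoint_linearIsometryEquiv, adjoint_linearIsometryEquiv, leftAmp, ContinuousLinearMap.comp_assoc]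
  simp only [ContinuousLinearMap.adjoint_id]
  rfl

end HilbertTensorLemmas

/-! ### Operators at the two ends of a tensor power, and the relations between the legs. -/

section Legs

variable {H : Type u} [NormedAddCommGroup H] [InnerProductSpace ℂ H]

/-- The left creation map `x ↦ a ⊗ x`. -/
def consOp (a : H) (n : ℕ) : Pow H n →L[ℂ] Pow H (n + 1) :=
  (powCons H n).toContinuousLinearEquiv.toContinuousLinearMap ∘L tmulL H (Pow H n) a

/-- The right creation map `x ↦ x ⊗ a`. -/
def snocOp (a : H) (n : ℕ) : Pow H n →L[ℂ] Pow H (n + 1) :=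
  powSnoc H n ∘L (tmulL (Pow H n) H).flip a

/-- The left annihilation map. -/
def unconsOp (a : H) (n : ℕ) : Pow H (n + 1) →L[ℂ] Pow H n :=
  ContinuousLinearMap.adjoint (consOp a n)

/-- The right annihilation map. -/
def unsnocOp (a : H) (n : ℕ) : Pow H (n + 1) →L[ℂ] Pow H n :=
  ContinuousLinearMap.adjoint (snocOp a n)

theorem consOp_apply (a : H) (n : ℕ) (x : Pow H n) : consOp a n x = powCons H n (tmul a x) := rfl

theorem snocOp_apply (a : H) (n : ℕ) (x : Pow H n) : snocOp a n x = powSnoc H n (tmul x a) := rfl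

theorem pow_induction {n : ℕ} {p : Pow H (n + 1) → Prop} (hc : IsClosed {x | p x})
    (hadd : ∀ x y, p x → p y → p (x + y)) (hcons : ∀ a x, p (consOp a n x)) (z : Pow H (n + 1)) :
    p z :=
  htensor_induction (E := H) (F := Pow H n) hc hadd hcons z

theorem pow_ext {W : Type*} [NormedAddCommGroup W] [NormedSpace ℂ W] {σ : ℂ →+* ℂ} {n : ℕ}
    {A B : Pow H (n + 1) →SL[σ] W} (h : ∀ a x, A (consOp a n x) = B (consOp a n x)) : A = B :=
  htensor_ext (E := H) (F := Pow H n) h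

/-- The map `x ↦ w ⊗ x` for a two-particle vector `w`. -/
def consTwo (n : ℕ) : HTensor H H →L[ℂ] Pow H n →L[ℂ] Pow H (n + 2) :=
  ContinuousLinearMap.compL ℂ _ _ _ ((assocT H H (Pow H n)).trans
    (powCons H (n + 1))).toContinuousLinearEquiv.toContinuousLinearMap ∘L tmulL (HTensor H H) (Pow H n)

theorem consTwo_apply (n : ℕ) (w : HTensor H H) (x : Pow H n) :
    consTwo n w x = powCons H (n + 1) (assocT H H (Pow H n) (tmul w x)) := rfl

theorem consTwo_tmul (n : ℕ) (a b : H) (x : Pow H n) :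
    consTwo n (tmul a b) x = consOp a (n + 1) (consOp b n x) := by
  rw [consTwo_apply, assocT_tmul]; rfl

/-- Leg `0` mixes the first two factors, so testing it requires arbitrary two-particle vectors `w`
in front. -/
theorem pow_ext₂ {W : Type*} [NormedAddCommGroup W] [NormedSpace ℂ W] {σ : ℂ →+* ℂ} {n : ℕ}
    {A B : Pow H (n + 2) →SL[σ] W} (h : ∀ w x, A (consTwo n w x) = B (consTwo n w x)) : A = B :=
  htensor_ext (E := H) (F := Pow H (n + 1)) fun a y => by
    refine pow_induction (p := fun y => A (consOp a (n + 1) y) = B (consOp a (n + 1) y))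
      (isClosed_eq (by fun_prop) (by fun_prop))
      (fun x y hx hy => by simp only [map_add, hx, hy]) (fun b x => ?_) y
    rw [← consTwo_tmul, h]

theorem snocOp_zero (a : H) (x : Pow H 0) : snocOp a 0 x = consOp a 0 x := by
  rw [snocOp_apply]
  simp [powSnoc, flipT_tmul, consOp_apply]

theorem snocOp_consOp (a b : H) (n : ℕ) (x : Pow H n) :
    snocOp b (n + 1) (consOp a n x) = consOp a (n + 1) (snocOp b n x) := by
  rw [snocOp_apply, powSnoc, consOp_apply, consOp_apply]
  simp [mapT_tmul, assocT_tmul, snocOp_apply]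

theorem unconsOp_consOp (a b : H) (n : ℕ) (x : Pow H n) :
    unconsOp a n (consOp b n x) = inner ℂ a b • x := by
  refine ext_inner_left ℂ fun y => ?_
  rw [unconsOp, ContinuousLinearMap.adjoint_inner_right, consOp_apply, consOp_apply,
    LinearIsometryEquiv.inner_map_map, inner_tmul_tmul, inner_smul_right]

/-- The operators touch opposite ends, which are different factors only if there is at least one
particle. On `H^{⊗0}` they contract with each other instead. -/
theorem unconsOp_snocOp (a b : H) (n : ℕ) (x : Pow H (n + 1)) :
    unconsOp a (n + 1) (snocOp b (n + 1) x) = snocOp b n (unconsOp a n x) := by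
  have : unconsOp a (n + 1) ∘L snocOp b (n + 1) = snocOp b n ∘L unconsOp a n :=
    pow_ext fun c x => by simp [snocOp_consOp, unconsOp_consOp]
  exact congrArg (fun C => C x) this

theorem unsnocOp_unconsOp (a b : H) (n : ℕ) (x : Pow H (n + 2)) :
    unsnocOp b n (unconsOp a (n + 1) x) = unconsOp a n (unsnocOp b (n + 1) x) := by
  refine ext_inner_right ℂ fun y => ?_
  simp only [unsnocOp, unconsOp, ContinuousLinearMap.adjoint_inner_left, snocOp_consOp]

variable (T : HTensor H H →L[ℂ] HTensor H H)

theorem leg_zero_consTwo (n : ℕ) (w : HTensor H H) (x : Pow H n) :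
    leg T (n + 2) 0 (consTwo n w x) = consTwo n (T w) x := by
  exact congrArg (powCons H (n + 1)) (leftAmp_assocT T w x)

theorem leg_of_le {n j : ℕ} (h : n ≤ j + 1) : leg T n j = ContinuousLinearMap.id ℂ _ := by
  induction n generalizing j with
  | zero => simp [leg]
  | succ n ih =>
    cases n with
    | zero => simp [leg]
    | succ n =>
      cases j with
      | zero => omega
      | succ j =>
        rw [leg, ih (by omega), mapT_id_id]
        ext x
        simp

theorem leg_succ_consOp (n j : ℕ) (a : H) (x : Pow H n) :
    leg T (n + 1) (j + 1) (consOp a n x) = consOp a n (leg T n j x) := by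
  cases n with
  | zero => simp [leg]
  | succ n =>
    rw [consOp_apply, consOp_apply, leg]
    simp [mapT_tmul]

theorem leg_comm_consOp_consOp (n j : ℕ) (w : HTensor H H) (x : Pow H n) :
    leg T (n + 2) (j + 2) (consTwo n w x) = consTwo n w (leg T n j x) := by
  refine htensor_induction (p := fun w => leg T (n + 2) (j + 2) (consTwo n w x) =
    consTwo n w (leg T n j x)) (isClosed_eq (by fun_prop) (by fun_prop))
    (fun w w' h h' => by
      simp only [map_add, add_apply, h, h']) (fun a b => ?_) w
  rw [consTwo_tmul, consTwo_tmul, leg_succ_consOp, leg_succ_consOp]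

/-- Legs at distance at least two commute. -/
theorem leg_comm {n i j : ℕ} (h : i + 2 ≤ j) (x : Pow H n) :
    leg T n i (leg T n j x) = leg T n j (leg T n i x) := by
  suffices leg T n i ∘L leg T n j = leg T n j ∘L leg T n i from congrArg (fun C => C x) this
  induction n generalizing i j with
  | zero => simp [leg]
  | succ n ih =>
    cases i with
    | zero =>
      obtain ⟨j, rfl⟩ := Nat.exists_eq_add_of_le' h
      cases n with
      | zero => simp [leg]
      | succ n =>
        refine pow_ext₂ fun w x => ?_
        simp only [ContinuousLinearMap.comp_apply, zero_add, leg_zero_consTwo,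
          leg_comm_consOp_consOp]
    | succ i =>
      obtain ⟨j, rfl⟩ := Nat.exists_eq_succ_of_ne_zero (n := j) (by omega)
      refine pow_ext fun a x => ?_
      have := congrArg (fun C => C x) (ih (i := i) (j := j) (by omega) (x := x))
      simp only [ContinuousLinearMap.comp_apply] at this
      simp only [ContinuousLinearMap.comp_apply, Nat.succ_eq_add_one, leg_succ_consOp, this]

variable {T}

theorem leg_leg (h2 : T ∘L T = ContinuousLinearMap.id ℂ _) {n : ℕ} (j : ℕ) (x : Pow H n) :
    leg T n j (leg T n j x) = x := by
  suffices leg T n j ∘L leg T n j = ContinuousLinearMap.id ℂ _ from congrArg (fun C => C x) this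
  induction n generalizing j with
  | zero => simp [leg]
  | succ n ih =>
    cases j with
    | zero =>
      cases n with
      | zero => simp [leg]
      | succ n =>
        refine pow_ext₂ fun w x => ?_
        have := congrArg (fun C => C w) h2
        simp only [ContinuousLinearMap.comp_apply, ContinuousLinearMap.id_apply] at this
        simp [leg_zero_consTwo, this]
    | succ j =>
      refine pow_ext fun a x => ?_
      have := congrArg (fun C => C x) (ih j x)
      simp only [ContinuousLinearMap.comp_apply] at this
      simp only [ContinuousLinearMap.comp_apply, leg_succ_consOp, this,
        ContinuousLinearMap.id_apply]

theorem adjoint_leg [CompleteSpace H] (hT : ContinuousLinearMap.adjoint T = T) (n j : ℕ) :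
    ContinuousLinearMap.adjoint (leg T n j) = leg T n j := by
  induction n generalizing j with
  | zero => exact ContinuousLinearMap.adjoint_id
  | succ n ih =>
    cases n with
    | zero => exact ContinuousLinearMap.adjoint_id
    | succ n =>
      cases j with
      | zero =>
        refine Eq.trans (adjoint_leftAmp (G := Pow H n) T) ?_
        rw [hT]; rfl
      | succ j =>
        refine Eq.trans (adjoint_mapT (ContinuousLinearMap.id ℂ H) (leg T (n + 1) j)) ?_
        rw [ih, ContinuousLinearMap.adjoint_id]; rfl

theorem inner_leg [CompleteSpace H] (hT : ContinuousLinearMap.adjoint T = T) (n j : ℕ) (x y : Pow H n) :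
    inner ℂ (leg T n j x) y = inner ℂ x (leg T n j y) := by
  rw [← ContinuousLinearMap.adjoint_inner_left, adjoint_leg hT]

theorem unconsOp_leg_succ [CompleteSpace H] (hT : ContinuousLinearMap.adjoint T = T) (n j : ℕ) (a : H)
    (x : Pow H (n + 1)) : unconsOp a n (leg T (n + 1) (j + 1) x) = leg T n j (unconsOp a n x) := by
  refine ext_inner_right ℂ fun y => ?_
  rw [unconsOp, ContinuousLinearMap.adjoint_inner_left, inner_leg hT, leg_succ_consOp,
    inner_leg hT, ContinuousLinearMap.adjoint_inner_left]

theorem snocOp_consTwo (n : ℕ) (b : H) (w : HTensor H H) (x : Pow H n) :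
    snocOp b (n + 2) (consTwo n w x) = consTwo (n + 1) w (snocOp b n x) := by
  refine htensor_induction (p := fun w => snocOp b (n + 2) (consTwo n w x) =
    consTwo (n + 1) w (snocOp b n x)) (isClosed_eq (by fun_prop) (by fun_prop))
    (fun w w' h h' => by
      simp only [map_add, add_apply, h, h']) (fun a b => ?_) w
  rw [consTwo_tmul, consTwo_tmul, snocOp_consOp, snocOp_consOp]

/-- The bound says that leg `j` does not reach the appended factor. For `j + 1 = n` the leg on the
right would be the identity by default, while the one on the left acts on the last two factors. -/
theorem leg_snocOp {n j : ℕ} (h : j + 1 < n) (b : H) (x : Pow H n) :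
    leg T (n + 1) j (snocOp b n x) = snocOp b n (leg T n j x) := by
  suffices leg T (n + 1) j ∘L snocOp b n = snocOp b n ∘L leg T n j from
    congrArg (fun C => C x) this
  induction n generalizing j with
  | zero => omega
  | succ n ih =>
    cases j with
    | zero =>
      obtain ⟨n, rfl⟩ := Nat.exists_eq_succ_of_ne_zero (n := n) (by omega)
      refine pow_ext₂ fun w x => ?_
      simp only [ContinuousLinearMap.comp_apply, Nat.succ_eq_add_one, leg_zero_consTwo,
        snocOp_consTwo]
    | succ j =>
      refine pow_ext fun a x => ?_
      have := congrArg (fun C => C x) (ih (j := j) (by omega) x)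
      simp only [ContinuousLinearMap.comp_apply] at this
      simp only [ContinuousLinearMap.comp_apply, leg_succ_consOp, snocOp_consOp, this]

theorem unsnocOp_leg [CompleteSpace H] (hT : ContinuousLinearMap.adjoint T = T) {n j : ℕ} (h : j + 1 < n) (a : H)
    (x : Pow H (n + 1)) : unsnocOp a n (leg T (n + 1) j x) = leg T n j (unsnocOp a n x) := by
  refine ext_inner_right ℂ fun y => ?_
  rw [unsnocOp, ContinuousLinearMap.adjoint_inner_left, inner_leg hT, leg_snocOp h,
    inner_leg hT, ContinuousLinearMap.adjoint_inner_left]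

/-- The map `x ↦ z ⊗ x` for a three-particle vector `z`. -/
def consThree (n : ℕ) (x : Pow H n) : HTensor H (HTensor H H) →L[ℂ] Pow H (n + 3) :=
  (powCons H (n + 2)).toContinuousLinearEquiv.toContinuousLinearMap ∘L
    mapT (ContinuousLinearMap.id ℂ H) ((consTwo n).flip x)

theorem consThree_tmul (n : ℕ) (x : Pow H n) (a : H) (w : HTensor H H) :
    consThree n x (tmul a w) = consOp a (n + 2) (consTwo n w x) := by
  simp [consThree, mapT_tmul, consOp_apply]

theorem consThree_assocT (n : ℕ) (x : Pow H n) (c : H) (w : HTensor H H) :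
    consThree n x (assocT H H H (tmul w c)) = consTwo (n + 1) w (consOp c n x) := by
  refine htensor_induction (p := fun w => consThree n x (assocT H H H (tmul w c)) =
    consTwo (n + 1) w (consOp c n x)) (isClosed_eq ?_ (by fun_prop))
    (fun w w' h h' => by
      simp only [map_add, add_tmul, add_apply, h, h']) (fun a b => ?_) w
  · exact (consThree n x).continuous.comp ((assocT H H H).continuous.comp
      ((tmulL (HTensor H H) H).flip c).continuous)
  · rw [assocT_tmul, consThree_tmul, consTwo_tmul, consTwo_tmul]

theorem leg_zero_consThree (n : ℕ) (x : Pow H n) (z : HTensor H (HTensor H H)) :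
    leg T (n + 3) 0 (consThree n x z) = consThree n x (leftAmp H T z) := by
  obtain ⟨z, rfl⟩ := (assocT H H H).surjective z
  refine htensor_induction (p := fun z => leg T (n + 3) 0 (consThree n x (assocT H H H z)) =
    consThree n x (leftAmp H T (assocT H H H z))) (isClosed_eq (by fun_prop) (by fun_prop))
    (fun w w' h h' => by simp only [map_add, h, h']) (fun w c => ?_) z
  rw [consThree_assocT, leg_zero_consTwo, leftAmp_assocT, consThree_assocT]

theorem leg_one_consThree (n : ℕ) (x : Pow H n) (z : HTensor H (HTensor H H)) :
    leg T (n + 3) 1 (consThree n x z) =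
      consThree n x (mapT (ContinuousLinearMap.id ℂ H) T z) := by
  refine htensor_induction (p := fun z => leg T (n + 3) 1 (consThree n x z) =
    consThree n x (mapT (ContinuousLinearMap.id ℂ H) T z)) (isClosed_eq (by fun_prop) (by fun_prop))
    (fun w w' h h' => by simp only [map_add, h, h']) (fun a w => ?_) z
  rw [consThree_tmul, mapT_tmul, consThree_tmul, leg_succ_consOp, leg_zero_consTwo]
  rfl

/-- The braid relation on three factors. -/
def Braided (T : HTensor H H →L[ℂ] HTensor H H) : Prop :=
  leftAmp H T ∘L mapT (ContinuousLinearMap.id ℂ H) T ∘L leftAmp H T =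
    mapT (ContinuousLinearMap.id ℂ H) T ∘L leftAmp H T ∘L mapT (ContinuousLinearMap.id ℂ H) T

/-- Leading factors are peeled off until the three affected factors come first. There the relation
is `Braided` acting on a three-particle prefix. -/
theorem leg_braid (hB : Braided T) {n j : ℕ} (h : j + 2 < n) (x : Pow H n) :
    leg T n j (leg T n (j + 1) (leg T n j x)) =
      leg T n (j + 1) (leg T n j (leg T n (j + 1) x)) := by
  suffices leg T n j ∘L leg T n (j + 1) ∘L leg T n j =
      leg T n (j + 1) ∘L leg T n j ∘L leg T n (j + 1) from congrArg (fun C => C x) this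
  induction n generalizing j with
  | zero => omega
  | succ n ih =>
    cases j with
    | zero =>
      obtain ⟨n, rfl⟩ := Nat.exists_eq_add_of_le' (m := 2) (n := n) (by omega)
      refine pow_ext₂ fun w y => ?_
      refine pow_induction (p := fun y => (leg T (n + 3) 0 ∘L leg T (n + 3) 1 ∘L leg T (n + 3) 0)
          (consTwo (n + 1) w y) = (leg T (n + 3) 1 ∘L leg T (n + 3) 0 ∘L leg T (n + 3) 1)
          (consTwo (n + 1) w y)) (isClosed_eq (by fun_prop) (by fun_prop))
        (fun a b ha hb => by rw [map_add, map_add, map_add, ha, hb]) (fun c x => ?_) y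
      rw [← consThree_assocT]
      simp only [ContinuousLinearMap.comp_apply, leg_zero_consThree, leg_one_consThree]
      exact congrArg (fun C => consThree n x (C (assocT H H H (tmul w c)))) hB
    | succ j =>
      refine pow_ext fun a x => ?_
      have := congrArg (fun C => C x) (ih (j := j) (by omega) x)
      simp only [ContinuousLinearMap.comp_apply] at this
      simp only [ContinuousLinearMap.comp_apply, leg_succ_consOp, this]

end Legs

/-! ### The antiunitary reversal of tensor powers. -/

section Reversal

variable {H : Type u} [NormedAddCommGroup H] [InnerProductSpace ℂ H] (J : H →ₗᵢ⋆[ℂ] H)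

/-- The antilinear map `x₁ ⊗ ⋯ ⊗ xₙ ↦ J xₙ ⊗ ⋯ ⊗ J x₁`. -/
def revConj (n : ℕ) : Pow H n →L⋆[ℂ] Pow H n :=
  (powConj J n).toContinuousLinearMap.comp (powRev H n)

theorem powRev_consOp (n : ℕ) (a : H) (x : Pow H n) :
    powRev H (n + 1) (consOp a n x) = snocOp a n (powRev H n x) := by
  rw [powRev, consOp_apply, snocOp_apply]
  simp [flipT_tmul, mapT_tmul]

theorem powConj_consOp (n : ℕ) (a : H) (x : Pow H n) :
    powConj J (n + 1) (consOp a n x) = consOp (J a) n (powConj J n x) := by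
  rw [powConj, consOp_apply, consOp_apply]
  simp [mapConjT_tmul]

theorem powConj_snocOp (n : ℕ) (a : H) (x : Pow H n) :
    powConj J (n + 1) (snocOp a n x) = snocOp (J a) n (powConj J n x) := by
  suffices (powConj J (n + 1)).toContinuousLinearMap.comp (snocOp a n) =
      (snocOp (J a) n).comp (powConj J n).toContinuousLinearMap from congrArg (fun C => C x) this
  induction n with
  | zero => ext x; simp [snocOp_zero, powConj_consOp]
  | succ n ih =>
    refine pow_ext fun c x => ?_
    have := congrArg (fun C => C x) (ih x)
    simp only [ContinuousLinearMap.comp_apply, LinearIsometry.coe_toContinuousLinearMap] at this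
    simp [snocOp_consOp, powConj_consOp, this]

theorem revConj_consOp (n : ℕ) (a : H) (x : Pow H n) :
    revConj J (n + 1) (consOp a n x) = snocOp (J a) n (revConj J n x) := by
  simp [revConj, powRev_consOp, powConj_snocOp]

theorem revConj_snocOp (n : ℕ) (a : H) (x : Pow H n) :
    revConj J (n + 1) (snocOp a n x) = consOp (J a) n (revConj J n x) := by
  suffices (revConj J (n + 1)).comp (snocOp a n) =
      (consOp (J a) n).comp (revConj J n) from congrArg (fun C => C x) this
  induction n with
  | zero => ext x; simp [snocOp_zero, revConj_consOp]
  | succ n ih =>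
    refine pow_ext fun c x => ?_
    have := congrArg (fun C => C x) (ih x)
    simp only [ContinuousLinearMap.comp_apply] at this
    simp [snocOp_consOp, revConj_consOp, this]

theorem inner_consOp_consOp (n : ℕ) (a b : H) (x y : Pow H n) :
    inner ℂ (consOp a n x) (consOp b n y) = inner ℂ a b * inner ℂ x y := by
  rw [consOp_apply, consOp_apply, LinearIsometryEquiv.inner_map_map, inner_tmul_tmul]

theorem inner_snocOp_snocOp (n : ℕ) (a b : H) (x y : Pow H n) :
    inner ℂ (snocOp a n x) (snocOp b n y) = inner ℂ a b * inner ℂ x y := by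
  induction n with
  | zero => rw [snocOp_zero, snocOp_zero, inner_consOp_consOp]
  | succ n ih =>
    refine pow_induction (p := fun x => inner ℂ (snocOp a (n + 1) x) (snocOp b (n + 1) y) =
      inner ℂ a b * inner ℂ x y) (isClosed_eq (by fun_prop) (by fun_prop))
      (fun x y hx hy => by simp only [map_add, inner_add_left, hx, hy, mul_add]) (fun c x => ?_) x
    refine pow_induction (p := fun y => inner ℂ (snocOp a (n + 1) (consOp c n x))
      (snocOp b (n + 1) y) = inner ℂ a b * inner ℂ (consOp c n x) y)
      (isClosed_eq (by fun_prop) (by fun_prop))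
      (fun x y hx hy => by simp only [map_add, inner_add_right, hx, hy, mul_add]) (fun d y => ?_) y
    rw [snocOp_consOp, snocOp_consOp, inner_consOp_consOp, inner_consOp_consOp, ih]
    ring

theorem inner_revConj_revConj (n : ℕ) (x y : Pow H n) :
    inner ℂ (revConj J n x) (revConj J n y) = inner ℂ y x := by
  induction n with
  | zero => exact inner_conj_conj (powConj J 0) x y
  | succ n ih =>
    refine pow_induction (p := fun x => inner ℂ (revConj J (n + 1) x) (revConj J (n + 1) y) =
      inner ℂ y x) (isClosed_eq (by fun_prop) (by fun_prop))
      (fun x y hx hy => by simp only [map_add, inner_add_left, inner_add_right, hx, hy])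
      (fun c x => ?_) x
    refine pow_induction (p := fun y => inner ℂ (revConj J (n + 1) (consOp c n x))
      (revConj J (n + 1) y) = inner ℂ y (consOp c n x))
      (isClosed_eq (by fun_prop) (by fun_prop))
      (fun x y hx hy => by simp only [map_add, inner_add_left, inner_add_right, hx, hy])
      (fun d y => ?_) y
    rw [revConj_consOp, revConj_consOp, inner_snocOp_snocOp, inner_consOp_consOp, ih,
      inner_conj_conj]

variable {J}

theorem revConj_revConj (hJ : ∀ a, J (J a) = a) (n : ℕ) (x : Pow H n) :
    revConj J n (revConj J n x) = x := by
  suffices (revConj J n).comp (revConj J n) = ContinuousLinearMap.id ℂ (Pow H n) from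
    congrArg (fun C => C x) this
  induction n with
  | zero =>
    ext x
    change powZero H (euclConj (euclConj ((powZero H).symm x))) = x
    have : euclConj (euclConj ((powZero H).symm x)) = (powZero H).symm x := by
      ext i; simp [euclConj]
    rw [this, LinearIsometryEquiv.apply_symm_apply]
  | succ n ih =>
    refine pow_ext fun c x => ?_
    have := congrArg (fun C => C x) (ih x)
    simp only [ContinuousLinearMap.comp_apply] at this
    simp [revConj_consOp, revConj_snocOp, this, hJ]

/-- The map `w ↦ x ⊗ w` that appends a two-particle vector. -/
def snocTwo (n : ℕ) : Pow H n →L[ℂ] HTensor H H →L[ℂ] Pow H (n + 2) :=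
  ContinuousLinearMap.compL ℂ _ _ _ (powSnoc H (n + 1) ∘L
    mapT (powSnoc H n) (ContinuousLinearMap.id ℂ H) ∘L
    (assocT (Pow H n) H H).symm.toContinuousLinearEquiv.toContinuousLinearMap) ∘L
      tmulL (Pow H n) (HTensor H H)

theorem snocTwo_tmul (n : ℕ) (x : Pow H n) (a b : H) :
    snocTwo n x (tmul a b) = snocOp b (n + 1) (snocOp a n x) := by
  simp [snocTwo, tmulL_apply, assocT_symm_tmul, mapT_tmul, snocOp_apply]

theorem snocTwo_zero (x : Pow H 0) (w : HTensor H H) : snocTwo 0 x w = consTwo 0 w x := by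
  suffices snocTwo 0 x = (consTwo 0).flip x from congrArg (fun C => C w) this
  refine htensor_ext fun a b => ?_
  rw [snocTwo_tmul, ContinuousLinearMap.flip_apply, consTwo_tmul, snocOp_zero, snocOp_consOp,
    snocOp_zero]

theorem snocTwo_consOp (n : ℕ) (c : H) (x : Pow H n) (w : HTensor H H) :
    snocTwo (n + 1) (consOp c n x) w = consOp c (n + 2) (snocTwo n x w) := by
  suffices snocTwo (n + 1) (consOp c n x) = consOp c (n + 2) ∘L snocTwo n x from
    congrArg (fun C => C w) this
  refine htensor_ext fun a b => ?_
  rw [snocTwo_tmul, ContinuousLinearMap.comp_apply, snocTwo_tmul, snocOp_consOp, snocOp_consOp]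

theorem leg_snocTwo (T : HTensor H H →L[ℂ] HTensor H H) (n : ℕ) (x : Pow H n) (w : HTensor H H) :
    leg T (n + 2) n (snocTwo n x w) = snocTwo n x (T w) := by
  suffices leg T (n + 2) n ∘L (snocTwo n).flip w = (snocTwo n).flip (T w) from
    congrArg (fun C => C x) this
  induction n with
  | zero => ext x; simp [snocTwo_zero, leg_zero_consTwo]
  | succ n ih =>
    refine pow_ext fun c x => ?_
    have := congrArg (fun C => C x) (ih x)
    simp only [ContinuousLinearMap.comp_apply, ContinuousLinearMap.flip_apply] at this
    simp [snocTwo_consOp, leg_succ_consOp, this]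

theorem revConj_consTwo (n : ℕ) (w : HTensor H H) (x : Pow H n) :
    revConj J (n + 2) (consTwo n w x) =
      snocTwo n (revConj J n x) (mapConjT J J (flipT H H w)) := by
  suffices (revConj J (n + 2)).comp ((consTwo n).flip x) =
      (snocTwo n (revConj J n x)).comp
        ((mapConjT J J).toContinuousLinearMap.comp (flipT H H)) from
    congrArg (fun C => C w) this
  refine htensor_ext fun a b => ?_
  simp [consTwo_tmul, revConj_consOp, flipT_tmul, mapConjT_tmul, snocTwo_tmul]

variable {T : HTensor H H →L[ℂ] HTensor H H}

/-- Reversal sends the pair of factors `(j, j + 1)` to the pair beginning at `n - 2 - j`. The bound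
on `j` keeps the natural subtraction honest. -/
theorem revConj_leg (hTJ : ∀ w, mapConjT J J (flipT H H (T w)) = T (mapConjT J J (flipT H H w)))
    {n j : ℕ} (h : j + 1 < n) (x : Pow H n) :
    revConj J n (leg T n j x) = leg T n (n - 2 - j) (revConj J n x) := by
  suffices (revConj J n).comp (leg T n j) = (leg T n (n - 2 - j)).comp (revConj J n) from
    congrArg (fun C => C x) this
  induction n generalizing j with
  | zero => omega
  | succ n ih =>
    cases j with
    | zero =>
      obtain ⟨n, rfl⟩ := Nat.exists_eq_succ_of_ne_zero (n := n) (by omega)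
      refine pow_ext₂ fun w x => ?_
      have e : n.succ + 1 - 2 - 0 = n := by omega
      rw [e]
      simp [leg_zero_consTwo, revConj_consTwo, leg_snocTwo, hTJ]
    | succ j =>
      refine pow_ext fun a x => ?_
      have := congrArg (fun C => C x) (ih (j := j) (by omega) x)
      simp only [ContinuousLinearMap.comp_apply] at this
      have e : n + 1 - 2 - (j + 1) = n - 2 - j := by omega
      rw [e]
      simp only [ContinuousLinearMap.comp_apply, leg_succ_consOp, revConj_consOp, this]
      rw [leg_snocOp (by omega)]

theorem mem_symSpace_iff {n : ℕ} {x : Pow H n} :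
    x ∈ symSpace T n ↔ ∀ j, j + 1 < n → leg T n j x = x := by
  refine ⟨fun h j _ => h j, fun h j => ?_⟩
  by_cases hj : j + 1 < n
  · exact h j hj
  · rw [leg_of_le T (not_lt.1 hj)]; rfl

theorem revConj_mem_symSpace
    (hTJ : ∀ w, mapConjT J J (flipT H H (T w)) = T (mapConjT J J (flipT H H w)))
    {n : ℕ} {x : Pow H n} (hx : x ∈ symSpace T n) : revConj J n x ∈ symSpace T n := by
  refine mem_symSpace_iff.2 fun j hj => ?_
  -- Writing `j` as a reflected index lets `revConj_leg` be used from right to left.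
  have e : j = n - 2 - (n - 2 - j) := by omega
  rw [e, ← revConj_leg hTJ (by omega), hx]

end Reversal

/-! ### The projection of `x ⊗ ξ` onto the symmetric vectors, as a sum over cosets. -/

section Projection

variable {H : Type u} [NormedAddCommGroup H] [InnerProductSpace ℂ H]
  (T : HTensor H H →L[ℂ] HTensor H H)

/-- The product of the legs `k, k + 1, …, k + l - 1`. -/
def legChain (N : ℕ) : ℕ → ℕ → (Pow H N →L[ℂ] Pow H N)
  | _, 0 => ContinuousLinearMap.id ℂ _
  | k, l + 1 => leg T N k ∘L legChain N (k + 1) l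

variable {T}

theorem inner_symProj {n : ℕ} {x : Pow H n} (hx : x ∈ symSpace T n) (y : Pow H n) :
    inner ℂ x (symProj T n y : Pow H n) = inner ℂ x y :=
  Submodule.inner_orthogonalProjectionOnto_eq_of_mem_left ⟨x, hx⟩ y

theorem symProj_eq {n : ℕ} {x y : Pow H n} (hx : x ∈ symSpace T n)
    (h : ∀ z ∈ symSpace T n, inner ℂ z y = inner ℂ z x) : (symProj T n y : Pow H n) = x := by
  suffices symProj T n y = ⟨x, hx⟩ from congrArg Subtype.val this
  refine ext_inner_left ℂ fun z => ?_
  rw [Submodule.coe_inner, Submodule.coe_inner, inner_symProj z.2, h z z.2]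

theorem legChain_consOp (n k l : ℕ) (a : H) (x : Pow H n) :
    legChain T (n + 1) (k + 1) l (consOp a n x) = consOp a n (legChain T n k l x) := by
  induction l generalizing k with
  | zero => rfl
  | succ l ih => simp only [legChain, ContinuousLinearMap.comp_apply, ih, leg_succ_consOp]

theorem inner_legChain [CompleteSpace H] (hT : ContinuousLinearMap.adjoint T = T) {n : ℕ} (k l : ℕ)
    {z : Pow H n} (hz : z ∈ symSpace T n) (x : Pow H n) :
    inner ℂ z (legChain T n k l x) = inner ℂ z x := by
  induction l generalizing k with
  | zero => rfl
  | succ l ih => rw [legChain, ContinuousLinearMap.comp_apply, ← inner_leg hT, hz, ih]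

theorem unconsOp_legChain [CompleteSpace H] (hT : ContinuousLinearMap.adjoint T = T) (n k l : ℕ)
    (a : H) (x : Pow H (n + 1)) :
    unconsOp a n (legChain T (n + 1) (k + 1) l x) = legChain T n k l (unconsOp a n x) := by
  induction l generalizing k with
  | zero => rfl
  | succ l ih => simp only [legChain, ContinuousLinearMap.comp_apply, ih, unconsOp_leg_succ hT]

/-- The leg lies below the whole chain, so it commutes through it and past the appended `ξ`, and is
absorbed by the symmetric vector `x`. -/
theorem leg_legChain_low {n k l j : ℕ} (hl : k + l = n) (hj : j + 1 < k) (ξ : H) {x : Pow H n}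
    (hx : x ∈ symSpace T n) :
    leg T (n + 1) j (legChain T (n + 1) k l (snocOp ξ n x)) =
      legChain T (n + 1) k l (snocOp ξ n x) := by
  induction l generalizing k with
  | zero =>
    have : leg T (n + 1) j (snocOp ξ n x) = snocOp ξ n x := by
      rw [leg_snocOp (by omega), hx]
    exact this
  | succ l ih =>
    rw [legChain, ContinuousLinearMap.comp_apply, leg_comm T (by omega),
      ih (by omega) (by omega)]

/-- The leg commutes inwards until it meets `T_{j-1} T_j`. The braid relation then turns it into leg
`j - 1` standing before the rest of the chain, where the preceding lemma absorbs it. -/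
theorem leg_legChain_high (hB : Braided T) {n k l j : ℕ} (hl : k + l = n) (hj : k < j) (hjn : j < n)
    (ξ : H) {x : Pow H n} (hx : x ∈ symSpace T n) :
    leg T (n + 1) j (legChain T (n + 1) k l (snocOp ξ n x)) =
      legChain T (n + 1) k l (snocOp ξ n x) := by
  induction l generalizing k with
  | zero => omega
  | succ l ih =>
    rcases Nat.lt_or_ge (k + 1) j with h | h
    · rw [legChain, ContinuousLinearMap.comp_apply, ← leg_comm T (by omega),
        ih (by omega) (by omega)]
    · obtain rfl : j = k + 1 := by omega
      obtain ⟨l, rfl⟩ := Nat.exists_eq_succ_of_ne_zero (n := l) (by omega)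
      simp only [legChain, ContinuousLinearMap.comp_apply]
      rw [← leg_braid hB (by omega), leg_legChain_low (by omega) (by omega) ξ hx]

/-- The chains represent the cosets of `S_n` in `S_{n+1}`, indexed by the final position of `ξ`. Leg
`j` exchanges positions `j` and `j + 1`, because the chain from `j` is `T_j` times the chain from `j
+ 1` and `T_j² = 1`. -/
theorem leg_legChain_swap (h2 : T ∘L T = ContinuousLinearMap.id ℂ _) (hB : Braided T) {n k j : ℕ}
    (hk : k ≤ n) (hj : j < n) (ξ : H) {x : Pow H n} (hx : x ∈ symSpace T n) :
    leg T (n + 1) j (legChain T (n + 1) k (n - k) (snocOp ξ n x)) =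
      legChain T (n + 1) (Equiv.swap j (j + 1) k) (n - Equiv.swap j (j + 1) k) (snocOp ξ n x) := by
  have step : n - j = (n - (j + 1)) + 1 := by omega
  rcases eq_or_ne k j with rfl | h1
  · rw [Equiv.swap_apply_left, step, legChain, ContinuousLinearMap.comp_apply, leg_leg h2]
  rcases eq_or_ne k (j + 1) with rfl | h3
  · rw [Equiv.swap_apply_right, step, legChain, ContinuousLinearMap.comp_apply]
  rw [Equiv.swap_apply_of_ne_of_ne h1 h3]
  rcases Nat.lt_or_ge k j with h | h
  · exact leg_legChain_high hB (by omega) h hj ξ hx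
  · exact leg_legChain_low (by omega) (by omega) ξ hx

/-- The sum is symmetric because each leg only permutes its terms. It has the right inner products
with symmetric vectors because each chain can be moved onto such a vector and disappears. No sum
over the whole symmetric group is needed. -/
theorem symProj_snocOp [CompleteSpace H] (hT : ContinuousLinearMap.adjoint T = T)
    (h2 : T ∘L T = ContinuousLinearMap.id ℂ _) (hB : Braided T) (n : ℕ) (ξ : H) {x : Pow H n}
    (hx : x ∈ symSpace T n) :
    ((n : ℂ) + 1) • (symProj T (n + 1) (snocOp ξ n x) : Pow H (n + 1)) =
      ∑ k ∈ Finset.range (n + 1), legChain T (n + 1) k (n - k) (snocOp ξ n x) := by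
  have hn : ((n : ℂ) + 1) ≠ 0 := by exact_mod_cast n.succ_ne_zero
  rw [← Submodule.coe_smul, ← map_smul]
  refine symProj_eq (mem_symSpace_iff.2 fun j hj => ?_) fun z hz => ?_
  · rw [map_sum]
    refine Finset.sum_equiv (Equiv.swap j (j + 1)) (fun k => ?_) fun k hk => ?_
    · simp only [Finset.mem_range]
      rcases eq_or_ne k j with rfl | h1
      · rw [Equiv.swap_apply_left]; omega
      rcases eq_or_ne k (j + 1) with rfl | h3
      · rw [Equiv.swap_apply_right]; omega
      rw [Equiv.swap_apply_of_ne_of_ne h1 h3]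
    · exact leg_legChain_swap h2 hB (by simpa [Nat.lt_succ_iff] using hk) (by omega) ξ hx
  -- Each of the `n + 1` terms has the same inner product with `z` as `x ⊗ ξ` itself.
  · rw [inner_sum, Finset.sum_congr rfl fun k _ => inner_legChain hT k (n - k) hz _]
    simp

end Projection

/-! ### Left and right fields on the symmetric Fock space, and their commutator. -/

section FockCommutator

variable {H : Type u} [NormedAddCommGroup H] [InnerProductSpace ℂ H]
  {T : HTensor H H →L[ℂ] HTensor H H}

theorem raiseOp_succ (A : ∀ n, symSpace T n →L[ℂ] symSpace T (n + 1)) (Ψ : finPart T) (n : ℕ) :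
    (raiseOp T A Ψ : Fock T) (n + 1) = A n ((Ψ : Fock T) n) := rfl

theorem raiseOp_zero (A : ∀ n, symSpace T n →L[ℂ] symSpace T (n + 1)) (Ψ : finPart T) :
    (raiseOp T A Ψ : Fock T) 0 = 0 := rfl

theorem lowerOp_apply (B : ∀ n, symSpace T (n + 1) →L[ℂ] symSpace T n) (Ψ : finPart T) (n : ℕ) :
    (lowerOp T B Ψ : Fock T) n = B n ((Ψ : Fock T) (n + 1)) := rfl

theorem finPart_ext {Ψ Φ : finPart T} (h : ∀ n, (Ψ : Fock T) n = (Φ : Fock T) n) : Ψ = Φ :=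
  Subtype.ext (lp.ext (funext h))

theorem finPart_add_apply (Ψ Φ : finPart T) (n : ℕ) :
    ((Ψ + Φ : finPart T) : Fock T) n = (Ψ : Fock T) n + (Φ : Fock T) n := rfl

/-- Two operators that change the particle number by `± 1` commute if their components do. -/
theorem raise_lower_comm {A A' : ∀ n, symSpace T n →L[ℂ] symSpace T (n + 1)}
    {B B' : ∀ n, symSpace T (n + 1) →L[ℂ] symSpace T n}
    (hA : ∀ n x, A (n + 1) (A' n x) = A' (n + 1) (A n x))
    (hB : ∀ n x, B n (B' (n + 1) x) = B' n (B (n + 1) x))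
    (h0 : ∀ x, B 0 (A' 0 x) = B' 0 (A 0 x))
    (h : ∀ n x, B (n + 1) (A' (n + 1) x) + A n (B' n x) = B' (n + 1) (A (n + 1) x) + A' n (B n x))
    (Ψ : finPart T) :
    (raiseOp T A + lowerOp T B) ((raiseOp T A' + lowerOp T B') Ψ) =
      (raiseOp T A' + lowerOp T B') ((raiseOp T A + lowerOp T B) Ψ) := by
  refine finPart_ext fun m => ?_
  simp only [LinearMap.add_apply, finPart_add_apply, lowerOp_apply, raiseOp_succ, map_add]
  cases m with
  | zero => simp only [raiseOp_zero, zero_add, h0, hB]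
  | succ n =>
    simp only [raiseOp_succ]
    have h1 : A n ((raiseOp T A' Ψ : Fock T) n) = A' n ((raiseOp T A Ψ : Fock T) n) := by
      cases n with
      | zero => simp only [raiseOp_zero, map_zero]
      | succ n => simp only [raiseOp_succ, hA]
    simp only [lowerOp_apply, h1, hB]
    have := h n ((Ψ : Fock T) (n + 1))
    rw [← sub_eq_zero] at this ⊢
    rw [← this]
    abel

/-- `Ψ_n ↦ √(n+1) P_{n+1} (Ψ_n ⊗ ξ)`. -/
def createRightN (T : HTensor H H →L[ℂ] HTensor H H) (ξ : H) (n : ℕ) :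
    symSpace T n →L[ℂ] symSpace T (n + 1) :=
  ((Real.sqrt (n + 1) : ℝ) : ℂ) • (symProj T (n + 1) ∘L snocOp ξ n ∘L (symSpace T n).subtypeL)

theorem createN_eq (ξ : H) (n : ℕ) (x : symSpace T n) : createN T ξ n x =
    ((Real.sqrt (n + 1) : ℝ) : ℂ) • symProj T (n + 1) (consOp ξ n x) := rfl

theorem createRightN_eq (ξ : H) (n : ℕ) (x : symSpace T n) : createRightN T ξ n x =
    ((Real.sqrt (n + 1) : ℝ) : ℂ) • symProj T (n + 1) (snocOp ξ n x) := rfl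

theorem unconsOp_mem_symSpace [CompleteSpace H] (hT : ContinuousLinearMap.adjoint T = T) (ξ : H)
    {n : ℕ} {x : Pow H (n + 1)} (hx : x ∈ symSpace T (n + 1)) : unconsOp ξ n x ∈ symSpace T n := by
  intro j
  rw [← unconsOp_leg_succ hT, hx]

theorem unsnocOp_mem_symSpace [CompleteSpace H] (hT : ContinuousLinearMap.adjoint T = T) (ξ : H)
    {n : ℕ} {x : Pow H (n + 1)} (hx : x ∈ symSpace T (n + 1)) : unsnocOp ξ n x ∈ symSpace T n := by
  refine mem_symSpace_iff.2 fun j hj => ?_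
  rw [← unsnocOp_leg hT hj, hx]

/-- Annihilating an end factor preserves symmetry, so no projection is left in the annihilator. -/
theorem adjoint_createN [CompleteSpace H] (hT : ContinuousLinearMap.adjoint T = T) (ξ : H) (n : ℕ)
    (x : symSpace T (n + 1)) : (ContinuousLinearMap.adjoint (createN T ξ n) x : Pow H n) =
      ((Real.sqrt (n + 1) : ℝ) : ℂ) • unconsOp ξ n x := by
  suffices ContinuousLinearMap.adjoint (createN T ξ n) x =
      ((Real.sqrt (n + 1) : ℝ) : ℂ) • ⟨unconsOp ξ n x, unconsOp_mem_symSpace hT ξ x.2⟩ from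
    congrArg Subtype.val this
  refine ext_inner_right ℂ fun y => ?_
  rw [ContinuousLinearMap.adjoint_inner_left, createN_eq, inner_smul_right, inner_smul_left,
    Complex.conj_ofReal, Submodule.coe_inner, inner_symProj x.2, Submodule.coe_inner]
  exact congrArg _ (ContinuousLinearMap.adjoint_inner_left (consOp ξ n) _ _).symm

theorem adjoint_createRightN [CompleteSpace H] (hT : ContinuousLinearMap.adjoint T = T) (ξ : H)
    (n : ℕ) (x : symSpace T (n + 1)) :
    (ContinuousLinearMap.adjoint (createRightN T ξ n) x : Pow H n) =
      ((Real.sqrt (n + 1) : ℝ) : ℂ) • unsnocOp ξ n x := by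
  suffices ContinuousLinearMap.adjoint (createRightN T ξ n) x =
      ((Real.sqrt (n + 1) : ℝ) : ℂ) • ⟨unsnocOp ξ n x, unsnocOp_mem_symSpace hT ξ x.2⟩ from
    congrArg Subtype.val this
  refine ext_inner_right ℂ fun y => ?_
  rw [ContinuousLinearMap.adjoint_inner_left, createRightN_eq, inner_smul_right, inner_smul_left,
    Complex.conj_ofReal, Submodule.coe_inner, inner_symProj x.2, Submodule.coe_inner]
  exact congrArg _ (ContinuousLinearMap.adjoint_inner_left (snocOp ξ n) _ _).symm

/-- Without projections, this is the commutation of annihilation at opposite ends. -/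
theorem adjoint_createN_comm [CompleteSpace H] (hT : ContinuousLinearMap.adjoint T = T)
    (η η' : H) (n : ℕ) (x : symSpace T (n + 2)) :
    ContinuousLinearMap.adjoint (createN T η n)
        (ContinuousLinearMap.adjoint (createRightN T η' (n + 1)) x) =
      ContinuousLinearMap.adjoint (createRightN T η' n)
        (ContinuousLinearMap.adjoint (createN T η (n + 1)) x) := by
  refine Subtype.ext ?_
  rw [adjoint_createN hT, adjoint_createRightN hT, adjoint_createRightN hT, adjoint_createN hT,
    map_smul, map_smul, unsnocOp_unconsOp]

/-- Passing to adjoints avoids manipulating the projections that the creators contain. -/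
theorem createN_comm [CompleteSpace H] (hT : ContinuousLinearMap.adjoint T = T)
    (ξ ξ' : H) (n : ℕ) (x : symSpace T n) :
    createN T ξ (n + 1) (createRightN T ξ' n x) = createRightN T ξ' (n + 1) (createN T ξ n x) := by
  refine ext_inner_left ℂ fun z => ?_
  rw [← ContinuousLinearMap.adjoint_inner_left, ← ContinuousLinearMap.adjoint_inner_left,
    ← ContinuousLinearMap.adjoint_inner_left, ← ContinuousLinearMap.adjoint_inner_left,
    adjoint_createN_comm hT]

/-- The operator `a_l(η) T_0 ⋯ T_{n-1} a_r(ξ)^*` on `H^{⊗n}`. -/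
def exchangeOp (T : HTensor H H →L[ℂ] HTensor H H) (η ξ : H) (n : ℕ) : Pow H n →L[ℂ] Pow H n :=
  unconsOp η n ∘L legChain T (n + 1) 0 n ∘L snocOp ξ n

theorem sqrt_smul_sqrt_smul {M : Type*} [AddCommGroup M] [Module ℂ M] (n : ℕ) (x : M) :
    ((Real.sqrt (n + 1) : ℝ) : ℂ) • ((Real.sqrt (n + 1) : ℝ) : ℂ) • x = ((n : ℂ) + 1) • x := by
  rw [smul_smul, ← Complex.ofReal_mul, Real.mul_self_sqrt (by positivity)]
  norm_cast

section

variable [CompleteSpace H] (hT : ContinuousLinearMap.adjoint T = T)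
  (h2 : T ∘L T = ContinuousLinearMap.id ℂ _) (hB : Braided T)

include hT h2 hB

theorem annihilate_createRight_zero (η ξ : H) (x : symSpace T 0) :
    (ContinuousLinearMap.adjoint (createN T η 0) (createRightN T ξ 0 x) : Pow H 0) =
      exchangeOp T η ξ 0 x := by
  have h := symProj_snocOp hT h2 hB 0 ξ x.2
  rw [adjoint_createN hT, createRightN_eq, Submodule.coe_smul, map_smul, sqrt_smul_sqrt_smul,
    ← map_smul, h, Finset.sum_range_one]
  rfl

/-- The two factors `√(n + 2)` cancel the denominator of the mean. The terms with `k ≥ 1` leave the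
first factor alone, so annihilating it leaves the coset sum for one particle fewer, which is the
right creator applied after the annihilator. -/
theorem annihilate_createRight_succ (η ξ : H) (n : ℕ) (x : symSpace T (n + 1)) :
    (ContinuousLinearMap.adjoint (createN T η (n + 1)) (createRightN T ξ (n + 1) x) :
        Pow H (n + 1)) =
      exchangeOp T η ξ (n + 1) x +
        createRightN T ξ n (ContinuousLinearMap.adjoint (createN T η n) x) := by
  have h := symProj_snocOp hT h2 hB (n + 1) ξ x.2
  -- `Finset.sum_range_succ'` separates the term `k = 0`, the full chain that carries `ξ` to the
  -- front.
  rw [adjoint_createN hT, createRightN_eq, Submodule.coe_smul, map_smul, sqrt_smul_sqrt_smul,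
    ← map_smul, h, Finset.sum_range_succ', map_add,
    add_comm (exchangeOp T η ξ (n + 1) (x : Pow H (n + 1))), createRightN_eq, adjoint_createN hT,
    map_smul, map_smul, sqrt_smul_sqrt_smul, Submodule.coe_smul,
    symProj_snocOp hT h2 hB n ξ (unconsOp_mem_symSpace hT η x.2), map_sum]
  congr 1
  refine Finset.sum_congr rfl fun k hk => ?_
  rw [unconsOp_legChain hT, unconsOp_snocOp, Nat.add_sub_add_right]

/-- The fields built from left and right creation and annihilation operators commute if the
exchange operators of the left-right and of the right-left pair are adjoint to each other. -/
theorem field_comm_of_exchange {ξ η ξ' η' : H}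
    (h : ∀ n, exchangeOp T η ξ' n = ContinuousLinearMap.adjoint (exchangeOp T ξ η' n))
    (Ψ : finPart T) :
    (raiseOp T (createN T ξ) +
        lowerOp T fun n => ContinuousLinearMap.adjoint (createN T η n))
      ((raiseOp T (createRightN T ξ') +
        lowerOp T fun n => ContinuousLinearMap.adjoint (createRightN T η' n)) Ψ) =
    (raiseOp T (createRightN T ξ') +
        lowerOp T fun n => ContinuousLinearMap.adjoint (createRightN T η' n))
      ((raiseOp T (createN T ξ) +
        lowerOp T fun n => ContinuousLinearMap.adjoint (createN T η n)) Ψ) := by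
  refine raise_lower_comm (createN_comm hT ξ ξ') (adjoint_createN_comm hT η η') (fun x => ?_)
    (fun n x => ?_) Ψ
  · refine ext_inner_left ℂ fun y => ?_
    rw [Submodule.coe_inner, annihilate_createRight_zero hT h2 hB, h,
      ContinuousLinearMap.adjoint_inner_right, ← annihilate_createRight_zero hT h2 hB,
      ← Submodule.coe_inner, ContinuousLinearMap.adjoint_inner_left,
      ContinuousLinearMap.adjoint_inner_right]
  -- Both mixed terms are taken weakly. `h3` is the same commutator formula for the pair `ξ`, `η'`,
  -- read through adjoints. The hypothesis matches the two exchange terms, and the remaining terms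
  -- agree crosswise.
  · have h1 : ∀ y : symSpace T (n + 1),
        inner ℂ y (ContinuousLinearMap.adjoint (createN T η (n + 1))
          (createRightN T ξ' (n + 1) x)) =
        inner ℂ (y : Pow H (n + 1)) (exchangeOp T η ξ' (n + 1) x) +
          inner ℂ y (createRightN T ξ' n (ContinuousLinearMap.adjoint (createN T η n) x)) := by
      intro y
      rw [Submodule.coe_inner, annihilate_createRight_succ hT h2 hB, inner_add_right,
        Submodule.coe_inner]
    have h3 : ∀ y : symSpace T (n + 1),
        inner ℂ y (ContinuousLinearMap.adjoint (createRightN T η' (n + 1))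
          (createN T ξ (n + 1) x)) =
        inner ℂ (exchangeOp T ξ η' (n + 1) y) (x : Pow H (n + 1)) +
          inner ℂ y (createN T ξ n (ContinuousLinearMap.adjoint (createRightN T η' n) x)) := by
      intro y
      rw [ContinuousLinearMap.adjoint_inner_right, ← ContinuousLinearMap.adjoint_inner_left,
        Submodule.coe_inner, annihilate_createRight_succ hT h2 hB, inner_add_left,
        ← Submodule.coe_inner, ← ContinuousLinearMap.adjoint_inner_right (createRightN T η' n),
        ← ContinuousLinearMap.adjoint_inner_left (createN T ξ n)]
    refine ext_inner_left ℂ fun y => ?_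
    rw [inner_add_right, inner_add_right, h1, h3, h, ContinuousLinearMap.adjoint_inner_right]
    ring

end

/-! ### Conjugation by `Θ` exchanges left and right fields. -/

section Conjugate

variable {J : H →ₗᵢ⋆[ℂ] H} (hJ : ∀ a, J (J a) = a)
  (hTJ : ∀ w, mapConjT J J (flipT H H (T w)) = T (mapConjT J J (flipT H H w)))

theorem symProj_of_mem {n : ℕ} {x : Pow H n} (hx : x ∈ symSpace T n) :
    (symProj T n x : Pow H n) = x := symProj_eq hx fun _ _ => rfl

include hTJ in
-- The reversal already preserves symmetric vectors, so the projection in the definition of `Θ` acts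
-- trivially.
theorem secondQuantConj_apply (Ψ : finPart T) (n : ℕ) :
    ((secondQuantConj T J Ψ : Fock T) n : Pow H n) = revConj J n ((Ψ : Fock T) n) :=
  symProj_of_mem (revConj_mem_symSpace hTJ ((Ψ : Fock T) n).2)

include hJ in
theorem inner_revConj_left (n : ℕ) (x y : Pow H n) :
    inner ℂ (revConj J n x) y = inner ℂ (revConj J n y) x := by
  rw [← inner_revConj_revConj J, revConj_revConj hJ]

include hJ in
theorem inner_revConj_right {n : ℕ} (x y : Pow H n) :
    inner ℂ x (revConj J n y) = inner ℂ y (revConj J n x) := by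
  rw [← inner_revConj_revConj J, revConj_revConj hJ]

include hJ hTJ in
-- An antiunitary involution that preserves a closed subspace commutes with the orthogonal
-- projection onto it.
theorem revConj_symProj (n : ℕ) (x : Pow H n) :
    revConj J n (symProj T n x) = symProj T n (revConj J n x) := by
  refine (symProj_eq (revConj_mem_symSpace hTJ (Subtype.property _)) fun z hz => ?_).symm
  rw [inner_revConj_right hJ z x, inner_revConj_right hJ z, ← inner_conj_symm,
    ← inner_symProj (revConj_mem_symSpace hTJ hz) x, inner_conj_symm]

include hJ in
theorem revConj_unconsOp (n : ℕ) (a : H) (x : Pow H (n + 1)) :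
    revConj J n (unconsOp a n (revConj J (n + 1) x)) = unsnocOp (J a) n x := by
  refine ext_inner_right ℂ fun y => ?_
  rw [inner_revConj_left hJ, unconsOp, ContinuousLinearMap.adjoint_inner_right,
    inner_revConj_right hJ, revConj_consOp, revConj_revConj hJ, unsnocOp,
    ContinuousLinearMap.adjoint_inner_left]

include hJ hTJ in
-- Reversal exchanges the two ends, and the factors `√(n + 1)` are real, so antilinearity affects
-- only the one-particle vectors.
theorem secondQuantConj_conj [CompleteSpace H] (hT : ContinuousLinearMap.adjoint T = T) (ξ η : H) (Ψ : finPart T) :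
    secondQuantConj T J ((create T ξ + annihilate T η) (secondQuantConj T J Ψ)) =
      (raiseOp T (createRightN T (J ξ)) +
        lowerOp T fun n => ContinuousLinearMap.adjoint (createRightN T (J η) n)) Ψ := by
  refine finPart_ext fun n => Subtype.ext ?_
  rw [secondQuantConj_apply hTJ, LinearMap.add_apply, LinearMap.add_apply, finPart_add_apply,
    finPart_add_apply, Submodule.coe_add, Submodule.coe_add, map_add, annihilate, lowerOp_apply,
    lowerOp_apply, adjoint_createN hT, adjoint_createRightN hT, secondQuantConj_apply hTJ,
    map_smulₛₗ, Complex.conj_ofReal, revConj_unconsOp hJ]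
  congr 1
  cases n with
  | zero => simp only [create, raiseOp_zero]; simp
  | succ n =>
    rw [create, raiseOp_succ, raiseOp_succ, createN_eq, createRightN_eq, Submodule.coe_smul,
      Submodule.coe_smul, map_smulₛₗ, Complex.conj_ofReal, revConj_symProj hJ hTJ,
      revConj_consOp, secondQuantConj_apply hTJ, revConj_revConj hJ]

end Conjugate

end FockCommutator

/-! ### The two-particle operator `R.op` as a self-adjoint involution compatible with `Θ`. -/

section TwoParticle

variable {K : Type u} [NormedAddCommGroup K] [InnerProductSpace ℂ K]

theorem twoPMap_tmul (ξ η : OneP K) : twoPMap K (tmul ξ η) = prodTensor ξ η := by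
  rw [twoPMap, tmul, extendT_ofAlg]; rfl

theorem norm_twoPMap (z : HTensor (OneP K) (OneP K)) : ‖twoPMap K z‖ = ‖z‖ := by
  refine (denseRange_ofAlg _ _).induction_on z (isClosed_eq (by fun_prop) (by fun_prop)) fun a => ?_
  rw [twoPMap, extendT_ofAlg]
  simp

theorem inner_twoPMap (z w : HTensor (OneP K) (OneP K)) :
    inner ℂ (twoPMap K z) (twoPMap K w) = inner ℂ z w :=
  LinearIsometry.inner_map_map ⟨(twoPMap K).toLinearMap, norm_twoPMap⟩ z w

/-- Rectangles form a π-system generating the product σ-algebra, and vanishing of the integral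
passes to complements and to countable disjoint unions. The complement step uses that the integral
over `Q ×ˢ Q` itself vanishes. -/
theorem ae_eq_zero_of_setIntegral_prod_eq_zero {E : Type*} [NormedAddCommGroup E] [NormedSpace ℝ E]
    [CompleteSpace E] {Q : Set ℝ} (hQ : MeasurableSet Q) {Ψ : ℝ × ℝ → E}
    (hΨ : IntegrableOn Ψ (Q ×ˢ Q) volume)
    (h : ∀ A B : Set ℝ, MeasurableSet A → MeasurableSet B → A ⊆ Q → B ⊆ Q →
      ∫ p in A ×ˢ B, Ψ p = 0) : Ψ =ᵐ[volume.restrict (Q ×ˢ Q)] 0 := by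
  have hQQ : MeasurableSet (Q ×ˢ Q) := hQ.prod hQ
  have key : ∀ S : Set (ℝ × ℝ), MeasurableSet S → ∫ p in S, Ψ p ∂(volume.restrict (Q ×ˢ Q)) = 0 := by
    intro S hS
    induction S, hS using MeasurableSpace.induction_on_inter generateFrom_prod.symm isPiSystem_prod with
    | empty => simp
    | basic S hS =>
      obtain ⟨A, (hA : MeasurableSet A), B, (hB : MeasurableSet B), rfl⟩ := hS
      rw [Measure.restrict_restrict (hA.prod hB), Set.prod_inter_prod]
      exact h _ _ (hA.inter hQ) (hB.inter hQ) Set.inter_subset_right Set.inter_subset_right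
    | compl S hS ih =>
      have h1 := integral_add_compl hS hΨ
      have h2 : ∫ p, Ψ p ∂(volume.restrict (Q ×ˢ Q)) = 0 := h Q Q hQ hQ subset_rfl subset_rfl
      rw [ih, zero_add, h2] at h1
      exact h1
    | iUnion S hd hS ih =>
      have := hasSum_integral_iUnion hS hd hΨ.integrableOn
      simp only [ih] at this
      exact this.unique hasSum_zero
  exact Integrable.ae_eq_zero_of_forall_setIntegral_eq_zero hΨ fun S hS _ => key S hS

/-- Product functions are total in the two-particle `L²` space. Hence the isometry `twoPMap` is
onto, which justifies using its adjoint as inverse in `YBFunction.op`. -/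
theorem twoP_eq_zero {Ψ : TwoP K} (h : ∀ ξ η : OneP K, inner ℂ (prodTensor ξ η) Ψ = 0) : Ψ = 0 := by
  have hInt : ∀ A B : Set ℝ, volume A ≠ ⊤ → volume B ≠ ⊤ → IntegrableOn Ψ (A ×ˢ B) volume := by
    intro A B hA hB
    have : volume (A ×ˢ B) ≠ ⊤ := by
      rw [Measure.volume_eq_prod, Measure.prod_prod]; exact ENNReal.mul_ne_top hA hB
    have : IsFiniteMeasure ((volume : Measure (ℝ × ℝ)).restrict (A ×ˢ B)) :=
      ⟨by simpa using this.lt_top⟩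
    exact MemLp.integrable one_le_two ((Lp.memLp Ψ).restrict _)
  have hz : ∀ A B : Set ℝ, MeasurableSet A → MeasurableSet B → volume A ≠ ⊤ → volume B ≠ ⊤ →
      ∫ p in A ×ˢ B, Ψ p = 0 := by
    intro A B hA hB hA' hB'
    refine ext_inner_left ℂ fun v => ?_
    rw [inner_zero_right]
    refine htensor_induction (p := fun v => inner ℂ v (∫ p in A ×ˢ B, Ψ p) = 0)
      (isClosed_eq (by fun_prop) (by fun_prop))
      (fun x y hx hy => by rw [inner_add_left, hx, hy, add_zero]) (fun x y => ?_) v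
    rw [← integral_inner (hInt A B hA' hB'), ← integral_indicator (hA.prod hB),
      -- The integral over a rectangle, paired with `x ⊗ y`, is the inner product with the product
      -- of two indicator functions.
      ← h (indicatorConstLp 2 hA hA' x) (indicatorConstLp 2 hB hB' y), L2.inner_def]
    refine integral_congr_ae ?_
    filter_upwards [prodTensor_coeFn (indicatorConstLp 2 hA hA' x) (indicatorConstLp 2 hB hB' y),
      ae_fst (indicatorConstLp_coeFn (p := 2) (hs := hA) (hμs := hA') (c := x)),
      ae_snd (indicatorConstLp_coeFn (p := 2) (hs := hB) (hμs := hB') (c := y))] with p h1 h2 h3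
    rw [h1, h2, h3]
    by_cases h4 : p.1 ∈ A <;> by_cases h5 : p.2 ∈ B <;>
      simp [Set.indicator, h4, h5, zero_tmul, tmul_zero]
  have hN : ∀ n : ℕ, (Ψ : ℝ × ℝ → HTensor K K) =ᵐ[volume.restrict
      (Set.Icc (-(n : ℝ)) n ×ˢ Set.Icc (-(n : ℝ)) n)] 0 := by
    intro n
    have hfin : volume (Set.Icc (-(n : ℝ)) n) ≠ ⊤ := measure_Icc_lt_top.ne
    refine ae_eq_zero_of_setIntegral_prod_eq_zero measurableSet_Icc (hInt _ _ hfin hfin)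
      fun A B hA hB hA' hB' => hz A B hA hB (measure_ne_top_of_subset hA' hfin)
        (measure_ne_top_of_subset hB' hfin)
  refine Lp.ext ?_
  refine EventuallyEq.trans ?_ (Lp.coeFn_zero _ _ _).symm
  have hU : (⋃ n : ℕ, Set.Icc (-(n : ℝ)) n ×ˢ Set.Icc (-(n : ℝ)) n) = Set.univ := by
    refine Set.eq_univ_of_forall fun p => ?_
    obtain ⟨n, hn⟩ := exists_nat_ge (max |p.1| |p.2|)
    refine Set.mem_iUnion.2 ⟨n, ?_, ?_⟩
    · exact abs_le.1 ((le_max_left _ _).trans hn)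
    · exact abs_le.1 ((le_max_right _ _).trans hn)
  have := (ae_restrict_iUnion_iff (μ := (volume : Measure (ℝ × ℝ)))
    (fun n : ℕ => Set.Icc (-(n : ℝ)) n ×ˢ Set.Icc (-(n : ℝ)) n) (fun p => Ψ p = 0)).2 hN
  rwa [hU, Measure.restrict_univ] at this

theorem twoPMap_adjoint_apply (Ψ : TwoP K) :
    twoPMap K (ContinuousLinearMap.adjoint (twoPMap K) Ψ) = Ψ := by
  rw [← sub_eq_zero]
  refine twoP_eq_zero fun ξ η => ?_
  rw [← twoPMap_tmul, inner_sub_right, inner_twoPMap, ContinuousLinearMap.adjoint_inner_right,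
    sub_self]

theorem twistedFlip_coeFn {R : ℝ → HTensor K K →L[ℂ] HTensor K K}
    (hm : ∀ x, AEStronglyMeasurable (fun θ => R θ x) volume)
    (hu : ∀ᵐ θ : ℝ, R θ ∈ unitary (HTensor K K →L[ℂ] HTensor K K)) (Ψ : TwoP K) :
    twistedFlip hm hu Ψ =ᵐ[volume] fun p => R (p.1 - p.2) (Ψ p.swap) := by
  have h1 := Lp.coeFn_compMeasurePreserving Ψ
    (Measure.measurePreserving_swap (μ := (volume : Measure ℝ)) (ν := (volume : Measure ℝ)))
  have h2 := (memLp_field hm hu (Lp.compMeasurePreserving Prod.swap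
    (Measure.measurePreserving_swap (μ := (volume : Measure ℝ)) (ν := (volume : Measure ℝ)))
    Ψ)).coeFn_toLp
  filter_upwards [h1, h2] with p h1 h2
  refine h2.trans ?_
  rw [h1]; rfl

/-- A contractive involution is isometric, since `‖x‖ = ‖A (A x)‖ ≤ ‖A x‖`. Being its own inverse,
it is then its own adjoint. -/
theorem adjoint_eq_self_of_contraction {E : Type*} [NormedAddCommGroup E] [InnerProductSpace ℂ E]
    [CompleteSpace E] {A : E →L[ℂ] E} (h : ∀ x, ‖A x‖ ≤ ‖x‖) (h2 : A ∘L A = ContinuousLinearMap.id ℂ E) :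
    ContinuousLinearMap.adjoint A = A := by
  have h2' : ∀ x, A (A x) = x := fun x => congrArg (fun C => C x) h2
  have hn : ∀ x, ‖A x‖ = ‖x‖ := fun x => (h x).antisymm (by simpa [h2'] using h (A x))
  refine ContinuousLinearMap.ext fun x => ext_inner_right ℂ fun y => ?_
  rw [ContinuousLinearMap.adjoint_inner_left]
  have := LinearIsometry.inner_map_map ⟨A.toLinearMap, hn⟩ x (A y)
  change inner ℂ (A x) (A (A y)) = _ at this
  rw [← this, h2']

theorem ae_swap {p : ℝ × ℝ → Prop} (h : ∀ᵐ x, p x) : ∀ᵐ x : ℝ × ℝ, p x.swap :=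
  (Measure.measurePreserving_swap (μ := (volume : Measure ℝ))
    (ν := (volume : Measure ℝ))).quasiMeasurePreserving.ae h

theorem ae_sub {p : ℝ → Prop} (h : ∀ᵐ x, p x) : ∀ᵐ x : ℝ × ℝ, p (x.1 - x.2) :=
  (quasiMeasurePreserving_sub volume volume).ae h

variable {G : Type v} [Group G] {V : G →* (K ≃ₗᵢ[ℂ] K)} {Γ : Conjugation K}
  (R : YBFunction V Γ)

theorem twoPMap_op (w : HTensor (OneP K) (OneP K)) :
    twoPMap K (R.op w) = twistedFlip R.measurable R.isUnitary (twoPMap K w) :=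
  twoPMap_adjoint_apply _

theorem twoPMap_op_coeFn (w : HTensor (OneP K) (OneP K)) :
    twoPMap K (R.op w) =ᵐ[volume] fun p => R.toFun (p.1 - p.2) (twoPMap K w p.swap) := by
  rw [twoPMap_op]
  exact twistedFlip_coeFn _ _ _

/-- Applying the operator twice restores the arguments and leaves `R(θ₁ - θ₂) R(θ₂ - θ₁) = 1`. -/
theorem op_comp_op : R.op ∘L R.op = ContinuousLinearMap.id ℂ _ := by
  ext w
  refine (LinearIsometry.mk (twoPMap K).toLinearMap norm_twoPMap).injective ?_
  change twoPMap K (R.op (R.op w)) = twoPMap K w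
  refine Lp.ext ?_
  filter_upwards [twoPMap_op_coeFn R (R.op w), ae_swap (twoPMap_op_coeFn R w),
    ae_sub R.inverse] with p h1 h2 h3
  rw [h1, h2]
  have := congrArg (fun C => C (twoPMap K w p)) h3.2
  simpa [neg_sub] using this

theorem norm_op_le (w : HTensor (OneP K) (OneP K)) : ‖R.op w‖ ≤ ‖w‖ := by
  rw [← norm_twoPMap, ← norm_twoPMap w, Lp.norm_def, Lp.norm_def]
  refine ENNReal.toReal_mono (Lp.eLpNorm_ne_top _) ?_
  have h1 := twoPMap_op_coeFn R w
  have h2 : eLpNorm (twoPMap K (R.op w)) 2 volume =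
      eLpNorm (fun p : ℝ × ℝ => twoPMap K w p.swap) 2 volume := by
    refine eLpNorm_congr_norm_ae ?_
    filter_upwards [h1, ae_sub R.isUnitary] with p h1 h2
    rw [h1, ContinuousLinearMap.norm_map_of_mem_unitary h2]
  rw [h2]
  exact (eLpNorm_comp_measurePreserving (Lp.aestronglyMeasurable (twoPMap K w))
    (Measure.measurePreserving_swap (μ := (volume : Measure ℝ))
    (ν := (volume : Measure ℝ)))).le

theorem adjoint_op : ContinuousLinearMap.adjoint R.op = R.op :=
  adjoint_eq_self_of_contraction (norm_op_le R) (op_comp_op R)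

theorem oneTCP_coeFn (ξ : OneP K) : oneTCP Γ ξ =ᵐ[volume] fun θ => Γ.map (ξ θ) :=
  Γ.map.toContinuousLinearMap.coeFn_compLpL (p := 2) (μ := volume) ξ

theorem oneTCP_oneTCP (ξ : OneP K) : oneTCP Γ (oneTCP Γ ξ) = ξ := by
  refine Lp.ext ?_
  filter_upwards [oneTCP_coeFn (Γ := Γ) ξ, oneTCP_coeFn (Γ := Γ) (oneTCP Γ ξ)] with θ h1 h2
  rw [h2, h1, Γ.involutive]

theorem twoPMap_tcp_coeFn (w : HTensor (OneP K) (OneP K)) :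
    twoPMap K (mapConjT (oneTCP Γ) (oneTCP Γ) (flipT _ _ w)) =ᵐ[volume]
      fun p => mapConjT Γ.map Γ.map (flipT K K (twoPMap K w p.swap)) := by
  let A : HTensor K K →L⋆[ℂ] HTensor K K :=
    (mapConjT Γ.map Γ.map).toContinuousLinearMap.comp (flipT K K)
  let B : TwoP K →L[ℂ] TwoP K := (Lp.compMeasurePreservingₗᵢ ℂ Prod.swap
    (Measure.measurePreserving_swap (μ := (volume : Measure ℝ)) (ν := (volume : Measure ℝ)))
    ).toContinuousLinearMap
  have hB : ∀ Ψ : TwoP K, B Ψ =ᵐ[volume] fun p => Ψ p.swap := fun Ψ =>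
    Lp.coeFn_compMeasurePreserving Ψ
      (Measure.measurePreserving_swap (μ := (volume : Measure ℝ)) (ν := (volume : Measure ℝ)))
  have hA : ∀ Ψ : TwoP K, A.compLpL 2 volume Ψ =ᵐ[volume] fun p => A (Ψ p) := fun Ψ =>
    A.coeFn_compLpL (p := 2) (μ := volume) Ψ
  have key : (twoPMap K).comp ((mapConjT (oneTCP Γ) (oneTCP Γ)).toContinuousLinearMap.comp
      (flipT _ _)) = (A.compLpL 2 volume).comp (B.comp (twoPMap K)) := by
    refine htensor_ext fun ξ η => ?_
    simp only [ContinuousLinearMap.comp_apply, flipT_tmul, LinearIsometry.coe_toContinuousLinearMap,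
      mapConjT_tmul, twoPMap_tmul]
    refine Lp.ext ?_
    filter_upwards [hA (B (prodTensor ξ η)), hB (prodTensor ξ η),
      ae_swap (prodTensor_coeFn ξ η), prodTensor_coeFn (oneTCP Γ η) (oneTCP Γ ξ),
      ae_fst (oneTCP_coeFn (Γ := Γ) η), ae_snd (oneTCP_coeFn (Γ := Γ) ξ)] with p h1 h2 h3 h4 h5 h6
    rw [h1, h2, h3, h4, h5, h6]
    simp [A, flipT_tmul, mapConjT_tmul]
  have := congrArg (fun C => C w) key
  simp only [ContinuousLinearMap.comp_apply, LinearIsometry.coe_toContinuousLinearMap] at this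
  rw [this]
  filter_upwards [hA (B (twoPMap K w)), hB (twoPMap K w)] with p h1 h2
  rw [h1, h2]; rfl

theorem mapConjT_mapConjT_flipT (x : HTensor K K) :
    flipT K K (mapConjT Γ.map Γ.map (mapConjT Γ.map Γ.map (flipT K K x))) = x := by
  have : (flipT K K).comp ((mapConjT Γ.map Γ.map).toContinuousLinearMap.comp
    ((mapConjT Γ.map Γ.map).toContinuousLinearMap.comp (flipT K K))) =
      ContinuousLinearMap.id ℂ _ :=
    htensor_ext fun x y => by simp [flipT_tmul, mapConjT_tmul, Γ.involutive]
  exact congrArg (fun C => C x) this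

/-- Flipping the rapidities changes the sign of `θ₁ - θ₂`, and the `tcp` condition compensates for
this in the fibre. -/
theorem op_tcp (w : HTensor (OneP K) (OneP K)) :
    mapConjT (oneTCP Γ) (oneTCP Γ) (flipT _ _ (R.op w)) =
      R.op (mapConjT (oneTCP Γ) (oneTCP Γ) (flipT _ _ w)) := by
  refine (LinearIsometry.mk (twoPMap K).toLinearMap norm_twoPMap).injective ?_
  change twoPMap K _ = twoPMap K _
  refine Lp.ext ?_
  filter_upwards [twoPMap_op_coeFn R (mapConjT (oneTCP Γ) (oneTCP Γ) (flipT _ _ w)),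
    twoPMap_tcp_coeFn (Γ := Γ) (R.op w), ae_swap (twoPMap_op_coeFn R w),
    ae_swap (twoPMap_tcp_coeFn (Γ := Γ) w), ae_sub R.tcp] with p h1 h2 h3 h4 h5
  rw [h1, h2, h3, h4, ← h5, mapConjT_mapConjT_flipT]
  simp

end TwoParticle

/-! ### Tensor products of general `L²` spaces. -/

section LpTensor

variable {α β : Type*} [MeasurableSpace α] [MeasurableSpace β] {μ : Measure α} {ν : Measure β}
  {E F : Type*} [NormedAddCommGroup E] [InnerProductSpace ℂ E]
  [NormedAddCommGroup F] [InnerProductSpace ℂ F]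

theorem memLp_lpTensor (ξ : Lp E 2 μ) (η : Lp F 2 ν) :
    MemLp (fun p : α × β => tmul (ξ p.1) (η p.2)) 2 (μ.prod ν) := by
  have h1 : AEStronglyMeasurable (fun p : α × β => ξ p.1) (μ.prod ν) :=
    (Lp.aestronglyMeasurable ξ).comp_quasiMeasurePreserving Measure.quasiMeasurePreserving_fst
  have h2 : AEStronglyMeasurable (fun p : α × β => η p.2) (μ.prod ν) :=
    (Lp.aestronglyMeasurable η).comp_quasiMeasurePreserving Measure.quasiMeasurePreserving_snd
  have hm : AEStronglyMeasurable (fun p : α × β => tmul (ξ p.1) (η p.2)) (μ.prod ν) :=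
    (tmulL E F).aestronglyMeasurable_comp₂ h1 h2
  rw [memLp_two_iff_integrable_sq_norm hm]
  simp only [norm_tmul_eq, mul_pow]
  exact Integrable.mul_prod ((memLp_two_iff_integrable_sq_norm (Lp.aestronglyMeasurable ξ)).1
    (Lp.memLp ξ)) ((memLp_two_iff_integrable_sq_norm (Lp.aestronglyMeasurable η)).1 (Lp.memLp η))

theorem ae_prod_fst {p : α → Prop} (h : ∀ᵐ x ∂μ, p x) : ∀ᵐ z ∂(μ.prod ν), p z.1 :=
  Measure.quasiMeasurePreserving_fst.ae h

theorem ae_prod_snd {p : β → Prop} (h : ∀ᵐ x ∂ν, p x) : ∀ᵐ z ∂(μ.prod ν), p z.2 :=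
  Measure.quasiMeasurePreserving_snd.ae h

/-- The bilinear map that sends `ξ, η` to the function `(s, t) ↦ ξ(s) ⊗ η(t)`. -/
def lpTensor : Lp E 2 μ →ₗ[ℂ] Lp F 2 ν →ₗ[ℂ] Lp (HTensor E F) 2 (μ.prod ν) :=
  LinearMap.mk₂ ℂ (fun ξ η => (memLp_lpTensor ξ η).toLp _)
    (fun ξ ξ' η => by
      ext1
      filter_upwards [(memLp_lpTensor (ξ + ξ') η).coeFn_toLp, (memLp_lpTensor ξ η).coeFn_toLp,
        (memLp_lpTensor ξ' η).coeFn_toLp, ae_prod_fst (Lp.coeFn_add ξ ξ'),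
        Lp.coeFn_add ((memLp_lpTensor ξ η).toLp _) ((memLp_lpTensor ξ' η).toLp _)]
        with p h1 h2 h3 h4 h5
      rw [h1, h5, Pi.add_apply, h2, h3, h4, Pi.add_apply, add_tmul])
    (fun c ξ η => by
      ext1
      filter_upwards [(memLp_lpTensor (c • ξ) η).coeFn_toLp, (memLp_lpTensor ξ η).coeFn_toLp,
        ae_prod_fst (Lp.coeFn_smul c ξ), Lp.coeFn_smul c ((memLp_lpTensor ξ η).toLp _)]
        with p h1 h2 h3 h4
      rw [h1, h4, Pi.smul_apply, h2, h3, Pi.smul_apply, smul_tmul])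
    (fun ξ η η' => by
      ext1
      filter_upwards [(memLp_lpTensor ξ (η + η')).coeFn_toLp, (memLp_lpTensor ξ η).coeFn_toLp,
        (memLp_lpTensor ξ η').coeFn_toLp, ae_prod_snd (Lp.coeFn_add η η'),
        Lp.coeFn_add ((memLp_lpTensor ξ η).toLp _) ((memLp_lpTensor ξ η').toLp _)]
        with p h1 h2 h3 h4 h5
      rw [h1, h5, Pi.add_apply, h2, h3, h4, Pi.add_apply, tmul_add])
    (fun c ξ η => by
      ext1
      filter_upwards [(memLp_lpTensor ξ (c • η)).coeFn_toLp, (memLp_lpTensor ξ η).coeFn_toLp,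
        ae_prod_snd (Lp.coeFn_smul c η), Lp.coeFn_smul c ((memLp_lpTensor ξ η).toLp _)]
        with p h1 h2 h3 h4
      rw [h1, h4, Pi.smul_apply, h2, h3, Pi.smul_apply, tmul_smul])

theorem lpTensor_coeFn (ξ : Lp E 2 μ) (η : Lp F 2 ν) :
    lpTensor ξ η =ᵐ[μ.prod ν] fun p => tmul (ξ p.1) (η p.2) :=
  (memLp_lpTensor ξ η).coeFn_toLp

variable [SFinite μ] [SFinite ν]

theorem inner_lpTensor (ξ ξ' : Lp E 2 μ) (η η' : Lp F 2 ν) :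
    inner ℂ (lpTensor ξ η) (lpTensor ξ' η') = inner ℂ ξ ξ' * inner ℂ η η' := by
  rw [L2.inner_def, L2.inner_def, L2.inner_def, ← integral_prod_mul]
  refine integral_congr_ae ?_
  filter_upwards [lpTensor_coeFn ξ η, lpTensor_coeFn ξ' η'] with p h1 h2
  rw [h1, h2, inner_tmul_tmul]

/-- The canonical map on the algebraic tensor product. -/
def algLpTensor : Lp E 2 μ ⊗[ℂ] Lp F 2 ν →ₗᵢ[ℂ] Lp (HTensor E F) 2 (μ.prod ν) :=
  (TensorProduct.lift (lpTensor (E := E) (F := F) (μ := μ) (ν := ν))).isometryOfInner fun x y => by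
    induction x using TensorProduct.induction_on with
    | zero => simp
    | add a b ha hb => simp only [map_add, inner_add_left, ha, hb]
    | tmul a b =>
      induction y using TensorProduct.induction_on with
      | zero => simp
      | add c d hc hd => simp only [map_add, inner_add_right, hc, hd]
      | tmul c d =>
        simp only [TensorProduct.lift.tmul, TensorProduct.inner_tmul]
        exact inner_lpTensor a c b d

variable (E F μ ν) in
/-- The canonical isometry `L²(μ, E) ⊗ L²(ν, F) → L²(μ × ν, E ⊗ F)`. -/
def lpTensorMap : HTensor (Lp E 2 μ) (Lp F 2 ν) →L[ℂ] Lp (HTensor E F) 2 (μ.prod ν) :=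
  extendT algLpTensor.toContinuousLinearMap

theorem lpTensorMap_tmul (ξ : Lp E 2 μ) (η : Lp F 2 ν) :
    lpTensorMap μ ν E F (tmul ξ η) = lpTensor ξ η := by
  rw [lpTensorMap, tmul, extendT_ofAlg]; rfl

theorem lpTensorMap_injective : Function.Injective (lpTensorMap μ ν E F) := by
  refine (injective_iff_map_eq_zero _).2 fun z hz => ?_
  have : ‖lpTensorMap μ ν E F z‖ = ‖z‖ := by
    refine (denseRange_ofAlg _ _).induction_on z (isClosed_eq (by fun_prop) (by fun_prop))
      fun a => ?_
    rw [lpTensorMap, extendT_ofAlg]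
    simp
  rwa [hz, norm_zero, eq_comm, norm_eq_zero] at this

end LpTensor

/-! ### Pointwise formulas for operators on `L²` spaces. -/

section AEFormula

/-- If the functions `A z` are given almost everywhere by `U(p) (B z)(τ p)` for pure tensors `z`,
then so they are for all `z`. -/
theorem ae_formula_of_tmul {α β E F W W' : Type*} [MeasurableSpace α] [MeasurableSpace β]
    {μ : Measure α} {ν : Measure β} [NormedAddCommGroup E] [InnerProductSpace ℂ E]
    [NormedAddCommGroup F] [InnerProductSpace ℂ F] [NormedAddCommGroup W] [NormedSpace ℂ W]
    [NormedAddCommGroup W'] [NormedSpace ℂ W'] {A : HTensor E F →L[ℂ] Lp W' 2 ν}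
    {B : HTensor E F →L[ℂ] Lp W 2 μ} {τ : β → α} (hτ : Measure.QuasiMeasurePreserving τ ν μ)
    (U : β → W →L[ℂ] W') (h : ∀ x y, A (tmul x y) =ᵐ[ν] fun p => U p (B (tmul x y) (τ p)))
    (z : HTensor E F) : A z =ᵐ[ν] fun p => U p (B z (τ p)) := by
  refine htensor_induction (p := fun z => A z =ᵐ[ν] fun p => U p (B z (τ p))) ?_ ?_ h z
  -- Convergence in `L²` gives convergence almost everywhere along a subsequence, extracted once for
  -- `A` and once more for `B`. Each `U p` is continuous, so the formula passes to the limit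
  -- pointwise, without any measurability of `U`.
  · refine IsSeqClosed.isClosed fun z z₀ hz hlim => ?_
    have h1 := tendstoInMeasure_of_tendsto_Lp ((A.continuous.tendsto z₀).comp hlim)
    obtain ⟨ns, hns, h1⟩ := h1.exists_seq_tendsto_ae
    have h2 := tendstoInMeasure_of_tendsto_Lp
      ((B.continuous.tendsto z₀).comp (hlim.comp hns.tendsto_atTop))
    obtain ⟨ms, hms, h2⟩ := h2.exists_seq_tendsto_ae
    have h3 : ∀ᵐ p ∂ν, ∀ i, A (z i) p = U p (B (z i) (τ p)) := ae_all_iff.2 hz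
    filter_upwards [h1, hτ.ae h2, h3] with p h1 h2 h3
    refine tendsto_nhds_unique (h1.comp hms.tendsto_atTop) ?_
    refine (((U p).continuous.tendsto _).comp h2).congr fun i => ?_
    exact (h3 _).symm
  · intro x y hx hy
    rw [map_add, map_add]
    filter_upwards [hx, hy, Lp.coeFn_add (A x) (A y), hτ.ae (Lp.coeFn_add (B x) (B y))]
      with p h1 h2 h3 h4
    rw [h3, h4, Pi.add_apply, Pi.add_apply, map_add, h1, h2]

/-- The image of a Haar measure under a linear surjection is a multiple, possibly infinite, of Haar
measure. This is what transports null sets along the coordinate maps and rapidity differences used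
below. -/
theorem quasiMeasurePreserving_of_surjective {E F : Type*} [NormedAddCommGroup E]
    [MeasurableSpace E] [BorelSpace E] [NormedSpace ℝ E] [NormedAddCommGroup F] [MeasurableSpace F]
    [BorelSpace F] [NormedSpace ℝ F] [LocallyCompactSpace E] (μ : Measure E) (ν : Measure F)
    [μ.IsAddHaarMeasure] [ν.IsAddHaarMeasure] (L : E →L[ℝ] F) (h : Function.Surjective L) :
    Measure.QuasiMeasurePreserving L μ ν := by
  refine ⟨L.continuous.measurable, ?_⟩
  obtain ⟨c, -, -, hc⟩ := L.toLinearMap.exists_map_addHaar_eq_smul_addHaar' μ ν h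
  change Measure.map L.toLinearMap μ ≪ ν
  rw [hc]
  exact Measure.smul_absolutelyContinuous

end AEFormula

/-! ### The braid relation from the Yang-Baxter equation, on `L²(ℝ³)`. -/

section Braid

variable {K : Type u} [NormedAddCommGroup K] [InnerProductSpace ℂ K]

variable (K) in
/-- The canonical isometry from the three-particle space to `L²(ℝ³ → K ⊗ K ⊗ K)`. -/
def threePMap : HTensor (OneP K) (HTensor (OneP K) (OneP K)) →L[ℂ]
    Lp (HTensor K (HTensor K K)) 2 (volume : Measure (ℝ × (ℝ × ℝ))) :=
  lpTensorMap volume volume K (HTensor K K) ∘L mapT (ContinuousLinearMap.id ℂ _) (twoPMap K)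

theorem threePMap_injective : Function.Injective (threePMap K) := by
  refine lpTensorMap_injective.comp (Function.LeftInverse.injective
    (g := mapT (ContinuousLinearMap.id ℂ _) (ContinuousLinearMap.adjoint (twoPMap K))) fun z => ?_)
  have : ContinuousLinearMap.adjoint (twoPMap K) ∘L twoPMap K = ContinuousLinearMap.id ℂ _ := by
    refine ContinuousLinearMap.ext fun w => ext_inner_left ℂ fun v => ?_
    rw [ContinuousLinearMap.comp_apply, ContinuousLinearMap.adjoint_inner_right, inner_twoPMap,
      ContinuousLinearMap.id_apply]
  refine (mapT_mapT _ _ _ _ z).trans ?_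
  rw [this, ContinuousLinearMap.id_comp, mapT_id_id, ContinuousLinearMap.id_apply]

theorem threePMap_tmul_coeFn (ξ : OneP K) (w : HTensor (OneP K) (OneP K)) :
    threePMap K (tmul ξ w) =ᵐ[volume] fun p => tmul (ξ p.1) (twoPMap K w p.2) := by
  rw [threePMap, ContinuousLinearMap.comp_apply, mapT_tmul, lpTensorMap_tmul]
  exact lpTensor_coeFn _ _

instance : (volume : Measure (ℝ × ℝ)).IsAddHaarMeasure :=
  inferInstanceAs ((volume : Measure ℝ).prod (volume : Measure ℝ)).IsAddHaarMeasure

instance : (volume : Measure (ℝ × (ℝ × ℝ))).IsAddHaarMeasure :=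
  inferInstanceAs ((volume : Measure ℝ).prod (volume : Measure (ℝ × ℝ))).IsAddHaarMeasure

theorem qmp_fst_snd : Measure.QuasiMeasurePreserving (fun p : ℝ × (ℝ × ℝ) => (p.1, p.2.1)) :=
  quasiMeasurePreserving_of_surjective volume volume
    ((ContinuousLinearMap.fst ℝ ℝ (ℝ × ℝ)).prod
      (ContinuousLinearMap.fst ℝ ℝ ℝ ∘L ContinuousLinearMap.snd ℝ ℝ (ℝ × ℝ)))
    fun q => ⟨(q.1, (q.2, 0)), rfl⟩

theorem qmp_snd : Measure.QuasiMeasurePreserving (fun p : ℝ × (ℝ × ℝ) => p.2) :=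
  quasiMeasurePreserving_of_surjective volume volume
    (ContinuousLinearMap.snd ℝ ℝ (ℝ × ℝ)) fun q => ⟨(0, q), rfl⟩

theorem qmp_swap_left :
    Measure.QuasiMeasurePreserving (fun p : ℝ × (ℝ × ℝ) => (p.2.1, (p.1, p.2.2))) :=
  quasiMeasurePreserving_of_surjective volume volume
    ((ContinuousLinearMap.fst ℝ ℝ ℝ ∘L ContinuousLinearMap.snd ℝ ℝ (ℝ × ℝ)).prod
      ((ContinuousLinearMap.fst ℝ ℝ (ℝ × ℝ)).prod
      (ContinuousLinearMap.snd ℝ ℝ ℝ ∘L ContinuousLinearMap.snd ℝ ℝ (ℝ × ℝ))))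
    fun q => ⟨(q.2.1, (q.1, q.2.2)), rfl⟩

theorem qmp_swap_right :
    Measure.QuasiMeasurePreserving (fun p : ℝ × (ℝ × ℝ) => (p.1, p.2.swap)) :=
  quasiMeasurePreserving_of_surjective volume volume
    ((ContinuousLinearMap.fst ℝ ℝ (ℝ × ℝ)).prod
      ((ContinuousLinearMap.snd ℝ ℝ ℝ ∘L ContinuousLinearMap.snd ℝ ℝ (ℝ × ℝ)).prod
      (ContinuousLinearMap.fst ℝ ℝ ℝ ∘L ContinuousLinearMap.snd ℝ ℝ (ℝ × ℝ))))
    fun q => ⟨(q.1, (q.2.2, q.2.1)), rfl⟩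

theorem qmp_differences :
    Measure.QuasiMeasurePreserving (fun p : ℝ × (ℝ × ℝ) => (p.1 - p.2.1, p.2.1 - p.2.2)) :=
  quasiMeasurePreserving_of_surjective volume volume
    ((ContinuousLinearMap.fst ℝ ℝ (ℝ × ℝ) -
      ContinuousLinearMap.fst ℝ ℝ ℝ ∘L ContinuousLinearMap.snd ℝ ℝ (ℝ × ℝ)).prod
      (ContinuousLinearMap.fst ℝ ℝ ℝ ∘L ContinuousLinearMap.snd ℝ ℝ (ℝ × ℝ) -
      ContinuousLinearMap.snd ℝ ℝ ℝ ∘L ContinuousLinearMap.snd ℝ ℝ (ℝ × ℝ)))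
    fun q => ⟨(q.1 + q.2, (q.2, 0)), by simp⟩

/-- `threePMap` groups the factors as `1 + 2`. This gives its values on the grouping `2 + 1`, in
which the left leg is a pure tensor of operators. -/
theorem threePMap_assocT_coeFn (w : HTensor (OneP K) (OneP K)) (ζ : OneP K) :
    threePMap K (assocT _ _ _ (tmul w ζ)) =ᵐ[volume]
      fun p => assocT K K K (tmul (twoPMap K w (p.1, p.2.1)) (ζ p.2.2)) := by
  refine ae_formula_of_tmul (A := threePMap K ∘L (assocT _ _ _).toContinuousLinearEquiv.toContinuousLinearMap ∘L
    (tmulL (HTensor (OneP K) (OneP K)) (OneP K)).flip ζ) (B := twoPMap K) qmp_fst_snd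
    (fun p => (assocT K K K).toContinuousLinearEquiv.toContinuousLinearMap ∘L
      (tmulL (HTensor K K) K).flip (ζ p.2.2)) (fun ξ η => ?_) w
  change threePMap K (assocT _ _ _ (tmul (tmul ξ η) ζ)) =ᵐ[volume]
    fun p => assocT K K K (tmul (twoPMap K (tmul ξ η) (p.1, p.2.1)) (ζ p.2.2))
  rw [assocT_tmul, twoPMap_tmul]
  filter_upwards [threePMap_tmul_coeFn ξ (tmul η ζ), qmp_fst_snd.ae (prodTensor_coeFn ξ η),
    qmp_snd.ae (prodTensor_coeFn η ζ)] with p h1 h2 h3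
  rw [h1, h2, twoPMap_tmul, h3, assocT_tmul]

variable {G : Type v} [Group G] {V : G →* (K ≃ₗᵢ[ℂ] K)} {Γ : Conjugation K}
  (R : YBFunction V Γ)

theorem threePMap_right_coeFn (z : HTensor (OneP K) (HTensor (OneP K) (OneP K))) :
    threePMap K (mapT (ContinuousLinearMap.id ℂ _) R.op z) =ᵐ[volume]
      fun p => mapT (ContinuousLinearMap.id ℂ K) (R.toFun (p.2.1 - p.2.2))
        (threePMap K z (p.1, p.2.swap)) := by
  refine ae_formula_of_tmul (A := threePMap K ∘L mapT (ContinuousLinearMap.id ℂ _) R.op)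
    (B := threePMap K) qmp_swap_right (fun p => mapT (ContinuousLinearMap.id ℂ K)
      (R.toFun (p.2.1 - p.2.2))) (fun ξ w => ?_) z
  rw [ContinuousLinearMap.comp_apply, mapT_tmul]
  filter_upwards [threePMap_tmul_coeFn ξ (R.op w), qmp_swap_right.ae (threePMap_tmul_coeFn ξ w),
    qmp_snd.ae (twoPMap_op_coeFn R w)] with p h1 h2 h3
  rw [ContinuousLinearMap.id_apply, h1, h2, h3, mapT_tmul, ContinuousLinearMap.id_apply]

theorem threePMap_left_coeFn (z : HTensor (OneP K) (HTensor (OneP K) (OneP K))) :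
    threePMap K (leftAmp _ R.op z) =ᵐ[volume]
      fun p => leftAmp K (R.toFun (p.1 - p.2.1)) (threePMap K z (p.2.1, (p.1, p.2.2))) := by
  obtain ⟨z, rfl⟩ := (assocT (OneP K) (OneP K) (OneP K)).surjective z
  refine ae_formula_of_tmul
    (A := threePMap K ∘L leftAmp _ R.op ∘L (assocT _ _ _).toContinuousLinearEquiv.toContinuousLinearMap)
    (B := threePMap K ∘L (assocT _ _ _).toContinuousLinearEquiv.toContinuousLinearMap) qmp_swap_left
    (fun p => leftAmp K (R.toFun (p.1 - p.2.1))) (fun w ζ => ?_) z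
  change threePMap K (leftAmp _ R.op (assocT _ _ _ (tmul w ζ))) =ᵐ[volume]
    fun p => leftAmp K (R.toFun (p.1 - p.2.1))
      (threePMap K (assocT _ _ _ (tmul w ζ)) (p.2.1, (p.1, p.2.2)))
  rw [leftAmp_assocT]
  filter_upwards [threePMap_assocT_coeFn (R.op w) ζ,
    qmp_swap_left.ae (threePMap_assocT_coeFn w ζ),
    qmp_fst_snd.ae (twoPMap_op_coeFn R w)] with p h1 h2 h3
  rw [h1, h2, h3, leftAmp_assocT]
  rfl

/-- The Yang-Baxter equation gives the braid relation of the two-particle operator. -/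
theorem braided_op : Braided R.op := by
  refine ContinuousLinearMap.ext fun z => threePMap_injective (Lp.ext ?_)
  simp only [ContinuousLinearMap.comp_apply]
  set T₁ := leftAmp (OneP K) R.op
  set T₂ := mapT (ContinuousLinearMap.id ℂ (OneP K)) R.op
  filter_upwards [threePMap_left_coeFn R (T₂ (T₁ z)),
    qmp_swap_left.ae (threePMap_right_coeFn R (T₁ z)),
    qmp_swap_left.ae (qmp_swap_right.ae (threePMap_left_coeFn R z)),
    threePMap_right_coeFn R (T₁ (T₂ z)),
    qmp_swap_right.ae (threePMap_left_coeFn R (T₂ z)),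
    qmp_swap_right.ae (qmp_swap_left.ae (threePMap_right_coeFn R z)),
    qmp_differences.ae R.yang_baxter] with p h1 h2 h3 h4 h5 h6 h7
  simp only [Prod.swap] at h1 h2 h3 h4 h5 h6 h7
  -- Both sides evaluate `z` at the reversed rapidities `(θ₃, θ₂, θ₁)`. What remains is Yang-Baxter
  -- at `θ = θ₁ - θ₂` and `θ' = θ₂ - θ₃`, whose sum is `θ₁ - θ₃`.
  rw [h1, h2, h3, h4, h5, h6]
  have := congrArg (fun C => C (threePMap K z (p.2.2, (p.2.1, p.1)))) h7
  simpa using this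

end Braid

/-! ### Exchange operators as products of one-particle operators. -/

section Monodromy

variable {H : Type u} [NormedAddCommGroup H] [InnerProductSpace ℂ H] [CompleteSpace H]
  (T : HTensor H H →L[ℂ] HTensor H H)

/-- The partial matrix element `⟪η, t b⟫ = ⟪η ⊗ φ, T (ψ ⊗ b)⟫` of an operator `T`. -/
def partialElem (φ ψ : H) : H →L[ℂ] H :=
  ContinuousLinearMap.adjoint ((tmulL H H).flip φ) ∘L T ∘L tmulL H H ψ

theorem inner_partialElem (φ ψ η b : H) :
    inner ℂ η (partialElem T φ ψ b) = inner ℂ (tmul η φ) (T (tmul ψ b)) := by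
  rw [partialElem, ContinuousLinearMap.comp_apply, ContinuousLinearMap.adjoint_inner_right]
  rfl

/-- The product of the partial matrix elements of a list of pairs of vectors, with an operator `Q`
inserted after each factor. -/
def monodromy (Q : H →L[ℂ] H) : List (H × H) → (H →L[ℂ] H)
  | [] => ContinuousLinearMap.id ℂ H
  | p :: l => partialElem T p.1 p.2 ∘L Q ∘L monodromy Q l

omit [CompleteSpace H] in
theorem inner_consTwo (n : ℕ) (w w' : HTensor H H) (x y : Pow H n) :
    inner ℂ (consTwo n w x) (consTwo n w' y) = inner ℂ w w' * inner ℂ x y := by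
  rw [consTwo_apply, consTwo_apply]
  exact ((powCons H (n + 1)).inner_map_map _ _).trans (((assocT H H (Pow H n)).inner_map_map _ _).trans
    (inner_tmul_tmul w w' x y))

theorem inner_leg_zero_consOp (n : ℕ) (η φ ψ : H) (z : Pow H n) (y : Pow H (n + 1)) :
    inner ℂ (consOp η (n + 1) (consOp φ n z)) (leg T (n + 2) 0 (consOp ψ (n + 1) y)) =
      inner ℂ (consOp (ContinuousLinearMap.adjoint (partialElem T φ ψ) η) n z) y := by
  refine pow_induction (p := fun y => inner ℂ (consOp η (n + 1) (consOp φ n z))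
    (leg T (n + 2) 0 (consOp ψ (n + 1) y)) =
      inner ℂ (consOp (ContinuousLinearMap.adjoint (partialElem T φ ψ) η) n z) y)
    (isClosed_eq (by fun_prop) (by fun_prop))
    (fun a b ha hb => by simp only [map_add, inner_add_right, ha, hb]) (fun b y => ?_) y
  rw [← consTwo_tmul, ← consTwo_tmul, leg_zero_consTwo, inner_consTwo, inner_consOp_consOp,
    ContinuousLinearMap.adjoint_inner_left, inner_partialElem]

/-- Only leg `0` of the chain sees the first factor. Taking its partial matrix element removes one
particle and changes `η`, which gives a recursion for the matrix elements of the exchange operator.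
-/
theorem inner_exchangeOp_consOp (η ξ φ ψ : H) (n : ℕ) (z x : Pow H n) :
    inner ℂ (consOp φ n z) (exchangeOp T η ξ (n + 1) (consOp ψ n x)) =
      inner ℂ z (exchangeOp T (ContinuousLinearMap.adjoint (partialElem T φ ψ) η) ξ n x) := by
  simp only [exchangeOp, ContinuousLinearMap.comp_apply, unconsOp,
    ContinuousLinearMap.adjoint_inner_right, legChain, snocOp_consOp, legChain_consOp]
  exact inner_leg_zero_consOp T n η φ ψ z _

omit [CompleteSpace H] in
theorem exchangeOp_zero (η ξ : H) (x : Pow H 0) : exchangeOp T η ξ 0 x = inner ℂ η ξ • x := by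
  simp only [exchangeOp, ContinuousLinearMap.comp_apply, snocOp_zero, legChain,
    ContinuousLinearMap.id_apply, unconsOp_consOp]

omit [CompleteSpace H] in
theorem consOp_induction {S : Set H} (hS : (Submodule.span ℂ S).topologicalClosure = ⊤) {n : ℕ}
    {W : Type*} [NormedAddCommGroup W] [NormedSpace ℂ W] {σ : ℂ →+* ℂ} {A B : Pow H (n + 1) →SL[σ] W}
    (h : ∀ a ∈ S, ∀ x, A (consOp a n x) = B (consOp a n x)) : A = B := by
  refine pow_ext fun a x => ?_
  let C : H →L[ℂ] Pow H (n + 1) :=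
    (powCons H n).toContinuousLinearEquiv.toContinuousLinearMap ∘L (tmulL H (Pow H n)).flip x
  have hd : Dense (Submodule.span ℂ S : Set H) := by
    rw [Submodule.dense_iff_topologicalClosure_eq_top, hS]
  have : A.comp C = B.comp C :=
    ContinuousLinearMap.ext_on hd fun a ha => h a ha x
  exact congrArg (fun D => D a) this

/-- Crossing relations between products of partial matrix elements give the adjointness of the
exchange operators. -/
theorem exchangeOp_eq_adjoint {S : Set H} (hS : (Submodule.span ℂ S).topologicalClosure = ⊤)
    {η ξ ξ' η' : H}
    (h : ∀ l : List (H × H), (∀ p ∈ l, p.1 ∈ S ∧ p.2 ∈ S) →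
      inner ℂ η (monodromy T (ContinuousLinearMap.id ℂ H) l ξ') =
        inner ℂ (monodromy T (ContinuousLinearMap.id ℂ H) (l.map Prod.swap) η') ξ) (n : ℕ) :
    exchangeOp T η ξ' n = ContinuousLinearMap.adjoint (exchangeOp T ξ η' n) := by
  induction n generalizing η ξ with
  | zero =>
    refine ContinuousLinearMap.ext fun x => ext_inner_left ℂ fun y => ?_
    rw [ContinuousLinearMap.adjoint_inner_right, exchangeOp_zero, exchangeOp_zero, inner_smul_left,
      inner_smul_right, inner_conj_symm]
    exact congrArg (· * _) (h [] (by simp))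
  | succ n ih =>
    refine consOp_induction hS fun ψ hψ x => ext_inner_right ℂ fun y => ?_
    -- Fixing `ψ ⊗ x` and passing to functionals of `y` makes the density argument available also
    -- for the first factor `φ` of the other vector.
    suffices innerSL ℂ (exchangeOp T η ξ' (n + 1) (consOp ψ n x)) =
        innerSL ℂ (ContinuousLinearMap.adjoint (exchangeOp T ξ η' (n + 1)) (consOp ψ n x)) from
      congrArg (fun D => D y) this
    refine consOp_induction hS fun φ hφ z => ?_
    simp only [innerSL_apply_apply]
    rw [← inner_conj_symm, inner_exchangeOp_consOp, ContinuousLinearMap.adjoint_inner_left,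
      inner_exchangeOp_consOp, ih, ContinuousLinearMap.adjoint_inner_right, inner_conj_symm]
    intro l hl
    -- The relation for the modified vectors and `l` is the original one for the list lengthened by
    -- `(φ, ψ)`; on the adjoint side the pair enters swapped.
    have := h ((φ, ψ) :: l) (by
      intro p hp
      rcases List.mem_cons.1 hp with rfl | hp
      · exact ⟨hφ, hψ⟩
      · exact hl p hp)
    rw [ContinuousLinearMap.adjoint_inner_left, ContinuousLinearMap.adjoint_inner_right]
    simpa [monodromy] using this

/-- Products of uniformly bounded, strongly convergent operators converge strongly. It will be used
to remove the projections that cut the products down to finite sums. -/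
theorem tendsto_monodromy {ι : Type*} {𝓕 : Filter ι} {Q : ι → H →L[ℂ] H}
    (hQ : ∀ i x, ‖Q i x‖ ≤ ‖x‖) (hlim : ∀ x, Tendsto (fun i => Q i x) 𝓕 (𝓝 x)) (l : List (H × H))
    (x : H) : Tendsto (fun i => monodromy T (Q i) l x) 𝓕
      (𝓝 (monodromy T (ContinuousLinearMap.id ℂ H) l x)) := by
  induction l with
  | nil => exact tendsto_const_nhds
  | cons p l ih =>
    simp only [monodromy, ContinuousLinearMap.comp_apply, ContinuousLinearMap.id_apply]
    refine ((partialElem T p.1 p.2).continuous.tendsto _).comp ?_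
    set y := monodromy T (ContinuousLinearMap.id ℂ H) l x
    have h1 : Tendsto (fun i => Q i (monodromy T (Q i) l x - y)) 𝓕 (𝓝 0) := by
      refine squeeze_zero_norm (fun i => hQ i _) ?_
      have := (ih.sub_const y).norm
      rwa [sub_self, norm_zero] at this
    have := h1.add (hlim y)
    simpa using this

end Monodromy

/-! ### Elementary vectors `h ⊗ e` and fibrewise finite-rank projections. -/

section TensorVec

variable {K : Type u} [NormedAddCommGroup K] [InnerProductSpace ℂ K]

/-- The map `h ↦ h ⊗ e` from `L²(ℝ)` to `L²(ℝ → K)`. -/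
def tensorL (e : K) : Lp ℂ 2 (volume : Measure ℝ) →L[ℂ] OneP K :=
  (ContinuousLinearMap.toSpanSingleton ℂ e).compLpL 2 volume

theorem tensorL_apply (e : K) (h : Lp ℂ 2 (volume : Measure ℝ)) : tensorL e h = tensorVec h e := rfl

theorem tensorL_coeFn (e : K) (h : Lp ℂ 2 (volume : Measure ℝ)) :
    tensorL e h =ᵐ[volume] fun θ => h θ • e :=
  (ContinuousLinearMap.toSpanSingleton ℂ e).coeFn_compLpL (p := 2) (μ := volume) h

theorem inner_tensorL_tensorL (e e' : K) (h h' : Lp ℂ 2 (volume : Measure ℝ)) :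
    inner ℂ (tensorL e h) (tensorL e' h') = inner ℂ e e' * inner ℂ h h' := by
  rw [L2.inner_def, L2.inner_def, ← integral_const_mul]
  refine integral_congr_ae ?_
  filter_upwards [tensorL_coeFn e h, tensorL_coeFn e' h'] with θ h1 h2
  rw [h1, h2, inner_smul_left, inner_smul_right]
  simp only [RCLike.inner_apply]
  ring

theorem norm_tensorL (e : K) (h : Lp ℂ 2 (volume : Measure ℝ)) :
    ‖tensorL e h‖ = ‖h‖ * ‖e‖ := by
  have := inner_tensorL_tensorL e e h h
  simp only [inner_self_eq_norm_sq_to_K] at this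
  rw [← mul_pow] at this
  have h2 : ‖tensorL e h‖ ^ 2 = (‖e‖ * ‖h‖) ^ 2 := by exact_mod_cast this
  rw [(sq_eq_sq₀ (by positivity) (by positivity)).1 h2, mul_comm]

/-- The map `e ↦ h ⊗ e` from `K` to `L²(ℝ → K)`. -/
def tensorR (h : Lp ℂ 2 (volume : Measure ℝ)) : K →L[ℂ] OneP K :=
  LinearMap.mkContinuous
    { toFun := fun e => tensorL e h
      map_add' := fun e e' => by
        refine Lp.ext ?_
        filter_upwards [tensorL_coeFn (e + e') h, tensorL_coeFn e h, tensorL_coeFn e' h,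
          Lp.coeFn_add (tensorL e h) (tensorL e' h)] with θ h1 h2 h3 h4
        rw [h1, h4, Pi.add_apply, h2, h3, smul_add]
      map_smul' := fun c e => by
        refine Lp.ext ?_
        filter_upwards [tensorL_coeFn (c • e) h, tensorL_coeFn e h,
          Lp.coeFn_smul c (tensorL e h)] with θ h1 h2 h3
        rw [h1, RingHom.id_apply, h3, Pi.smul_apply, h2, smul_comm] }
    ‖h‖ fun e => (norm_tensorL e h).le

theorem tensorR_apply (h : Lp ℂ 2 (volume : Measure ℝ)) (e : K) : tensorR h e = tensorL e h := rfl

/-- Indicator functions with a constant value `c` are of the form `h ⊗ c`, and their sums are dense.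
-/
theorem oneP_induction {p : OneP K → Prop} (hc : IsClosed {x | p x})
    (hadd : ∀ x y, p x → p y → p (x + y)) (ht : ∀ h e, p (tensorL e h)) (ξ : OneP K) : p ξ := by
  refine Lp.induction (by norm_num) p ?_ ?_ hc ξ
  · intro c s hs hμ
    have : (Lp.simpleFunc.indicatorConst 2 hs hμ.ne c : OneP K) =
        tensorL c (indicatorConstLp 2 hs hμ.ne (1 : ℂ)) := by
      refine Lp.ext ?_
      rw [Lp.simpleFunc.coe_indicatorConst]
      filter_upwards [indicatorConstLp_coeFn (p := 2) (hs := hs) (hμs := hμ.ne) (c := c),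
        indicatorConstLp_coeFn (p := 2) (hs := hs) (hμs := hμ.ne) (c := (1 : ℂ)),
        tensorL_coeFn c (indicatorConstLp 2 hs hμ.ne (1 : ℂ))] with θ h1 h2 h3
      rw [h1, h3, h2]
      by_cases hθ : θ ∈ s <;> simp [hθ]
    rw [this]
    exact ht _ _
  · intro f g hf hg _ h1 h2
    exact hadd _ _ h1 h2

variable (K) in
/-- The elementary one-particle vectors `h ⊗ e`. -/
def elementary : Set (OneP K) := {ξ | ∃ h e, ξ = tensorL e h}

variable (K) in
theorem span_elementary : (Submodule.span ℂ (elementary K)).topologicalClosure = ⊤ := by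
  refine eq_top_iff.2 fun ξ _ => ?_
  refine oneP_induction (p := fun ξ => ξ ∈ (Submodule.span ℂ (elementary K)).topologicalClosure)
    (Submodule.isClosed_topologicalClosure _) (fun x y hx hy => add_mem hx hy) (fun h e => ?_) ξ
  exact Submodule.le_topologicalClosure _ (Submodule.subset_span ⟨h, e, rfl⟩)

variable [CompleteSpace K]

/-- The fibrewise projection onto the span of finitely many orthonormal vectors. -/
def fibreProj {ι : Type*} (b : ι → K) (F : Finset ι) : OneP K →L[ℂ] OneP K :=
  ∑ i ∈ F, tensorL (b i) ∘L ContinuousLinearMap.adjoint (tensorL (b i))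

theorem fibreProj_apply {ι : Type*} (b : ι → K) (F : Finset ι) (ξ : OneP K) :
    fibreProj b F ξ = ∑ i ∈ F, tensorL (b i) (ContinuousLinearMap.adjoint (tensorL (b i)) ξ) := by
  simp [fibreProj]

theorem adjoint_tensorL_tensorL (e e' : K) (h : Lp ℂ 2 (volume : Measure ℝ)) :
    ContinuousLinearMap.adjoint (tensorL e) (tensorL e' h) = inner ℂ e e' • h := by
  refine ext_inner_left ℂ fun p => ?_
  rw [ContinuousLinearMap.adjoint_inner_right, inner_tensorL_tensorL, inner_smul_right]

theorem norm_fibreProj_le {ι : Type*} {b : ι → K} (hb : Orthonormal ℂ b) (F : Finset ι)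
    (ξ : OneP K) : ‖fibreProj b F ξ‖ ≤ ‖ξ‖ := by
  classical
  have h1 : ∀ i ∈ F, ContinuousLinearMap.adjoint (tensorL (b i)) (fibreProj b F ξ) =
      ContinuousLinearMap.adjoint (tensorL (b i)) ξ := by
    intro i hi
    rw [fibreProj_apply, map_sum]
    simp only [adjoint_tensorL_tensorL, orthonormal_iff_ite.1 hb]
    simp [hi]
  -- This is Bessel's inequality: `Q = Q*Q` for an orthogonal projection, followed by
  -- Cauchy-Schwarz.
  have h2 : inner ℂ (fibreProj b F ξ) (fibreProj b F ξ) = inner ℂ ξ (fibreProj b F ξ) := by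
    conv_lhs => rw [fibreProj_apply b F ξ, sum_inner]
    conv_rhs => rw [fibreProj_apply b F ξ, inner_sum]
    rw [← fibreProj_apply]
    refine Finset.sum_congr rfl fun i hi => ?_
    rw [← ContinuousLinearMap.adjoint_inner_right (tensorL (b i)), h1 i hi,
      ← ContinuousLinearMap.adjoint_inner_left (tensorL (b i))]
  have h3 : ‖fibreProj b F ξ‖ * ‖fibreProj b F ξ‖ ≤ ‖ξ‖ * ‖fibreProj b F ξ‖ := by
    have := norm_inner_le_norm (𝕜 := ℂ) ξ (fibreProj b F ξ)
    rw [← h2] at this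
    simpa [inner_self_eq_norm_sq_to_K, sq] using this
  rcases (norm_nonneg (fibreProj b F ξ)).eq_or_lt with h | h
  · rw [← h]; exact norm_nonneg _
  · exact le_of_mul_le_mul_right h3 h

theorem tendsto_fibreProj {ι : Type*} {b : ι → K} (hb : Orthonormal ℂ b)
    (hsum : ∀ x, HasSum (fun i => inner ℂ (b i) x • b i) x) (ξ : OneP K) :
    Tendsto (fun F => fibreProj b F ξ) atTop (𝓝 ξ) := by
  refine oneP_induction (p := fun ξ => Tendsto (fun F => fibreProj b F ξ) atTop (𝓝 ξ)) ?_ ?_ ?_ ξ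
  · refine isClosed_of_closure_subset fun ξ hξ => ?_
    refine Metric.tendsto_nhds.2 fun ε hε => ?_
    -- The uniform bound on the projections makes the set of vectors with convergence closed.
    obtain ⟨ξ', hξ', hd⟩ := Metric.mem_closure_iff.1 hξ (ε / 3) (by positivity)
    filter_upwards [Metric.tendsto_nhds.1 hξ' (ε / 3) (by positivity)] with F hF
    have h1 : dist (fibreProj b F ξ) (fibreProj b F ξ') ≤ dist ξ ξ' := by
      rw [dist_eq_norm, dist_eq_norm, ← map_sub]
      exact norm_fibreProj_le hb F _
    have h2 := dist_triangle4 (fibreProj b F ξ) (fibreProj b F ξ') ξ' ξ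
    rw [dist_comm ξ' ξ] at h2
    linarith
  · intro x y hx hy
    simpa using hx.add hy
  · intro h e
    have h1 : ∀ F : Finset ι, fibreProj b F (tensorL e h) =
        tensorR h (∑ i ∈ F, inner ℂ (b i) e • b i) := by
      intro F
      rw [fibreProj_apply, map_sum]
      refine Finset.sum_congr rfl fun i _ => ?_
      rw [adjoint_tensorL_tensorL, map_smul, map_smul, tensorR_apply]
    simp only [h1]
    exact ((tensorR h).continuous.tendsto e).comp (hsum e)

end TensorVec

/-! ### Bounded analytic functions on the strip and their edges. -/

section StripAnalysis

theorem isOpen_strip : IsOpen strip :=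
  (isOpen_lt continuous_const Complex.continuous_im).inter
    (isOpen_lt Complex.continuous_im continuous_const)

theorem add_mul_I_mem_strip {x y : ℝ} (h0 : 0 < y) (h1 : y < Real.pi) :
    (x : ℂ) + y * Complex.I ∈ strip := by
  constructor <;> simpa

theorem upper_mem_strip {x ε : ℝ} (h0 : 0 < ε) (h1 : ε < Real.pi) :
    (x : ℂ) + Real.pi * Complex.I - ε * Complex.I ∈ strip := by
  constructor <;> simp <;> linarith

theorem continuous_comp_horizontal {M : ℂ → ℂ} (hM : DifferentiableOn ℂ M strip) {c : ℂ}
    (h0 : 0 < c.im) (h1 : c.im < Real.pi) : Continuous fun x : ℝ => M (x + c) := by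
  refine hM.continuousOn.comp_continuous (by fun_prop) fun x => ?_
  constructor <;> simpa

theorem eventually_small : ∀ᶠ ε : ℝ in 𝓝[>] 0, 0 < ε ∧ ε < Real.pi := by
  filter_upwards [self_mem_nhdsWithin, nhdsWithin_le_nhds (Iio_mem_nhds Real.pi_pos)] with ε h1 h2
  exact ⟨h1, h2⟩

theorem eventually_small_half : ∀ᶠ ε : ℝ in 𝓝[>] 0, 0 < ε ∧ ε < Real.pi - ε := by
  filter_upwards [self_mem_nhdsWithin, nhdsWithin_le_nhds (Iio_mem_nhds Real.pi_div_two_pos)]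
    with ε h1 h2
  exact ⟨h1, by rw [Set.mem_Iio] at h2; linarith⟩

/-- Integrals over horizontal lines of a decaying analytic function on the strip agree. -/
theorem integral_horizontal_eq {M : ℂ → ℂ} (hM : DifferentiableOn ℂ M strip) {C : ℝ}
    (hC : ∀ ζ ∈ strip, ‖M ζ‖ ≤ C * (1 + ζ.re ^ 2)⁻¹) {y₀ y₁ : ℝ} (h0 : 0 < y₀) (h01 : y₀ ≤ y₁)
    (h1 : y₁ < Real.pi) :
    ∫ x : ℝ, M (x + y₀ * Complex.I) = ∫ x : ℝ, M (x + y₁ * Complex.I) := by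
  have hInt : ∀ y : ℝ, 0 < y → y < Real.pi → Integrable fun x : ℝ => M (x + y * Complex.I) := by
    intro y hy hy'
    refine (integrable_inv_one_add_sq.const_mul C).mono'
      (continuous_comp_horizontal hM (by simpa) (by simpa)).aestronglyMeasurable
      (Eventually.of_forall fun x => ?_)
    simpa using hC _ (add_mul_I_mem_strip (x := x) hy hy')
  have hrect : ∀ r : ℝ, ((∫ x in (-r)..r, M (x + y₀ * Complex.I)) -
      ∫ x in (-r)..r, M (x + y₁ * Complex.I)) =
      Complex.I • (∫ y in y₀..y₁, M ((-r : ℝ) + y * Complex.I)) -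
        Complex.I • ∫ y in y₀..y₁, M (r + y * Complex.I) := by
    intro r
    have := Complex.integral_boundary_rect_eq_zero_of_differentiableOn M
      ((-r : ℝ) + y₀ * Complex.I) (r + y₁ * Complex.I) (hM.mono fun ζ hζ => by
        have := hζ.2
        simp only [Complex.add_im, Complex.ofReal_im, Complex.mul_im, Complex.ofReal_re,
          Complex.I_im, mul_one, Complex.I_re, mul_zero, add_zero, zero_add, Set.mem_preimage,
          Set.uIcc_of_le h01] at this
        exact ⟨h0.trans_le this.1, this.2.trans_lt h1⟩)
    simp only [Complex.add_im, Complex.ofReal_im, Complex.mul_im, Complex.ofReal_re,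
      Complex.I_im, mul_one, Complex.I_re, mul_zero, add_zero, zero_add, Complex.add_re,
      Complex.mul_re, sub_self] at this
    rw [← sub_eq_zero, ← this]
    ring
  -- The sign `s = ±1` treats both vertical sides at once. They have fixed length, and the integrand
  -- on them is `O(r⁻²)`.
  have hside : ∀ s : ℝ, s ^ 2 = 1 → Tendsto (fun r : ℝ => Complex.I •
      ∫ y in y₀..y₁, M ((s * r : ℝ) + y * Complex.I)) atTop (𝓝 0) := by
    intro s hs
    refine squeeze_zero_norm (a := fun r : ℝ => (C * (1 + r ^ 2)⁻¹) * |y₁ - y₀|)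
      (fun r => ?_) ?_
    · rw [norm_smul, Complex.norm_I, one_mul]
      refine intervalIntegral.norm_integral_le_of_norm_le_const fun y hy => ?_
      rw [Set.uIoc_of_le h01] at hy
      have := hC _ (add_mul_I_mem_strip (x := s * r) (h0.trans hy.1) (hy.2.trans_lt h1))
      simpa [mul_pow, hs] using this
    · have h : Tendsto (fun r : ℝ => (1 + r ^ 2)⁻¹) atTop (𝓝 0) :=
        tendsto_inv_atTop_zero.comp
          (tendsto_atTop_add_const_left _ _ (tendsto_pow_atTop two_ne_zero))
      simpa using (h.const_mul C).mul_const |y₁ - y₀|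
  have hL := ((intervalIntegral_tendsto_integral (hInt y₀ h0 (h01.trans_lt h1))
    tendsto_neg_atTop_atBot tendsto_id).sub (intervalIntegral_tendsto_integral
      (hInt y₁ (h0.trans_le h01) h1) tendsto_neg_atTop_atBot tendsto_id))
  have hRt := (hside (-1) (by norm_num)).sub (hside 1 (by norm_num))
  simp only [neg_mul, one_mul, sub_zero] at hRt
  rw [← sub_eq_zero]
  refine tendsto_nhds_unique (hL.congr fun r => ?_) hRt
  exact hrect r

/-- The integrals of the boundary values of a decaying analytic function on the strip agree. -/
theorem integral_boundary_eq {M : ℂ → ℂ} (hM : DifferentiableOn ℂ M strip) {C : ℝ}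
    (hC : ∀ ζ ∈ strip, ‖M ζ‖ ≤ C * (1 + ζ.re ^ 2)⁻¹) {a b : ℝ → ℂ}
    (ha : ∀ θ : ℝ, Tendsto (fun ε : ℝ => M (θ + ε * Complex.I)) (𝓝[>] 0) (𝓝 (a θ)))
    (hb : ∀ θ : ℝ, Tendsto (fun ε : ℝ => M (θ + Real.pi * Complex.I - ε * Complex.I)) (𝓝[>] 0)
      (𝓝 (b θ))) : ∫ θ, a θ = ∫ θ, b θ := by
  have h1 : Tendsto (fun ε : ℝ => ∫ θ : ℝ, M (θ + ε * Complex.I)) (𝓝[>] 0) (𝓝 (∫ θ, a θ)) := by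
    refine tendsto_integral_filter_of_dominated_convergence (fun θ => C * (1 + θ ^ 2)⁻¹) ?_ ?_
      (integrable_inv_one_add_sq.const_mul C) (Eventually.of_forall ha)
    · filter_upwards [eventually_small] with ε hε
      exact (continuous_comp_horizontal hM (by simpa using hε.1)
        (by simpa using hε.2)).aestronglyMeasurable
    · filter_upwards [eventually_small] with ε hε
      refine Eventually.of_forall fun θ => ?_
      simpa using hC _ (add_mul_I_mem_strip (x := θ) hε.1 hε.2)
  have h2 : Tendsto (fun ε : ℝ => ∫ θ : ℝ, M (θ + Real.pi * Complex.I - ε * Complex.I)) (𝓝[>] 0)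
      (𝓝 (∫ θ, b θ)) := by
    refine tendsto_integral_filter_of_dominated_convergence (fun θ => C * (1 + θ ^ 2)⁻¹) ?_ ?_
      (integrable_inv_one_add_sq.const_mul C) (Eventually.of_forall hb)
    · filter_upwards [eventually_small] with ε hε
      have := continuous_comp_horizontal hM (c := Real.pi * Complex.I - ε * Complex.I)
        (by simpa using hε.2) (by simpa using hε.1)
      simp only [← add_sub_assoc] at this
      exact this.aestronglyMeasurable
    · filter_upwards [eventually_small] with ε hε
      refine Eventually.of_forall fun θ => ?_
      simpa using hC _ (upper_mem_strip (x := θ) hε.1 hε.2)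
  refine tendsto_nhds_unique h1 (h2.congr' ?_)
  -- The lines at heights `ε` and `π - ε` approach the two edges; for small `ε` they lie in this
  -- order inside the strip.
  filter_upwards [eventually_small_half] with ε hε
  rw [integral_horizontal_eq hM hC hε.1 hε.2.le (by linarith [hε.1])]
  congr 1
  ext θ
  congr 1
  push_cast
  ring

/-- The functions `a`, `b` are the boundary values, on the lower and on the upper edge, of a bounded
analytic function on the strip. -/
def StripPair (a b : ℝ → ℂ) : Prop :=
  ∃ M : ℂ → ℂ, DifferentiableOn ℂ M strip ∧ (∃ C : ℝ, ∀ ζ ∈ strip, ‖M ζ‖ ≤ C) ∧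
    (∀ θ : ℝ, Tendsto (fun ε : ℝ => M (θ + ε * Complex.I)) (𝓝[>] 0) (𝓝 (a θ))) ∧
    (∀ θ : ℝ, Tendsto (fun ε : ℝ => M (θ + Real.pi * Complex.I - ε * Complex.I)) (𝓝[>] 0)
      (𝓝 (b θ)))

theorem StripPair.const (c : ℂ) : StripPair (fun _ => c) (fun _ => c) :=
  ⟨fun _ => c, differentiableOn_const c, ⟨‖c‖, fun _ _ => le_rfl⟩, fun _ => tendsto_const_nhds,
    fun _ => tendsto_const_nhds⟩

theorem StripPair.add {a b a' b' : ℝ → ℂ} (h : StripPair a b) (h' : StripPair a' b') :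
    StripPair (fun θ => a θ + a' θ) (fun θ => b θ + b' θ) := by
  obtain ⟨M, hM, ⟨C, hC⟩, ha, hb⟩ := h
  obtain ⟨M', hM', ⟨C', hC'⟩, ha', hb'⟩ := h'
  exact ⟨fun ζ => M ζ + M' ζ, hM.add hM', ⟨C + C', fun ζ hζ => (norm_add_le _ _).trans
    (add_le_add (hC ζ hζ) (hC' ζ hζ))⟩, fun θ => (ha θ).add (ha' θ), fun θ => (hb θ).add (hb' θ)⟩

theorem StripPair.mul {a b a' b' : ℝ → ℂ} (h : StripPair a b) (h' : StripPair a' b') :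
    StripPair (fun θ => a θ * a' θ) (fun θ => b θ * b' θ) := by
  obtain ⟨M, hM, ⟨C, hC⟩, ha, hb⟩ := h
  obtain ⟨M', hM', ⟨C', hC'⟩, ha', hb'⟩ := h'
  refine ⟨fun ζ => M ζ * M' ζ, hM.mul hM', ⟨C * C', fun ζ hζ => ?_⟩, fun θ => (ha θ).mul (ha' θ),
    fun θ => (hb θ).mul (hb' θ)⟩
  rw [norm_mul]
  exact mul_le_mul (hC ζ hζ) (hC' ζ hζ) (norm_nonneg _) ((norm_nonneg _).trans (hC ζ hζ))

theorem StripPair.sum {ι : Type*} (F : Finset ι) {a b : ι → ℝ → ℂ}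
    (h : ∀ i, StripPair (a i) (b i)) :
    StripPair (fun θ => ∑ i ∈ F, a i θ) (fun θ => ∑ i ∈ F, b i θ) := by
  classical
  induction F using Finset.induction_on with
  | empty => simpa using StripPair.const 0
  | insert i F hi ih => simpa only [Finset.sum_insert hi] using (h i).add ih

theorem bounded_of_tendsto_boundary {N : ℝ → ℝ → ℂ} {a : ℝ → ℂ} {C : ℝ}
    (hN : ∀ᶠ ε in 𝓝[>] (0 : ℝ), Continuous (N ε) ∧ ∀ θ, ‖N ε θ‖ ≤ C)
    (h : ∀ θ, Tendsto (fun ε => N ε θ) (𝓝[>] 0) (𝓝 (a θ))) :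
    AEStronglyMeasurable a volume ∧ ∃ C, ∀ θ, ‖a θ‖ ≤ C := by
  refine ⟨?_, C, fun θ => le_of_tendsto (h θ).norm (hN.mono fun ε hε => hε.2 θ)⟩
  obtain ⟨x, hx⟩ := (𝓝[>] (0 : ℝ)).exists_seq_tendsto
  obtain ⟨n₀, hn₀⟩ := eventually_atTop.1 (hx.eventually hN)
  -- The shift by `n₀` makes every term of the sequence, not only the late ones, continuous.
  refine aestronglyMeasurable_of_tendsto_ae atTop (f := fun n θ => N (x (n + n₀)) θ)
    (fun n => (hn₀ _ (Nat.le_add_left n₀ n)).1.aestronglyMeasurable)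
    (Eventually.of_forall fun θ => ?_)
  exact ((h θ).comp hx).comp (tendsto_add_atTop_nat n₀)

theorem StripPair.bounded_left {a b : ℝ → ℂ} (h : StripPair a b) :
    AEStronglyMeasurable a volume ∧ ∃ C, ∀ θ, ‖a θ‖ ≤ C := by
  obtain ⟨M, hM, ⟨C, hC⟩, ha, -⟩ := h
  refine bounded_of_tendsto_boundary (C := C) ?_ ha
  filter_upwards [eventually_small] with ε hε
  exact ⟨continuous_comp_horizontal hM (by simpa using hε.1) (by simpa using hε.2),
    fun θ => hC _ (add_mul_I_mem_strip hε.1 hε.2)⟩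

theorem StripPair.bounded_right {a b : ℝ → ℂ} (h : StripPair a b) :
    AEStronglyMeasurable b volume ∧ ∃ C, ∀ θ, ‖b θ‖ ≤ C := by
  obtain ⟨M, hM, ⟨C, hC⟩, -, hb⟩ := h
  refine bounded_of_tendsto_boundary (C := C) ?_ hb
  filter_upwards [eventually_small] with ε hε
  have := continuous_comp_horizontal hM (c := Real.pi * Complex.I - ε * Complex.I)
    (by simpa using hε.2) (by simpa using hε.1)
  simp only [← add_sub_assoc] at this
  exact ⟨this, fun θ => hC _ (upper_mem_strip hε.1 hε.2)⟩

/-- The convolution of an integrable function with a bounded analytic function on the strip. -/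
theorem stripPair_convolution {c : ℝ → ℂ} (hc : Integrable c) {s : ℂ → ℂ}
    (hs : DifferentiableOn ℂ s strip) {C : ℝ} (hC : ∀ ζ ∈ strip, ‖s ζ‖ ≤ C) {r r' : ℝ → ℂ}
    (hr : ∀ᵐ θ : ℝ, Tendsto (fun ε : ℝ => s (θ + ε * Complex.I)) (𝓝[>] 0) (𝓝 (r θ)))
    (hr' : ∀ᵐ θ : ℝ, Tendsto (fun ε : ℝ => s (Real.pi * Complex.I - θ - ε * Complex.I)) (𝓝[>] 0)
      (𝓝 (r' θ))) :
    StripPair (fun θ => ∫ t, c t * r (θ - t)) (fun θ => ∫ t, c t * r' (t - θ)) := by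
  have hsub : ∀ ζ ∈ strip, ∀ t : ℝ, ζ - t ∈ strip := fun ζ hζ t => by
    constructor <;> simpa using by first | exact hζ.1 | exact hζ.2
  have hcont : ∀ ζ ∈ strip, Continuous fun t : ℝ => s (ζ - t) := fun ζ hζ =>
    hs.continuousOn.comp_continuous (by fun_prop) fun t => hsub ζ hζ t
  have hmeas : ∀ ζ ∈ strip, AEStronglyMeasurable (fun t : ℝ => c t * s (ζ - t)) volume :=
    fun ζ hζ => hc.1.mul (hcont ζ hζ).aestronglyMeasurable
  have hbd : ∀ ζ ∈ strip, ∀ t : ℝ, ‖c t * s (ζ - t)‖ ≤ ‖c t‖ * C := fun ζ hζ t => by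
    rw [norm_mul]
    exact mul_le_mul_of_nonneg_left (hC _ (hsub ζ hζ t)) (norm_nonneg _)
  have hInt : Integrable fun t => ‖c t‖ * C := hc.norm.mul_const C
  refine ⟨fun ζ => ∫ t : ℝ, c t * s (ζ - t), fun ζ hζ => ?_, ⟨∫ t, ‖c t‖ * C, fun ζ hζ =>
    norm_integral_le_of_norm_le hInt (Eventually.of_forall (hbd ζ hζ))⟩, fun θ => ?_, fun θ => ?_⟩
  -- The strip is invariant under real translations, so one radius serves for all `t`. Centres in
  -- the ball of radius `δ / 2`, with discs of radius `δ / 4`, stay in the strip; Cauchy's estimate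
  -- on these discs bounds the derivative by `C / (δ / 4)`.
  · obtain ⟨δ, hδ, hball⟩ := Metric.isOpen_iff.1 isOpen_strip ζ hζ
    have hball' : ∀ z ∈ Metric.ball ζ (δ / 2), ∀ t : ℝ,
        Metric.closedBall (z - t) (δ / 2 / 2) ⊆ strip := by
      intro z hz t w hw
      have : w + t ∈ strip := by
        apply hball
        rw [Metric.mem_ball, dist_eq_norm] at hz ⊢
        rw [Metric.mem_closedBall, dist_eq_norm] at hw
        calc ‖w + t - ζ‖ = ‖(w - (z - t)) + (z - ζ)‖ := by ring_nf
          _ ≤ ‖w - (z - t)‖ + ‖z - ζ‖ := norm_add_le _ _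
          _ < δ := by linarith
      simpa using hsub _ this t
    have hder := hasDerivAt_integral_of_dominated_loc_of_deriv_le (μ := (volume : Measure ℝ))
      (F := fun (z : ℂ) (t : ℝ) => c t * s (z - t)) (F' := fun z t => c t * deriv s (z - t))
      (x₀ := ζ) (bound := fun t => ‖c t‖ * (C / (δ / 2 / 2)))
      (Metric.ball_mem_nhds ζ (half_pos hδ)) ?_ ?_ ?_ ?_ (hc.norm.mul_const _) ?_
    · exact hder.2.differentiableAt.differentiableWithinAt
    · filter_upwards [isOpen_strip.mem_nhds hζ] with z hz using hmeas z hz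
    · exact hInt.mono' (hmeas ζ hζ) (Eventually.of_forall (hbd ζ hζ))
    · exact hc.1.mul ((measurable_deriv s).comp (by fun_prop)).aestronglyMeasurable
    · refine Eventually.of_forall fun t z hz => ?_
      rw [norm_mul]
      refine mul_le_mul_of_nonneg_left ?_ (norm_nonneg _)
      have hsub' := hball' z hz t
      refine Complex.norm_deriv_le_of_forall_mem_sphere_norm_le (by positivity) ?_
        fun w hw => hC w (hsub' (Metric.sphere_subset_closedBall hw))
      exact (hs.mono hsub').diffContOnCl_ball subset_rfl
    · refine Eventually.of_forall fun t z hz => ?_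
      have hz' : z - t ∈ strip := hball' z hz t (Metric.mem_closedBall_self (by positivity))
      have h1 := ((hs.differentiableAt (isOpen_strip.mem_nhds hz')).hasDerivAt.comp z
        ((hasDerivAt_id z).sub_const (t : ℂ))).const_mul (c t)
      simpa using h1
  · refine tendsto_integral_filter_of_dominated_convergence (fun t => ‖c t‖ * C) ?_ ?_ hInt ?_
    · filter_upwards [eventually_small] with ε hε
      exact hmeas _ (add_mul_I_mem_strip hε.1 hε.2)
    · filter_upwards [eventually_small] with ε hε
      exact Eventually.of_forall (hbd _ (add_mul_I_mem_strip hε.1 hε.2))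
    -- For each fixed `θ` the exceptional null set is only translated and reflected. So edges known
    -- almost everywhere before the convolution exist at every `θ` afterwards.
    · have : ∀ᵐ t : ℝ, Tendsto (fun ε : ℝ => s (((θ - t : ℝ) : ℂ) + ε * Complex.I)) (𝓝[>] 0)
          (𝓝 (r (θ - t))) :=
        (Measure.measurePreserving_sub_left volume θ).quasiMeasurePreserving.ae hr
      filter_upwards [this] with t ht
      refine (ht.congr fun ε => ?_).const_mul (c t)
      congr 1
      push_cast
      ring
  · refine tendsto_integral_filter_of_dominated_convergence (fun t => ‖c t‖ * C) ?_ ?_ hInt ?_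
    · filter_upwards [eventually_small] with ε hε
      exact hmeas _ (upper_mem_strip hε.1 hε.2)
    · filter_upwards [eventually_small] with ε hε
      exact Eventually.of_forall (hbd _ (upper_mem_strip hε.1 hε.2))
    · have : ∀ᵐ t : ℝ, Tendsto (fun ε : ℝ => s (Real.pi * Complex.I - ((t - θ : ℝ) : ℂ) -
          ε * Complex.I)) (𝓝[>] 0) (𝓝 (r' (t - θ))) :=
        (measurePreserving_sub_right volume θ).quasiMeasurePreserving.ae hr'
      filter_upwards [this] with t ht
      refine (ht.congr fun ε => ?_).const_mul (c t)
      congr 1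
      push_cast
      ring

end StripAnalysis

/-! ### Laplace transforms of half-line supported functions and the contour shift. -/

section HalfLine

/-- The shifted Laplace transform `w ↦ ∫ exp (i (u - a) w) g(u) du`. -/
def halfLaplace (a : ℝ) (g : 𝓢(ℝ, ℂ)) (w : ℂ) : ℂ :=
  ∫ u : ℝ, Complex.exp (Complex.I * (u - a) * w) * g u

variable {a : ℝ} {g : 𝓢(ℝ, ℂ)}

/-- On the support `u - a ≥ 0`, so the exponential has modulus at most one in the closed upper
half-plane. -/
theorem norm_exp_mul_le (hg : ∀ u, g u ≠ 0 → a ≤ u) {w : ℂ} (hw : 0 ≤ w.im) (u : ℝ) :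
    ‖Complex.exp (Complex.I * (u - a) * w) * g u‖ ≤ ‖g u‖ := by
  by_cases h : g u = 0
  · simp [h]
  · rw [norm_mul, Complex.norm_exp]
    refine mul_le_of_le_one_left (norm_nonneg _) (Real.exp_le_one_iff.2 ?_)
    have : (Complex.I * (u - a) * w).re = -((u - a) * w.im) := by simp
    rw [this, neg_nonpos]
    exact mul_nonneg (sub_nonneg.2 (hg u h)) hw

theorem integrable_exp_mul (hg : ∀ u, g u ≠ 0 → a ≤ u) {w : ℂ} (hw : 0 ≤ w.im) :
    Integrable fun u : ℝ => Complex.exp (Complex.I * (u - a) * w) * g u :=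
  g.integrable.norm.mono' (by have := g.continuous; fun_prop)
    (Eventually.of_forall (norm_exp_mul_le hg hw))

theorem norm_halfLaplace_le (hg : ∀ u, g u ≠ 0 → a ≤ u) {w : ℂ} (hw : 0 ≤ w.im) :
    ‖halfLaplace a g w‖ ≤ ∫ u, ‖g u‖ :=
  norm_integral_le_of_norm_le g.integrable.norm (Eventually.of_forall (norm_exp_mul_le hg hw))

theorem support_deriv (hg : ∀ u, g u ≠ 0 → a ≤ u) (u : ℝ)
    (h : SchwartzMap.derivCLM ℝ ℂ g u ≠ 0) : a ≤ u := by
  by_contra hu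
  refine h ?_
  rw [SchwartzMap.derivCLM_apply]
  have : (g : ℝ → ℂ) =ᶠ[𝓝 u] fun _ => 0 := by
    filter_upwards [Iio_mem_nhds (not_le.1 hu)] with x hx
    by_contra h'
    exact absurd (hg x h') (not_le.2 hx)
  rw [this.deriv_eq, deriv_const]

/-- Integration by parts over the whole line; integrability makes the boundary terms vanish. -/
theorem halfLaplace_deriv (hg : ∀ u, g u ≠ 0 → a ≤ u) {w : ℂ} (hw : 0 ≤ w.im) :
    halfLaplace a (SchwartzMap.derivCLM ℝ ℂ g) w = -(Complex.I * w) * halfLaplace a g w := by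
  have hu : ∀ x : ℝ, HasDerivAt (fun u : ℝ => Complex.exp (Complex.I * (u - a) * w))
      (Complex.I * w * Complex.exp (Complex.I * (x - a) * w)) x := by
    intro x
    have h1 : HasDerivAt (fun u : ℝ => Complex.I * (u - a) * w) (Complex.I * 1 * w) x :=
      (((Complex.ofRealCLM.hasDerivAt (x := x)).sub_const (a : ℂ)).const_mul Complex.I).mul_const w
    have := h1.cexp
    rw [mul_one, mul_comm] at this
    exact this
  have hInt := integrable_exp_mul hg hw
  have := integral_mul_deriv_eq_deriv_mul_of_integrable
    (u := fun u : ℝ => Complex.exp (Complex.I * (u - a) * w)) (v := g)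
    (u' := fun u : ℝ => Complex.I * w * Complex.exp (Complex.I * (u - a) * w))
    (v' := SchwartzMap.derivCLM ℝ ℂ g) (fun x _ => hu x)
    (fun x _ => g.hasDerivAt x)
    (integrable_exp_mul (support_deriv hg) hw)
    ((hInt.const_mul (Complex.I * w)).congr (Eventually.of_forall fun u => by
      simp [mul_assoc])) hInt
  rw [halfLaplace, this, halfLaplace, ← integral_const_mul, ← integral_neg]
  congr 1
  ext u
  ring

/-- Two derivatives of `g` give the factor `‖w‖²`; they are again supported in `u ≥ a`, so the
uniform bound applies to them too. -/
theorem exists_bound_halfLaplace (hg : ∀ u, g u ≠ 0 → a ≤ u) :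
    ∃ C, 0 ≤ C ∧ ∀ w : ℂ, 0 ≤ w.im → (1 + ‖w‖ ^ 2) * ‖halfLaplace a g w‖ ≤ C := by
  set g₂ := SchwartzMap.derivCLM ℝ ℂ (SchwartzMap.derivCLM ℝ ℂ g)
  refine ⟨(∫ u, ‖g u‖) + ∫ u, ‖g₂ u‖, add_nonneg (integral_nonneg fun _ => norm_nonneg _)
    (integral_nonneg fun _ => norm_nonneg _), fun w hw => ?_⟩
  have h1 := norm_halfLaplace_le hg hw
  have h2 := norm_halfLaplace_le (support_deriv (support_deriv hg)) hw
  rw [halfLaplace_deriv (support_deriv hg) hw, halfLaplace_deriv hg hw] at h2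
  simp only [norm_mul, norm_neg, Complex.norm_I, one_mul] at h2
  rw [add_mul, one_mul, sq, mul_assoc]
  exact add_le_add h1 h2

theorem continuousOn_halfLaplace (hg : ∀ u, g u ≠ 0 → a ≤ u) :
    ContinuousOn (halfLaplace a g) {w | 0 ≤ w.im} := by
  refine continuousOn_of_dominated (bound := fun u => ‖g u‖)
    (fun w hw => (integrable_exp_mul hg hw).1)
    (fun w hw => Eventually.of_forall (norm_exp_mul_le hg hw)) g.integrable.norm
    (Eventually.of_forall fun u => by fun_prop)

theorem differentiableOn_halfLaplace (hg : ∀ u, g u ≠ 0 → a ≤ u) :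
    DifferentiableOn ℂ (halfLaplace a g) {w | 0 < w.im} := by
  intro w hw
  have hopen : IsOpen {w : ℂ | 0 < w.im} := isOpen_lt continuous_const Complex.continuous_im
  have hcont := g.continuous
  have hder := hasDerivAt_integral_of_dominated_loc_of_deriv_le (μ := (volume : Measure ℝ))
    (F := fun (z : ℂ) (u : ℝ) => Complex.exp (Complex.I * (u - a) * z) * g u)
    (F' := fun (z : ℂ) (u : ℝ) => Complex.I * (u - a) *
      (Complex.exp (Complex.I * (u - a) * z) * g u))
    (x₀ := w) (bound := fun u => ‖u‖ ^ 1 * ‖g u‖ + |a| * ‖g u‖)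
    (hopen.mem_nhds hw) ?_ (integrable_exp_mul hg (le_of_lt hw)) ?_ ?_ ?_ ?_
  · exact hder.2.differentiableAt.differentiableWithinAt
  · filter_upwards [hopen.mem_nhds hw] with z hz using (integrable_exp_mul hg (le_of_lt hz)).1
  · fun_prop
  · refine Eventually.of_forall fun u z hz => ?_
    rw [norm_mul, norm_mul, Complex.norm_I, one_mul, ← add_mul, pow_one]
    refine mul_le_mul ?_ (norm_exp_mul_le hg (le_of_lt hz) u) (norm_nonneg _) (by positivity)
    rw [← Complex.ofReal_sub, Complex.norm_real]
    exact norm_sub_le u a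
  · exact (g.integrable_pow_mul volume 1).add (g.integrable.norm.const_mul _)
  · refine Eventually.of_forall fun u z hz => ?_
    have h1 : HasDerivAt (fun z : ℂ => Complex.I * (u - a) * z) (Complex.I * (u - a) * 1) z :=
      (hasDerivAt_id z).const_mul _
    exact ((h1.cexp).mul_const (g u)).congr_deriv (by ring)

/-- The reflected test function `u ↦ f(-u)`. -/
def reflect (f : 𝓢(ℝ, ℂ)) : 𝓢(ℝ, ℂ) :=
  SchwartzMap.compCLMOfContinuousLinearEquiv ℝ (ContinuousLinearEquiv.neg ℝ) f

theorem reflect_apply (f : 𝓢(ℝ, ℂ)) (u : ℝ) : reflect f u = f (-u) := rfl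

/-- The two shifts by `a` contribute opposite phases and cancel. The split point matters for the
bounds only. -/
theorem halfLaplace_mul_reflect (a : ℝ) (f g : 𝓢(ℝ, ℂ)) (w : ℂ) :
    halfLaplace (-a) (reflect f) w * halfLaplace a g w =
      (∫ u : ℝ, Complex.exp (-(Complex.I * u * w)) * f u) *
        ∫ u : ℝ, Complex.exp (Complex.I * u * w) * g u := by
  have h1 : halfLaplace (-a) (reflect f) w =
      Complex.exp (Complex.I * a * w) * ∫ u : ℝ, Complex.exp (-(Complex.I * u * w)) * f u := by
    rw [halfLaplace, ← integral_neg_eq_self, ← integral_const_mul]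
    congr 1
    ext u
    rw [reflect_apply, neg_neg, ← mul_assoc, ← Complex.exp_add]
    congr 2
    push_cast
    ring
  have h2 : halfLaplace a g w =
      Complex.exp (-(Complex.I * a * w)) * ∫ u : ℝ, Complex.exp (Complex.I * u * w) * g u := by
    rw [halfLaplace, ← integral_const_mul]
    congr 1
    ext u
    rw [← mul_assoc, ← Complex.exp_add]
    congr 2
    ring
  rw [h1, h2, mul_mul_mul_comm, ← Complex.exp_add, add_neg_cancel, Complex.exp_zero, one_mul]

/-- The left side is `(e^x + e^{-x})⁻²`, which is at most `e^{-2|x|}`. It supplies the integrable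
decay required in the contour shift. -/
theorem exp_sq_div_le (x : ℝ) :
    Real.exp x ^ 2 / (1 + Real.exp x ^ 2) ^ 2 ≤ (1 + x ^ 2)⁻¹ := by
  rw [← one_div, div_le_div_iff₀ (by positivity) (by positivity), one_mul]
  have h1 : Real.exp |x| ≤ Real.exp x + Real.exp (-x) := by
    rcases abs_cases x with ⟨h, -⟩ | ⟨h, -⟩ <;> rw [h]
    · linarith [Real.exp_pos (-x)]
    · linarith [Real.exp_pos x]
  have h2 : 1 + x ^ 2 ≤ Real.exp |x| ^ 2 := by
    have := Real.quadratic_le_exp_of_nonneg (abs_nonneg x)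
    rw [sq_abs] at this
    nlinarith [abs_nonneg x, sq_nonneg x, sq_abs x]
  have h3 : 1 + Real.exp x ^ 2 = Real.exp x * (Real.exp x + Real.exp (-x)) := by
    rw [mul_add, ← Real.exp_add x (-x), add_neg_cancel, Real.exp_zero]; ring
  rw [h3, mul_pow]
  have h4 : Real.exp |x| ^ 2 ≤ (Real.exp x + Real.exp (-x)) ^ 2 :=
    pow_le_pow_left₀ (Real.exp_pos _).le h1 2
  exact mul_le_mul_of_nonneg_left (h2.trans h4) (by positivity)

/-- Contour shift for test functions with ordered supports. -/
theorem integral_fpm_mul {f g : 𝓢(ℝ, ℂ)}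
    (hfg : ∀ u ∈ Function.support f, ∀ u' ∈ Function.support g, u < u') {m m' : ℝ → ℂ}
    (hm : StripPair m m') :
    ∫ θ, fpm (-1) f θ * (fpm 1 g θ * m θ) = ∫ θ, fpm 1 f θ * (fpm (-1) g θ * m' θ) := by
  -- The zero cases are set aside because the separating point is the supremum of the support of
  -- `f`, which must be nonempty and bounded above.
  by_cases hf0 : f = 0
  · subst hf0; simp [fpm]
  by_cases hg0 : g = 0
  · subst hg0; simp [fpm]
  obtain ⟨u₀, hu₀⟩ : ∃ u, f u ≠ 0 := by
    by_contra! h; exact hf0 (SchwartzMap.ext h)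
  obtain ⟨u₁, hu₁⟩ : ∃ u, g u ≠ 0 := by
    by_contra! h; exact hg0 (SchwartzMap.ext h)
  set a := sSup (Function.support f) with ha
  have hga : ∀ u, g u ≠ 0 → a ≤ u := fun u hu => csSup_le ⟨u₀, hu₀⟩ fun x hx => (hfg x hx u hu).le
  have hfa : ∀ u, reflect f u ≠ 0 → -a ≤ u := fun u hu => by
    rw [neg_le]
    exact le_csSup ⟨u₁, fun x hx => (hfg x hx u₁ hu₁).le⟩ hu
  obtain ⟨M, hM, ⟨C, hC⟩, hm1, hm2⟩ := hm
  obtain ⟨C₁, hC₁, hL₁⟩ := exists_bound_halfLaplace hfa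
  obtain ⟨C₂, hC₂, hL₂⟩ := exists_bound_halfLaplace hga
  have him : ∀ ζ ∈ strip, 0 < (Complex.exp ζ).im := by
    intro ζ hζ
    rw [Complex.exp_im]
    exact mul_pos (Real.exp_pos _) (Real.sin_pos_of_pos_of_lt_pi hζ.1 hζ.2)
  -- The substitution `w = exp ζ` maps the strip into the upper half-plane, with lower edge `e^θ`
  -- and upper edge `-e^θ`. The factor `w²` collects the prefactors `±i e^θ` of the two test
  -- functions and gives decay as `Re ζ → -∞`; the transforms decay as `Re ζ → ∞`.
  let P : ℂ → ℂ := fun w => w ^ 2 * (halfLaplace (-a) (reflect f) w * halfLaplace a g w)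
  have hPc : ContinuousOn P {w | 0 ≤ w.im} :=
    (continuousOn_id.pow 2).mul ((continuousOn_halfLaplace hfa).mul (continuousOn_halfLaplace hga))
  -- `s = -1` is the lower edge, with value `f⁻ g⁺`; `s = 1` is the upper edge, with value `f⁺ g⁻`.
  -- The product of the prefactors is `-s² i² = 1` times `e^{2θ}`.
  have hP : ∀ s θ : ℝ, s ^ 2 = 1 →
      P (-(s * Real.exp θ)) = fpm s f θ * fpm (-s) g θ := by
    intro s θ hs
    have hs' : (s : ℂ) ^ 2 = 1 := by exact_mod_cast hs
    simp only [P, halfLaplace_mul_reflect, fpm]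
    have e1 : ∀ u : ℝ, -(((-s : ℝ) : ℂ) * Complex.I * u * Real.exp θ) =
      s * Complex.I * u * Real.exp θ := fun u => by push_cast; ring
    have e2 : ∀ u : ℝ, Complex.I * u * -(s * (Real.exp θ : ℂ)) =
      ((-s : ℝ) : ℂ) * Complex.I * u * Real.exp θ := fun u => by push_cast; ring
    simp only [e2, e1]
    set A := ∫ u : ℝ, Complex.exp (s * Complex.I * u * Real.exp θ) * f u
    set B := ∫ u : ℝ, Complex.exp (((-s : ℝ) : ℂ) * Complex.I * u * Real.exp θ) * g u
    push_cast
    linear_combination ((s : ℂ) ^ 2 * (Complex.exp θ) ^ 2 * A * B) * Complex.I_sq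
  have hlim : ∀ (w₀ : ℂ), 0 ≤ w₀.im → ∀ z : ℝ → ℂ, (∀ᶠ ε in 𝓝[>] (0 : ℝ), z ε ∈ strip) →
      Tendsto (fun ε => Complex.exp (z ε)) (𝓝[>] 0) (𝓝 w₀) →
      Tendsto (fun ε => P (Complex.exp (z ε))) (𝓝[>] 0) (𝓝 (P w₀)) := by
    intro w₀ hw₀ z hz hzl
    refine (hPc w₀ hw₀).tendsto.comp (tendsto_nhdsWithin_iff.2 ⟨hzl, ?_⟩)
    filter_upwards [hz] with ε hε using (him _ hε).le
  have key := integral_boundary_eq (M := fun ζ => P (Complex.exp ζ) * M ζ) (C := C₁ * C₂ * C)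
    (a := fun θ => fpm (-1) f θ * fpm 1 g θ * m θ) (b := fun θ => fpm 1 f θ * fpm (-1) g θ * m' θ)
    ?_ ?_ ?_ ?_
  · simpa only [mul_assoc] using key
  · refine DifferentiableOn.mul ?_ hM
    have hPd : DifferentiableOn ℂ P {w | 0 < w.im} :=
      (differentiableOn_id.pow 2).mul
        ((differentiableOn_halfLaplace hfa).mul (differentiableOn_halfLaplace hga))
    exact hPd.comp Complex.differentiable_exp.differentiableOn him
  · intro ζ hζ
    have h1 := hL₁ _ (him ζ hζ).le
    have h2 := hL₂ _ (him ζ hζ).le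
    have h3 := hC ζ hζ
    have hC0 := (norm_nonneg _).trans h3
    rw [Complex.norm_exp] at h1 h2
    set e := Real.exp ζ.re
    have he : 0 < 1 + e ^ 2 := by positivity
    rw [mul_comm, ← le_div_iff₀ he] at h1 h2
    rw [norm_mul, norm_mul, norm_mul, norm_pow, Complex.norm_exp]
    calc e ^ 2 * (‖halfLaplace (-a) (reflect f) (Complex.exp ζ)‖ *
          ‖halfLaplace a g (Complex.exp ζ)‖) * ‖M ζ‖
        ≤ e ^ 2 * (C₁ / (1 + e ^ 2) * (C₂ / (1 + e ^ 2))) * C := by gcongr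
      _ = C₁ * C₂ * C * (e ^ 2 / (1 + e ^ 2) ^ 2) := by field_simp
      _ ≤ _ := mul_le_mul_of_nonneg_left (exp_sq_div_le ζ.re) (by positivity)
  · intro θ
    refine Tendsto.mul ?_ (hm1 θ)
    have h := hlim (-(((-1 : ℝ) : ℂ) * Real.exp θ)) (by simp [Complex.exp_ofReal_im])
      (fun ε : ℝ => θ + ε * Complex.I)
      (eventually_small.mono fun ε hε => add_mul_I_mem_strip hε.1 hε.2) ?_
    · rw [hP (-1) θ (by norm_num)] at h
      simpa using h
    · have : Tendsto (fun ε : ℝ => Complex.exp (θ + ε * Complex.I)) (𝓝 0)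
          (𝓝 (Complex.exp (θ + (0 : ℝ) * Complex.I))) :=
        Continuous.tendsto (by fun_prop) 0
      simpa using this.mono_left nhdsWithin_le_nhds
  · intro θ
    refine Tendsto.mul ?_ (hm2 θ)
    have h := hlim (-(((1 : ℝ) : ℂ) * Real.exp θ)) (by simp [Complex.exp_ofReal_im])
      (fun ε : ℝ => θ + Real.pi * Complex.I - ε * Complex.I)
      (eventually_small.mono fun ε hε => upper_mem_strip hε.1 hε.2) ?_
    · rw [hP 1 θ (by norm_num)] at h
      simpa using h
    · have : Tendsto (fun ε : ℝ => Complex.exp (θ + Real.pi * Complex.I - ε * Complex.I)) (𝓝 0)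
          (𝓝 (Complex.exp (θ + Real.pi * Complex.I - (0 : ℝ) * Complex.I))) :=
        Continuous.tendsto (by fun_prop) 0
      simpa [Complex.exp_add, Complex.exp_pi_mul_I] using this.mono_left nhdsWithin_le_nhds

end HalfLine

/-! ### Crossing of the one-particle operators and commutation of the fields. -/

section Crossing

variable {K : Type u} [NormedAddCommGroup K] [InnerProductSpace ℂ K] [CompleteSpace K]
  {G : Type v} [Group G] {V : G →* (K ≃ₗᵢ[ℂ] K)} {Γ : Conjugation K} (R : YBFunction V Γ)

/-- Boundedness of `m` puts `m q` in `L²`, where it is determined by its inner products. -/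
theorem ae_eq_mul_of_inner {Y q : Lp ℂ 2 (volume : Measure ℝ)} {m : ℝ → ℂ}
    (hm : AEStronglyMeasurable m volume) {C : ℝ} (hC : ∀ θ, ‖m θ‖ ≤ C)
    (h : ∀ p : Lp ℂ 2 (volume : Measure ℝ), inner ℂ p Y = ∫ θ, inner ℂ (p θ) (q θ) * m θ) :
    Y =ᵐ[volume] fun θ => m θ * q θ := by
  have hmem : MemLp (fun θ => m θ * q θ) 2 (volume : Measure ℝ) := by
    refine (Lp.memLp q).of_le_mul (c := C) (hm.mul (Lp.aestronglyMeasurable q))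
      (Eventually.of_forall fun θ => ?_)
    rw [norm_mul]
    exact mul_le_mul_of_nonneg_right (hC θ) (norm_nonneg _)
  have : Y = hmem.toLp _ := by
    refine ext_inner_left ℂ fun p => ?_
    rw [h, L2.inner_def]
    refine integral_congr_ae ?_
    filter_upwards [hmem.coeFn_toLp] with θ hθ
    rw [hθ]
    simp only [RCLike.inner_apply]
    ring
  rw [this]
  exact hmem.coeFn_toLp

/-- The partial matrix elements of the two-particle operator between elementary vectors are given
by convolutions. -/
theorem inner_partialElem_tensorL (e e' x y : K) (h h' p q : Lp ℂ 2 (volume : Measure ℝ)) :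
    inner ℂ p (ContinuousLinearMap.adjoint (tensorL e)
      (partialElem R.op (tensorL x h) (tensorL y h') (tensorL e' q))) =
    ∫ θ, inner ℂ (p θ) (q θ) * ∫ t, inner ℂ (h t) (h' t) *
      inner ℂ (tmul e x) (R.toFun (θ - t) (tmul y e')) := by
  rw [ContinuousLinearMap.adjoint_inner_right, inner_partialElem, ← inner_twoPMap, L2.inner_def]
  have hInt := L2.integrable_inner (𝕜 := ℂ) (twoPMap K (tmul (tensorL e p) (tensorL x h)))
    (twoPMap K (R.op (tmul (tensorL y h') (tensorL e' q))))
  have hae : (fun z : ℝ × ℝ => inner ℂ (twoPMap K (tmul (tensorL e p) (tensorL x h)) z)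
      (twoPMap K (R.op (tmul (tensorL y h') (tensorL e' q))) z)) =ᵐ[volume]
      fun z => inner ℂ (p z.1) (q z.1) * (inner ℂ (h z.2) (h' z.2) *
        inner ℂ (tmul e x) (R.toFun (z.1 - z.2) (tmul y e'))) := by
    filter_upwards [twoPMap_op_coeFn R (tmul (tensorL y h') (tensorL e' q)),
      prodTensor_coeFn (tensorL e p) (tensorL x h),
      ae_swap (prodTensor_coeFn (tensorL y h') (tensorL e' q)),
      ae_fst (tensorL_coeFn e p), ae_snd (tensorL_coeFn x h), ae_snd (tensorL_coeFn y h'),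
      ae_fst (tensorL_coeFn e' q)] with z h1 h2 h3 h4 h5 h6 h7
    rw [h1, twoPMap_tmul, twoPMap_tmul, h2, h3, Prod.fst_swap, Prod.snd_swap, h4, h5, h6, h7]
    simp only [smul_tmul, tmul_smul, map_smul, inner_smul_left, inner_smul_right,
      RCLike.inner_apply]
    ring
  rw [integral_congr_ae hae]
  refine (integral_prod _ (hInt.congr hae)).trans ?_
  simp only [integral_const_mul]

omit [CompleteSpace K] in
-- Unitarity and `R(-θ) R(θ) = 1` give `R(-θ) = R(θ)*`.
theorem inner_toFun_neg : ∀ᵐ θ : ℝ, ∀ v w : HTensor K K,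
    inner ℂ v (R.toFun (-θ) w) = inner ℂ (R.toFun θ v) w := by
  filter_upwards [R.isUnitary, R.inverse] with θ h1 h2 v w
  have h3 : R.toFun (-θ) = star (R.toFun θ) := by
    calc R.toFun (-θ) = R.toFun (-θ) * (R.toFun θ * star (R.toFun θ)) := by
          rw [Unitary.mul_star_self_of_mem h1, mul_one]
      _ = star (R.toFun θ) := by rw [← mul_assoc, h2.1, one_mul]
  rw [h3, ContinuousLinearMap.star_eq_adjoint, ContinuousLinearMap.adjoint_inner_right]

variable {R}

/-- Crossing symmetry of the partial matrix elements between elementary vectors. -/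
theorem exists_stripPair_partialElem (hR : R.CrossingSymmetric) (e e' x y : K)
    (h h' : Lp ℂ 2 (volume : Measure ℝ)) :
    ∃ m m' : ℝ → ℂ, StripPair m m' ∧
      (∀ q, ContinuousLinearMap.adjoint (tensorL e)
        (partialElem R.op (tensorL x h) (tensorL y h') (tensorL e' q)) =ᵐ[volume]
          fun θ => m θ * q θ) ∧
      ∀ q, ContinuousLinearMap.adjoint (tensorL (Γ.map e))
        (partialElem R.op (tensorL y h') (tensorL x h) (tensorL (Γ.map e') q)) =ᵐ[volume]
          fun θ => conj (m' θ) * q θ := by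
  obtain ⟨S, hS, ⟨C, hC⟩, hlow, hup⟩ := hR
  have hs : DifferentiableOn ℂ (fun ζ => inner ℂ (tmul e x) (S ζ (tmul y e'))) strip :=
    (innerSL ℂ (tmul e x)).differentiable.comp_differentiableOn
      (hS.clm_apply (differentiableOn_const _))
  have hbd : ∀ ζ ∈ strip, ‖(inner ℂ (tmul e x) (S ζ (tmul y e')) : ℂ)‖ ≤
      ‖tmul e x‖ * (C * ‖tmul y e'‖) := fun ζ hζ =>
    (norm_inner_le_norm _ _).trans (mul_le_mul_of_nonneg_left
      (((S ζ).le_opNorm _).trans (mul_le_mul_of_nonneg_right (hC ζ hζ) (norm_nonneg _)))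
      (norm_nonneg _))
  -- At `θ + iπ` the argument shifted by `t` is `iπ - (t - θ)`, so crossing applies with `t - θ` in
  -- place of the real variable.
  have hpair := stripPair_convolution (L2.integrable_inner (𝕜 := ℂ) h h') hs hbd
    (hlow (tmul e x) (tmul y e')) (hup e x y e')
  obtain ⟨hm1, C₁, hC₁⟩ := hpair.bounded_left
  obtain ⟨hm2, C₂, hC₂⟩ := hpair.bounded_right
  refine ⟨_, _, hpair, fun q => ?_, fun q => ?_⟩
  · exact ae_eq_mul_of_inner hm1 hC₁ fun p => inner_partialElem_tensorL R e e' x y h h' p q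
  · refine ae_eq_mul_of_inner (Complex.continuous_conj.comp_aestronglyMeasurable hm2)
      (fun θ => (RCLike.norm_conj _).trans_le (hC₂ θ)) fun p => ?_
    rw [inner_partialElem_tensorL R]
    congr 1
    ext θ
    congr 1
    rw [← integral_conj]
    refine integral_congr_ae ?_
    -- Crossing produces `R(t - θ)`, while the swapped partial element contains `R(θ - t)`. Passing
    -- to the adjoint reconciles them and produces the complex conjugate of `m'`.
    have : ∀ᵐ t : ℝ, ∀ v w : HTensor K K, inner ℂ v (R.toFun (-(θ - t)) w) =
        inner ℂ (R.toFun (θ - t) v) w :=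
      (Measure.measurePreserving_sub_left volume θ).quasiMeasurePreserving.ae (inner_toFun_neg R)
    filter_upwards [this] with t ht
    rw [map_mul, inner_conj_symm, inner_conj_symm, ← neg_sub θ t]
    congr 1
    rw [← inner_conj_symm, ← ht, inner_conj_symm]

theorem sum_ae_eq {ι : Type*} (F : Finset ι) {q : ι → Lp ℂ 2 (volume : Measure ℝ)}
    {w : ι → ℝ → ℂ} (h : ∀ i, q i =ᵐ[volume] w i) :
    (∑ i ∈ F, q i : Lp ℂ 2 (volume : Measure ℝ)) =ᵐ[volume] fun θ => ∑ i ∈ F, w i θ := by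
  classical
  induction F using Finset.induction_on with
  | empty =>
    simp only [Finset.sum_empty]
    exact Lp.coeFn_zero ℂ 2 (volume : Measure ℝ)
  | insert i F hi ih =>
    simp only [Finset.sum_insert hi]
    filter_upwards [Lp.coeFn_add (q i) (∑ j ∈ F, q j), h i, ih] with θ h1 h2 h3
    rw [h1, Pi.add_apply, h2, h3]

/-- Between fibre vectors the truncated product is a finite sum over intermediate basis vectors of
products of scalar multipliers. Crossing replaces each fibre vector by its image under `Γ`, hence
the conjugated basis on the other side. The vector `e` is general because the recursion ends at
basis vectors. -/
theorem exists_stripPair_monodromy (hR : R.CrossingSymmetric) {ι : Type*} (b : ι → K)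
    (F : Finset ι) (k : K) (g g' : Lp ℂ 2 (volume : Measure ℝ)) (l : List (OneP K × OneP K))
    (hl : ∀ p ∈ l, p.1 ∈ elementary K ∧ p.2 ∈ elementary K) (e : K) :
    ∃ m m' : ℝ → ℂ, StripPair m m' ∧
      (ContinuousLinearMap.adjoint (tensorL e)
        (monodromy R.op (fibreProj b F) l (tensorL k g)) =ᵐ[volume] fun θ => m θ * g θ) ∧
      (ContinuousLinearMap.adjoint (tensorL (Γ.map e))
        (monodromy R.op (fibreProj (fun i => Γ.map (b i)) F) (l.map Prod.swap)
          (tensorL (Γ.map k) g')) =ᵐ[volume] fun θ => conj (m' θ) * g' θ) := by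
  induction l generalizing e with
  | nil =>
    refine ⟨_, _, StripPair.const (inner ℂ e k), ?_, ?_⟩
    · simp only [monodromy, ContinuousLinearMap.id_apply, adjoint_tensorL_tensorL]
      exact Lp.coeFn_smul _ _
    · simp only [monodromy, List.map_nil, ContinuousLinearMap.id_apply, adjoint_tensorL_tensorL,
        inner_conj_conj, inner_conj_symm]
      exact Lp.coeFn_smul _ _
  | cons p l ih =>
    obtain ⟨⟨h, x, hx⟩, ⟨h', y, hy⟩⟩ := hl p (List.mem_cons_self)
    choose a a' ha hu hw using fun i => ih (fun q hq => hl q (List.mem_cons_of_mem _ hq)) (b i)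
    choose c c' hc hcu hcw using fun i => exists_stripPair_partialElem hR e (b i) x y h h'
    refine ⟨_, _, StripPair.sum F fun i => (hc i).mul (ha i), ?_, ?_⟩
    · simp only [monodromy, ContinuousLinearMap.comp_apply, fibreProj_apply, map_sum, hx, hy,
        Finset.sum_mul]
      refine sum_ae_eq F fun i => ?_
      filter_upwards [hcu i _, hu i] with θ h1 h2
      rw [h1, h2, mul_assoc]
    · simp only [monodromy, List.map_cons, Prod.fst_swap, Prod.snd_swap,
        ContinuousLinearMap.comp_apply, fibreProj_apply, map_sum, map_mul, hx, hy, Finset.sum_mul]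
      refine sum_ae_eq F fun i => ?_
      filter_upwards [hcw i _, hw i] with θ h1 h2
      rw [h1, h2, mul_assoc]

omit [CompleteSpace K] in
-- The antilinear involution `Γ` carries the expansion of `Γ x` in the basis to that of `x` in the
-- conjugated basis.
theorem hasSum_conj_basis {ι : Type*} {b : ι → K}
    (hb : ∀ x, HasSum (fun i => inner ℂ (b i) x • b i) x) (x : K) :
    HasSum (fun i => inner ℂ (Γ.map (b i)) x • Γ.map (b i)) x := by
  have h := (hb (Γ.map x)).mapL Γ.map.toContinuousLinearMap
  simp only [LinearIsometry.coe_toContinuousLinearMap, Γ.involutive] at h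
  convert h using 2 with i
  rw [map_smulₛₗ, inner_conj_symm, ← inner_conj_conj Γ.map (b i), Γ.involutive]

omit [CompleteSpace K] in
theorem orthonormal_conj {ι : Type*} {b : ι → K} (hb : Orthonormal ℂ b) :
    Orthonormal ℂ fun i => Γ.map (b i) :=
  ⟨fun i => by rw [LinearIsometry.norm_map, hb.1 i], fun i j hij => by
    change inner ℂ (Γ.map (b i)) (Γ.map (b j)) = 0
    rw [inner_conj_conj, hb.2 hij.symm]⟩

/-- Crossing symmetry for products of partial matrix elements, smeared with test functions that
have ordered supports. -/
theorem inner_monodromy_eq (hR : R.CrossingSymmetric) {f g : 𝓢(ℝ, ℂ)}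
    (hfg : ∀ u ∈ Function.support f, ∀ u' ∈ Function.support g, u < u') (k k' : K)
    (l : List (OneP K × OneP K)) (hl : ∀ p ∈ l, p.1 ∈ elementary K ∧ p.2 ∈ elementary K) :
    inner ℂ (tensorL (Γ.map k) (star (fMinus f)))
      (monodromy R.op (ContinuousLinearMap.id ℂ _) l (tensorL k' (fPlus g))) =
    inner ℂ (monodromy R.op (ContinuousLinearMap.id ℂ _) (l.map Prod.swap)
      (tensorL (Γ.map k') (star (fMinus g)))) (tensorL k (fPlus f)) := by
  obtain ⟨I, b, -⟩ := exists_hilbertBasis ℂ K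
  have hsum : ∀ x, HasSum (fun i => inner ℂ (b i) x • b i) x := fun x => by
    simpa only [b.repr_apply_apply] using b.hasSum_repr x
  have hon := b.orthonormal
  have h1 := tendsto_monodromy R.op (fun F => norm_fibreProj_le hon F)
    (fun x => tendsto_fibreProj hon hsum x) l (tensorL k' (fPlus g))
  have h2 := tendsto_monodromy R.op (fun F => norm_fibreProj_le (orthonormal_conj (Γ := Γ) hon) F)
    (fun x => tendsto_fibreProj (orthonormal_conj hon) (hasSum_conj_basis hsum) x)
    (l.map Prod.swap) (tensorL (Γ.map k') (star (fMinus g)))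
  -- Both sides are limits over finite sets `F` of basis vectors, so it suffices to compare them for
  -- each truncation.
  refine tendsto_nhds_unique (tendsto_const_nhds.inner h1)
    ((h2.inner tendsto_const_nhds).congr fun F => ?_)
  -- The choice `e = Γ k` makes the opposite side end at `Γ (Γ k) = k`, as required.
  obtain ⟨m, m', hm, hu, hw⟩ := exists_stripPair_monodromy hR b F k' (fPlus g) (star (fMinus g)) l hl
    (Γ.map k)
  rw [Γ.involutive] at hw
  rw [← ContinuousLinearMap.adjoint_inner_right (tensorL (Γ.map k)),
    ← ContinuousLinearMap.adjoint_inner_left (tensorL k), L2.inner_def, L2.inner_def]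
  have hkey := integral_fpm_mul hfg hm
  have hfp := (memLp_fpm (Or.inl rfl) f).coeFn_toLp
  have hfm := (memLp_fpm (Or.inr rfl) f).coeFn_toLp
  have hgp := (memLp_fpm (Or.inl rfl) g).coeFn_toLp
  have hgm := (memLp_fpm (Or.inr rfl) g).coeFn_toLp
  have e1 : ∫ θ, fpm (-1) f θ * (fpm 1 g θ * m θ) = ∫ θ, inner ℂ ((star (fMinus f) :
      Lp ℂ 2 (volume : Measure ℝ)) θ) (ContinuousLinearMap.adjoint (tensorL (Γ.map k))
        (monodromy R.op (fibreProj b F) l (tensorL k' (fPlus g))) θ) := by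
    refine integral_congr_ae ?_
    filter_upwards [hu, Lp.coeFn_star (fMinus f), hfm, hgp] with θ h1 h2 h3 h4
    rw [h1, h2, Pi.star_apply, fMinus, fPlus, h3, h4]
    simp only [RCLike.inner_apply, RCLike.star_def, Complex.conj_conj]
    ring
  have e2 : ∫ θ, fpm 1 f θ * (fpm (-1) g θ * m' θ) = ∫ θ, inner ℂ
      (ContinuousLinearMap.adjoint (tensorL k) (monodromy R.op (fibreProj (fun i => Γ.map (b i)) F)
        (l.map Prod.swap) (tensorL (Γ.map k') (star (fMinus g)))) θ) (fPlus f θ) := by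
    refine integral_congr_ae ?_
    filter_upwards [hw, Lp.coeFn_star (fMinus g), hfp, hgm] with θ h1 h2 h3 h4
    rw [h1, h2, Pi.star_apply, fMinus, fPlus, h3, h4]
    simp only [RCLike.inner_apply, RCLike.star_def, map_mul, Complex.conj_conj]
    ring
  rw [← e1, ← e2, hkey]

omit [CompleteSpace K] in
theorem oneTCP_tensorL (e : K) (h : Lp ℂ 2 (volume : Measure ℝ)) :
    oneTCP Γ (tensorL e h) = tensorL (Γ.map e) (star h) := by
  refine Lp.ext ?_
  filter_upwards [oneTCP_coeFn (Γ := Γ) (tensorL e h), tensorL_coeFn e h,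
    tensorL_coeFn (Γ.map e) (star h), Lp.coeFn_star h] with θ h1 h2 h3 h4
  rw [h1, h2, h3, h4, map_smulₛₗ]
  rfl

/-- Conjugation reverses the phase and substituting `-u` restores it. The prefactor `i` leaves a
minus sign. -/
theorem conj_fpm_tcpTest (s : ℝ) (g : 𝓢(ℝ, ℂ)) (θ : ℝ) :
    conj (fpm s (tcpTest g) θ) = -fpm s g θ := by
  simp only [fpm, map_mul, ← integral_conj, Complex.conj_ofReal, Complex.conj_I, tcpTest_apply,
    Complex.conj_conj, ← Complex.exp_conj]
  rw [← integral_neg_eq_self]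
  simp only [neg_neg, Complex.ofReal_neg]
  have : ∀ u : ℝ, (s : ℂ) * -Complex.I * -u * Real.exp θ = s * Complex.I * u * Real.exp θ :=
    fun u => by ring
  simp only [this]
  ring

theorem star_fPlus_tcpTest (g : 𝓢(ℝ, ℂ)) : star (fPlus (tcpTest g)) = -fPlus g := by
  refine Lp.ext ?_
  filter_upwards [Lp.coeFn_star (fPlus (tcpTest g)), Lp.coeFn_neg (fPlus g),
    (memLp_fpm (Or.inl rfl) g).coeFn_toLp, (memLp_fpm (Or.inl rfl) (tcpTest g)).coeFn_toLp]
    with θ h1 h2 h3 h4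
  rw [h1, h2, Pi.star_apply, Pi.neg_apply, fPlus, fPlus, h3, h4]
  exact conj_fpm_tcpTest 1 g θ

theorem fMinus_tcpTest (g : 𝓢(ℝ, ℂ)) : fMinus (tcpTest g) = -star (fMinus g) := by
  refine Lp.ext ?_
  filter_upwards [Lp.coeFn_star (fMinus g), Lp.coeFn_neg (star (fMinus g)),
    (memLp_fpm (Or.inr rfl) g).coeFn_toLp, (memLp_fpm (Or.inr rfl) (tcpTest g)).coeFn_toLp]
    with θ h1 h2 h3 h4
  rw [h2, Pi.neg_apply, h1, Pi.star_apply, fMinus, fMinus, h3, h4, ← Complex.conj_conj (fpm _ (tcpTest g) θ),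
    conj_fpm_tcpTest, map_neg]
  rfl

/-- The minus sign appears in both the creation and the annihilation vector, so it cancels in the
crossing relation between the exchange operators. -/
theorem tcpField_eq (R : YBFunction V Γ) (k' : K) (g : 𝓢(ℝ, ℂ)) (Ψ : finPart R.op) :
    tcpField R k' g Ψ =
      (raiseOp R.op (createRightN R.op (-tensorL k' (fPlus g))) + lowerOp R.op fun n =>
        ContinuousLinearMap.adjoint
          (createRightN R.op (-tensorL (Γ.map k') (star (fMinus g))) n)) Ψ := by
  have e1 : oneTCP Γ (tensorVec (fPlus (tcpTest g)) (Γ.map k')) = -tensorL k' (fPlus g) := by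
    rw [← tensorL_apply, oneTCP_tensorL, star_fPlus_tcpTest, Γ.involutive, map_neg]
  have e2 : oneTCP Γ (tensorVec (star (fMinus (tcpTest g))) (Γ.map (Γ.map k'))) =
      -tensorL (Γ.map k') (star (fMinus g)) := by
    rw [← tensorL_apply, oneTCP_tensorL, star_star, fMinus_tcpTest, Γ.involutive, map_neg]
  rw [← e1, ← e2]
  exact secondQuantConj_conj oneTCP_oneTCP (op_tcp R) (adjoint_op R)
    (tensorVec (fPlus (tcpTest g)) (Γ.map k'))
    (tensorVec (star (fMinus (tcpTest g))) (Γ.map (Γ.map k'))) Ψ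

theorem field_tcpField_comm (hR : R.CrossingSymmetric) {f g : 𝓢(ℝ, ℂ)}
    (hfg : ∀ u ∈ Function.support f, ∀ u' ∈ Function.support g, u < u') (k k' : K)
    (Ψ : finPart R.op) :
    field R k f (tcpField R k' g Ψ) = tcpField R k' g (field R k f Ψ) := by
  have h : ∀ n, exchangeOp R.op (tensorL (Γ.map k) (star (fMinus f))) (-tensorL k' (fPlus g)) n =
      ContinuousLinearMap.adjoint (exchangeOp R.op (tensorL k (fPlus f))
        (-tensorL (Γ.map k') (star (fMinus g))) n) := by
    refine exchangeOp_eq_adjoint R.op (span_elementary K) fun l hl => ?_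
    rw [map_neg, map_neg, inner_neg_left, inner_neg_right]
    exact congrArg Neg.neg (inner_monodromy_eq hR hfg k k' l hl)
  rw [tcpField_eq R k' g Ψ, tcpField_eq R k' g (field R k f Ψ)]
  exact field_comm_of_exchange (adjoint_op R) (op_comp_op R) (braided_op R) h Ψ

end Crossing

end YangBaxterQFT

end

theorem mainTheorem3 {G : Type v} [Group G]
    {K : Type u} [NormedAddCommGroup K] [InnerProductSpace ℂ K] [CompleteSpace K]
    (V : G →* (K ≃ₗᵢ[ℂ] K)) (Γ : YangBaxterQFT.Conjugation K)
    (R : YangBaxterQFT.YBFunction V Γ) (hR : R.CrossingSymmetric)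
    (k k' : K) (f g : 𝓢(ℝ, ℂ))
    (hfg : ∀ u ∈ Function.support f, ∀ u' ∈ Function.support g, u < u')
    (Ψ : YangBaxterQFT.finPart R.op) :
    YangBaxterQFT.field R k f (YangBaxterQFT.tcpField R k' g Ψ) -
      YangBaxterQFT.tcpField R k' g (YangBaxterQFT.field R k f Ψ) = 0 :=
  sub_eq_zero.2 (YangBaxterQFT.field_tcpField_comm hR hfg k k' Ψ)
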